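/- Let $O=(Z,A,Y,L)$ be the observed data, with instrument $Z$, binary treatment $A\in\{0,1\}$, real outcome $Y$ with $\mathbb{E}[Y^2]<\infty$ and covariates $L$; let $U$ be latent confounders and $Y(0),Y(1)$ potential outcomes. Assume consistency ($Y=Y(A)$), latent ignorability ($Y(a)\perp\!\!\!\perp(A,Z)\mid U,L$ for $a=0,1$), IV independence ($Z\perp\!\!\!\perp U\mid L$), IV relevance ($Z\not\perp\!\!\!\perp I\{A=a\}\mid L=l$ for $a=0,1$ and almost every $l$) and positivity (there is $\epsilon_0>0$ with $\mathrm{Var}\{\Pr(A=a\mid Z,L)\mid L\}\ge\epsilon_0$ almost surely, $a=0,1$). For the law $P$ of $O$ put $\pi^o(Z,L)=\Pr(A=1\mid Z,L)$, $\delta^o(L)=\mathbb{E}[A\mid L]$, $\kappa^o(L)=\mathrm{Cov}\{A,\pi^o(Z,L)\mid L\}$, $\xi^o(Z,L)=\mathbb{E}[Y\mid Z,L]$, $\eta^o(L)=\mathbb{E}[Y\mid L]$, $\gamma^o(L)=\mathrm{Cov}\{Y,\pi^o(Z,L)\mid L\}/\kappa^o(L)$, $\beta^o=(\pi^o,\delta^o,\kappa^o,\xi^o,\eta^o,\gamma^o)$,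 and $$\psi_{ada}^o=\mathbb{E}[\gamma^o(L)].$$ **Theorem.** One has $\psi_{ada}^o=\mathbb{E}\big[\tfrac{\pi^o(Z,L)-\delta^o(L)}{\kappa^o(L)}Y\big]$, and in the nonparametric model for the law of $O$ the efficient influence function of $\psi_{ada}$ at $P$ is $\varphi(O;\psi_{ada}^o,\beta^o)$, where $$\begin{aligned}\varphi(O;\psi_{ada},\beta)=&\frac{\pi(Z,L)-\delta(L)}{\kappa(L)}Y-\psi_{ada}+\frac{\gamma(L)}{\kappa(L)}\left\{\kappa(L)+(A-\pi(Z,L))^2-(A-\delta(L))^2\right\}\\&+\frac{1}{\kappa(L)}\left\{\xi(Z,L)(A-\pi(Z,L))-\eta(L)(A-\delta(L))\right\}.\end{aligned}$$ Here a regular submodel is a one-dimensional dominated family of laws $P_t$ of $O$ with $P_0=P$, differentiable in quadratic mean at $t=0$ with score $s\in L^2(P)$, along which, for $t$ near $0$, positivity holds with a common constant and $\mathbb{E}_{P_t}[Y^2]$ is bounded. That $\varphi$ is the efficient influence function means: $\varphi\in L^2(P)$ and $\mathbb{E}[\varphi]=0$; for every regular submodel, $\frac{d}{dt}\psi_{ada}(P_t)\big|_{t=0}=\mathbb{E}[\varphi\,s]$;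 and $\varphi$ lies in the tangent space, the closed linear span in $L^2(P)$ of the scores of all regular submodels. -/

import Mathlib

open MeasureTheory ProbabilityTheory Filter Topology

noncomputable section

/-! ## Semiparametric theory: submodels, tangent space, efficient influence function -/

/-- A one-dimensional parametric submodel `t ↦ law t` through `P = law 0`, dominated by a
σ-finite measure `ν` with densities `p t` (for `t` near `0`), differentiable in quadratic mean
at `t = 0` with score function `score ∈ L²(P)`. -/
structure QMDSubmodel {X : Type*} [MeasurableSpace X] (P : Measure X) where
  ν : Measure X
  sigmaFinite : SigmaFinite ν
  p : ℝ → X → ℝ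
  score : X → ℝ
  measurable_p : ∀ t, Measurable (p t)
  nonneg_p : ∀ t x, 0 ≤ p t x
  isProb : ∀ᶠ t in 𝓝 (0 : ℝ),
    IsProbabilityMeasure (ν.withDensity fun x => ENNReal.ofReal (p t x))
  base : (ν.withDensity fun x => ENNReal.ofReal (p 0 x)) = P
  memLp_score : MemLp score 2 P
  qmd : (fun t : ℝ =>
      ∫ x, (√(p t x) - √(p 0 x) - t / 2 * score x * √(p 0 x)) ^ 2 ∂ν) =o[𝓝 0] fun t => t ^ 2

/-- The law at parameter value `t` of a submodel. -/
def QMDSubmodel.law {X : Type*} [MeasurableSpace X] {P : Measure X} (M : QMDSubmodel P)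
    (t : ℝ) : Measure X :=
  M.ν.withDensity fun x => ENNReal.ofReal (M.p t x)

/-- The tangent space at `P`: the closed linear span in `L²(P)` of the scores of the submodels
in the collection `S`. -/
def tangentSpace {X : Type*} [MeasurableSpace X] (P : Measure X) (S : Set (QMDSubmodel P)) :
    Submodule ℝ (Lp ℝ 2 P) :=
  (Submodule.span ℝ {g | ∃ M ∈ S, g = M.memLp_score.toLp M.score}).topologicalClosure

/-- `φ` is the efficient influence function at `P` of the functional `Ψ`, relative to the
collection `S` of submodels: it is square integrable with mean zero, it represents the pathwise
derivative of `Ψ` along every submodel in `S`, and it belongs to the tangent space. -/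
def IsEIF {X : Type*} [MeasurableSpace X] (Ψ : Measure X → ℝ) (P : Measure X)
    (S : Set (QMDSubmodel P)) (φ : X → ℝ) : Prop :=
  (∫ x, φ x ∂P = 0) ∧
  (∀ M ∈ S, HasDerivAt (fun t => Ψ (M.law t)) (∫ x, φ x * M.score x ∂P) 0) ∧
  ∃ h : MemLp φ 2 P, h.toLp φ ∈ tangentSpace P S

/-! ## The observed data `O = (Z, A, Y, L)` with binary treatment `A` -/

/-- The observation space. -/
abbrev Obs (𝒵 ℒ : Type*) := 𝒵 × Fin 2 × ℝ × ℒ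

namespace Obs

variable {𝒵 ℒ : Type*}

/-- The instrument `Z`. -/
def Z (o : Obs 𝒵 ℒ) : 𝒵 := o.1

/-- The treatment `A ∈ {0, 1}`. -/
def treat (o : Obs 𝒵 ℒ) : Fin 2 := o.2.1

/-- The treatment `A` as a real number. -/
def A (o : Obs 𝒵 ℒ) : ℝ := ((treat o : ℕ) : ℝ)

/-- The outcome `Y`. -/
def Y (o : Obs 𝒵 ℒ) : ℝ := o.2.2.1

/-- The observed covariates `L`. -/
def L (o : Obs 𝒵 ℒ) : ℒ := o.2.2.2

/-- The indicator `I{A = a}`. -/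
def treatInd (a : Fin 2) (o : Obs 𝒵 ℒ) : ℝ := if treat o = a then 1 else 0

variable [MeasurableSpace 𝒵] [MeasurableSpace ℒ]

/-- The σ-algebra generated by `(Z, L)`. -/
@[reducible]
def sigmaZL : MeasurableSpace (Obs 𝒵 ℒ) :=
  MeasurableSpace.comap (fun o : Obs 𝒵 ℒ => (Z o, L o)) inferInstance

/-- The σ-algebra generated by `L`. -/
@[reducible]
def sigmaL : MeasurableSpace (Obs 𝒵 ℒ) :=
  MeasurableSpace.comap (fun o : Obs 𝒵 ℒ => L o) inferInstance

end Obs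

/-- The conditional covariance `Cov(V, W ∣ m) = E[V W ∣ m] - E[V ∣ m] E[W ∣ m]`. -/
def condCovariance {X : Type*} (m : MeasurableSpace X) {mX : MeasurableSpace X} (Q : Measure X)
    (V W : X → ℝ) : X → ℝ :=
  fun x => (Q[fun y => V y * W y | m]) x - (Q[V | m]) x * (Q[W | m]) x

section Nuisance

variable {𝒵 ℒ : Type*} [MeasurableSpace 𝒵] [MeasurableSpace ℒ]

/-- A nuisance vector `β = [π, δ, κ, ξ, η, γ]`, as functions of the observation. For the true
one, `π` and `ξ` are functions of `(Z, L)`, and `δ`, `κ`, `η`, `γ` are functions of `L`. -/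
structure NuisanceVec (𝒵 ℒ : Type*) where
  π : Obs 𝒵 ℒ → ℝ
  δ : Obs 𝒵 ℒ → ℝ
  κ : Obs 𝒵 ℒ → ℝ
  ξ : Obs 𝒵 ℒ → ℝ
  η : Obs 𝒵 ℒ → ℝ
  γ : Obs 𝒵 ℒ → ℝ

/-- The propensity `Pr(A = a ∣ Z, L)` under the law `Q`. -/
def propensity (Q : Measure (Obs 𝒵 ℒ)) (a : Fin 2) : Obs 𝒵 ℒ → ℝ :=
  Q[Obs.treatInd a | Obs.sigmaZL]

/-- The true nuisance vector of a law `Q` of the observed data. -/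
def trueNuisance (Q : Measure (Obs 𝒵 ℒ)) : NuisanceVec 𝒵 ℒ where
  π := propensity Q 1
  δ := Q[Obs.A | Obs.sigmaL]
  κ := condCovariance Obs.sigmaL Q Obs.A (propensity Q 1)
  ξ := Q[Obs.Y | Obs.sigmaZL]
  η := Q[Obs.Y | Obs.sigmaL]
  γ := fun o => condCovariance Obs.sigmaL Q Obs.Y (propensity Q 1) o /
    condCovariance Obs.sigmaL Q Obs.A (propensity Q 1) o

/-- The functional `Q ↦ ψ_ada(Q) = E_Q[γ_Q(L)]`. -/
def psiAda (Q : Measure (Obs 𝒵 ℒ)) : ℝ := ∫ o, (trueNuisance Q).γ o ∂Q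

/-- The function `φ(O; ψ, β)`. -/
def phiAda (ψ : ℝ) (β : NuisanceVec 𝒵 ℒ) (o : Obs 𝒵 ℒ) : ℝ :=
  (β.π o - β.δ o) / β.κ o * o.Y - ψ
    + β.γ o / β.κ o * (β.κ o + (o.A - β.π o) ^ 2 - (o.A - β.δ o) ^ 2)
    + 1 / β.κ o * (β.ξ o * (o.A - β.π o) - β.η o * (o.A - β.δ o))

/-- Positivity with constant `ε`: for each `a`, `Var{Pr(A = a ∣ Z, L) ∣ L} ≥ ε` almost surely. -/
def PositivityWith (Q : Measure (Obs 𝒵 ℒ)) (ε : ℝ) : Prop :=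
  ∀ a : Fin 2, ∀ᵐ o ∂Q, ε ≤ (Var[propensity Q a; Q | Obs.sigmaL]) o

/-- Positivity. -/
def Positivity (Q : Measure (Obs 𝒵 ℒ)) : Prop := ∃ ε : ℝ, 0 < ε ∧ PositivityWith Q ε

/-- IV relevance: for each `a` and almost every `l`, `Z` and `I{A = a}` are dependent given
`L = l`, that is, `Pr(A = a ∣ Z, L = l)` is not almost surely constant in `Z`. -/
def IVRelevance (Q : Measure (Obs 𝒵 ℒ)) : Prop :=
  ∀ a : Fin 2, ∀ᵐ o ∂Q, 0 < (Var[propensity Q a; Q | Obs.sigmaL]) o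

/-- The regular parametric submodels of the nonparametric model through `P`: those along which,
locally uniformly in the parameter, positivity holds and `Y` has bounded second moment. No
restriction is made on the form of the laws. -/
def regularSubmodels (P : Measure (Obs 𝒵 ℒ)) : Set (QMDSubmodel P) :=
  {M | (∃ ε : ℝ, 0 < ε ∧ ∀ᶠ t in 𝓝 (0 : ℝ), PositivityWith (M.law t) ε) ∧
    ∃ C : NNReal, ∀ᶠ t in 𝓝 (0 : ℝ), eLpNorm Obs.Y 2 (M.law t) ≤ C}

end Nuisance

end

/-! Write `w = (π - δ) / κ`. Pulling the `L`-measurable factors out of the conditional expectations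
gives `ψ = E[Y w]`, and `φ = Y w + B - ψ`, where `B` (`nuisancePart`) accounts for the dependence of
`w` on the law. Along a submodel `P_t`, with weight `w_t` and `c = w_t - w`, the increment of `ψ` is
the change of `∫ Y w` from `P` to `P_t` plus `∫ Y c dP_t`. The first term has derivative `E[Y w s]`
by `hasDerivAt_integral`. The task is to show that the second has derivative `E[B s]`, although
nothing is known about how the conditional expectations of `P_t` depend on `t`.

The nuisance functions are accessible only through moment equations against bounded test functions
(`IsNuisance`). These suffice for rates: subtracting the equations under `P_t` and `P`, tested with
the difference of the two solutions, bounds that difference in `L²(P_t)` by the Hellinger distance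
(`integral_sq_sub_densityLaw_le`), which is `O(t)` by `exists_hellingerSq_le`.

If `ξ` is bounded, `∫ ξ c dP_t - ∫ B dP_t` is exactly a sum of four terms (`remainder_eq`). Two are
quadratic in the nuisance errors. The other two are linear, but pair an `L`-measurable error with a
function whose conditional mean given `L` vanishes under `P`, so each is a difference of integrals
under `P_t` and `P`, again of second order. Hence the total is `O(t²)` (`exists_abs_remainder_le`),
and since `B` is centred under `P`, the derivative is `E[B s]`.

For `Y` merely square integrable, choose a bounded `ξ'` close to `ξ = E[Y | Z, L]` in `L²(P)` and
split `Y = ξ' + F`. The change of `∫ F c` from `P` to `P_t` is `o(t)`, because the bounded functions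
`c` are `O(t)` in `L²(P_t)` and their product with the root-density increment is `o(t)` in `L²`
(`integral_sq_mul_sub_sqrt_le`). Under `P`, `c` being `(Z, L)`-measurable, `∫ F c` equals `∫ (ξ -
ξ') c`, which is at most a small multiple of `|t|`. This is assembled in `hasDerivAt_of_isNuisance`.

Efficiency holds because the tangent space contains every centred function of `L²(P)`: the tilts `1
+ t g` with bounded centred `g` are regular, as their laws are comparable to `P` with constants
tending to one, which preserves positivity (`condVar_condExp_le`), and such `g` are dense
(`toLp_mem_tangentSpace`). -/

noncomputable section

/-! ## Bounded measurable functions -/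

/-- Bounded measurable real functions. -/
@[fun_prop]
def BoundedMeasurable {X : Type*} [MeasurableSpace X] (f : X → ℝ) : Prop :=
  Measurable f ∧ ∃ C : ℝ, ∀ x, |f x| ≤ C

namespace BoundedMeasurable

variable {X : Type*} {m : MeasurableSpace X} {f g : X → ℝ}

@[fun_prop]
theorem const (c : ℝ) : BoundedMeasurable fun _ : X => c :=
  ⟨measurable_const, |c|, fun _ => le_rfl⟩

@[fun_prop]
theorem neg (hf : BoundedMeasurable f) : BoundedMeasurable fun x => -f x :=
  ⟨hf.1.neg, hf.2.imp fun C hC x => by simpa using hC x⟩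

@[fun_prop]
theorem add (hf : BoundedMeasurable f) (hg : BoundedMeasurable g) :
    BoundedMeasurable fun x => f x + g x := by
  obtain ⟨hf, C, hC⟩ := hf
  obtain ⟨hg, D, hD⟩ := hg
  exact ⟨hf.add hg, C + D, fun x => (abs_add_le _ _).trans (add_le_add (hC x) (hD x))⟩

@[fun_prop]
theorem sub (hf : BoundedMeasurable f) (hg : BoundedMeasurable g) :
    BoundedMeasurable fun x => f x - g x := by
  simpa only [sub_eq_add_neg] using hf.add hg.neg

@[fun_prop]
theorem mul (hf : BoundedMeasurable f) (hg : BoundedMeasurable g) :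
    BoundedMeasurable fun x => f x * g x := by
  obtain ⟨hf, C, hC⟩ := hf
  obtain ⟨hg, D, hD⟩ := hg
  refine ⟨hf.mul hg, C * D, fun x => ?_⟩
  rw [abs_mul]
  exact mul_le_mul (hC x) (hD x) (abs_nonneg _) ((abs_nonneg _).trans (hC x))

@[fun_prop]
theorem pow (hf : BoundedMeasurable f) (n : ℕ) : BoundedMeasurable fun x => f x ^ n := by
  obtain ⟨hf, C, hC⟩ := hf
  refine ⟨hf.pow_const n, C ^ n, fun x => ?_⟩
  rw [abs_pow]
  exact pow_le_pow_left₀ (abs_nonneg _) (hC x) n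

theorem mono {m' : MeasurableSpace X} (h : m ≤ m') (hf : @BoundedMeasurable X m f) :
    @BoundedMeasurable X m' f :=
  ⟨hf.1.mono h le_rfl, hf.2⟩

theorem integrable {μ : Measure X} [IsFiniteMeasure μ] (hf : BoundedMeasurable f) :
    Integrable f μ :=
  hf.2.elim fun C hC => .of_bound hf.1.aestronglyMeasurable C (.of_forall hC)

theorem memLp {μ : Measure X} [IsFiniteMeasure μ] (hf : BoundedMeasurable f) (r : ENNReal) :
    MemLp f r μ :=
  hf.2.elim fun C hC => .of_bound hf.1.aestronglyMeasurable C (.of_forall hC)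

end BoundedMeasurable

/-! ## Laws with a density -/

section Density

variable {X : Type*} [MeasurableSpace X] {ν : Measure X}

/-- The measure with density `p` with respect to `ν`. -/
def densityLaw (ν : Measure X) (p : X → ℝ) : Measure X :=
  ν.withDensity fun x => ENNReal.ofReal (p x)

/-- The squared Hellinger distance (without the factor `1 / 2`) of the densities `p` and `q`. -/
def hellingerSq (ν : Measure X) (p q : X → ℝ) : ℝ := ∫ x, (√(q x) - √(p x)) ^ 2 ∂ν

theorem integral_densityLaw {p : X → ℝ} (hp : Measurable p) (h0 : ∀ x, 0 ≤ p x) (f : X → ℝ) :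
    ∫ x, f x ∂(densityLaw ν p) = ∫ x, f x * p x ∂ν := by
  rw [densityLaw, integral_withDensity_eq_integral_toReal_smul hp.ennreal_ofReal (by simp)]
  refine integral_congr_ae (.of_forall fun x => ?_)
  simp [ENNReal.toReal_ofReal (h0 x), mul_comm]

theorem integrable_densityLaw_iff {p : X → ℝ} (hp : Measurable p) (h0 : ∀ x, 0 ≤ p x)
    (f : X → ℝ) : Integrable f (densityLaw ν p) ↔ Integrable (fun x => f x * p x) ν := by
  rw [densityLaw, integrable_withDensity_iff hp.ennreal_ofReal (by simp)]
  simp only [ENNReal.toReal_ofReal (h0 _)]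

theorem abs_integral_mul_le_sqrt_mul_sqrt {f g : X → ℝ} (hf : MemLp f 2 ν) (hg : MemLp g 2 ν) :
    |∫ x, f x * g x ∂ν| ≤ √(∫ x, f x ^ 2 ∂ν) * √(∫ x, g x ^ 2 ∂ν) := by
  have h := integral_mul_norm_le_Lp_mul_Lq (μ := ν) (f := f) (g := g)
    (Real.HolderConjugate.two_two) (by simpa using hf) (by simpa using hg)
  have h2 : |∫ x, f x * g x ∂ν| ≤ ∫ x, ‖f x‖ * ‖g x‖ ∂ν := by
    refine (abs_integral_le_integral_abs).trans_eq ?_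
    simp only [abs_mul, Real.norm_eq_abs]
  refine h2.trans (h.trans_eq ?_)
  simp [Real.sqrt_eq_rpow]

theorem abs_integral_mul_le_of_sq_le {f g : X → ℝ} (hf : MemLp f 2 ν) (hg : MemLp g 2 ν) {a b : ℝ}
    (ha : 0 ≤ a) (hb : 0 ≤ b) (hfa : ∫ x, f x ^ 2 ∂ν ≤ a ^ 2) (hgb : ∫ x, g x ^ 2 ∂ν ≤ b ^ 2) :
    |∫ x, f x * g x ∂ν| ≤ a * b :=
  (abs_integral_mul_le_sqrt_mul_sqrt hf hg).trans
    (mul_le_mul (Real.sqrt_le_iff.2 ⟨ha, hfa⟩) (Real.sqrt_le_iff.2 ⟨hb, hgb⟩)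
      (Real.sqrt_nonneg _) ha)

theorem memLp_two_of_integrable_sq {μ : Measure X} {f : X → ℝ} (hf : Measurable f)
    (h : Integrable (fun x => f x ^ 2) μ) : MemLp f 2 μ :=
  (memLp_two_iff_integrable_sq hf.aestronglyMeasurable).2 h

variable {p q : X → ℝ}

theorem memLp_mul_sqrt (hp : Measurable p) (h0 : ∀ x, 0 ≤ p x) {f : X → ℝ} (hf : Measurable f)
    (h : Integrable (fun x => f x ^ 2) (densityLaw ν p)) :
    MemLp (fun x => f x * √(p x)) 2 ν := by
  refine memLp_two_of_integrable_sq (hf.mul hp.sqrt) ?_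
  rw [integrable_densityLaw_iff hp h0] at h
  refine h.congr (.of_forall fun x => ?_)
  simp only [mul_pow, Real.sq_sqrt (h0 x)]

theorem memLp_sqrt (hp : Measurable p) (h0 : ∀ x, 0 ≤ p x)
    [IsFiniteMeasure (densityLaw ν p)] : MemLp (fun x => √(p x)) 2 ν := by
  simpa using memLp_mul_sqrt (ν := ν) hp h0 (f := fun _ => 1) measurable_const (by simp)

theorem integral_mul_sqrt_sq (hp : Measurable p) (h0 : ∀ x, 0 ≤ p x) (f : X → ℝ) :
    ∫ x, (f x * √(p x)) ^ 2 ∂ν = ∫ x, f x ^ 2 ∂(densityLaw ν p) := by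
  rw [integral_densityLaw hp h0]
  simp only [mul_pow, Real.sq_sqrt (h0 _)]

theorem integrable_hellinger (hp : Measurable p) (h0 : ∀ x, 0 ≤ p x)
    [IsFiniteMeasure (densityLaw ν p)] (hq : Measurable q) (hq0 : ∀ x, 0 ≤ q x)
    [IsFiniteMeasure (densityLaw ν q)] : Integrable (fun x => (√(q x) - √(p x)) ^ 2) ν :=
  ((memLp_sqrt hq hq0).sub (memLp_sqrt hp h0)).integrable_sq

/-- The factorization `q - p = (√q - √p)(√q + √p)` turns differences of expectations into `L²(ν)`
pairings, to which Cauchy-Schwarz and quadratic mean differentiability apply. -/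
theorem integral_densityLaw_sub (hp : Measurable p) (h0 : ∀ x, 0 ≤ p x)
    (hq : Measurable q) (hq0 : ∀ x, 0 ≤ q x) {f : X → ℝ} (hfp : Integrable f (densityLaw ν p))
    (hfq : Integrable f (densityLaw ν q)) :
    ∫ x, f x ∂(densityLaw ν q) - ∫ x, f x ∂(densityLaw ν p) =
      ∫ x, f x * (√(q x) - √(p x)) * (√(q x) + √(p x)) ∂ν := by
  rw [integrable_densityLaw_iff hp h0] at hfp
  rw [integrable_densityLaw_iff hq hq0] at hfq
  rw [integral_densityLaw hp h0, integral_densityLaw hq hq0, ← integral_sub hfq hfp]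
  refine integral_congr_ae (.of_forall fun x => ?_)
  have h1 := Real.mul_self_sqrt (h0 x)
  have h2 := Real.mul_self_sqrt (hq0 x)
  simp only
  linear_combination f x * h1 - f x * h2

/-- Young's inequality trades a left side linear in `c` for a bound of second order in `c` and the
Hellinger distance. The coefficient `1 / 4` is small enough to be absorbed when the left side arises
from estimating `∫ c²` itself. -/
theorem abs_integral_densityLaw_sub_le (hp : Measurable p) (h0 : ∀ x, 0 ≤ p x)
    (hq : Measurable q) (hq0 : ∀ x, 0 ≤ q x) [IsFiniteMeasure (densityLaw ν p)]
    [IsFiniteMeasure (densityLaw ν q)] {G c : X → ℝ} (hG : Measurable G) (hc : Measurable c)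
    {B C : ℝ} (hB : ∀ x, |G x| ≤ B) (hC : ∀ x, |c x| ≤ C) :
    |∫ x, G x * c x ∂(densityLaw ν q) - ∫ x, G x * c x ∂(densityLaw ν p)| ≤
      1 / 4 * ∫ x, c x ^ 2 ∂(densityLaw ν q) + (4 * B ^ 2 + B * C) * hellingerSq ν p q := by
  have hG' : BoundedMeasurable G := ⟨hG, B, hB⟩
  have hc' : BoundedMeasurable c := ⟨hc, C, hC⟩
  have hGc : BoundedMeasurable fun x => G x * c x := by fun_prop
  have hc2 : Integrable (fun x => c x ^ 2) (densityLaw ν q) := (hc'.pow 2).integrable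
  rw [integral_densityLaw_sub hp h0 hq hq0 hGc.integrable hGc.integrable,
    integral_densityLaw hq hq0, hellingerSq,
    ← integral_const_mul, ← integral_const_mul]
  rw [integrable_densityLaw_iff hq hq0] at hc2
  have hH := integrable_hellinger (ν := ν) hp h0 hq hq0
  rw [← integral_add (hc2.const_mul _) (hH.const_mul _)]
  refine abs_integral_le_integral_abs.trans (integral_mono_of_nonneg (.of_forall fun _ => abs_nonneg _)
    ((hc2.const_mul _).add (hH.const_mul _)) (.of_forall fun x => ?_))
  simp only
  set u := √(q x)
  set v := √(p x)
  have hu : 0 ≤ u := Real.sqrt_nonneg _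
  have hv : 0 ≤ v := Real.sqrt_nonneg _
  have hqu : q x = u ^ 2 := (Real.sq_sqrt (hq0 x)).symm
  have hB' := hB x
  have hC' := hC x
  have hG0 := abs_nonneg (G x)
  have hc0 := abs_nonneg (c x)
  have hd0 := abs_nonneg (u - v)
  rw [hqu, abs_mul, abs_mul, abs_mul, abs_of_nonneg (add_nonneg hu hv), ← sq_abs (c x),
    ← sq_abs (u - v)]
  -- Eliminating `√p` in favour of `√q` leaves only `c² q` and the Hellinger integrand on the right.
  have h1 : u + v ≤ 2 * u + |u - v| := by linarith [neg_abs_le (u - v)]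
  calc |G x| * |c x| * |u - v| * (u + v)
      ≤ B * |c x| * |u - v| * (2 * u + |u - v|) := by
        have : 0 ≤ B := hG0.trans hB'
        gcongr
    _ = 2 * (|c x| * u) * (B * |u - v|) + B * |c x| * |u - v| ^ 2 := by ring
    _ ≤ (1 / 4 * (|c x| * u) ^ 2 + 4 * (B * |u - v|) ^ 2) + B * C * |u - v| ^ 2 := by
        have : 0 ≤ B := hG0.trans hB'
        gcongr
        nlinarith [sq_nonneg (1 / 2 * (|c x| * u) - 2 * (B * |u - v|))]
    _ = _ := by ring

/-- The case `G = c` of the preceding estimate: rates in `L²(Q)` transfer to `L²(P)`. -/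
theorem integral_sq_densityLaw_le (hp : Measurable p) (h0 : ∀ x, 0 ≤ p x)
    (hq : Measurable q) (hq0 : ∀ x, 0 ≤ q x) [IsFiniteMeasure (densityLaw ν p)]
    [IsFiniteMeasure (densityLaw ν q)] {c : X → ℝ} (hc : Measurable c)
    {C : ℝ} (hC : ∀ x, |c x| ≤ C) :
    ∫ x, c x ^ 2 ∂(densityLaw ν p) ≤
      2 * ∫ x, c x ^ 2 ∂(densityLaw ν q) + 5 * C ^ 2 * hellingerSq ν p q := by
  have h := abs_integral_densityLaw_sub_le (ν := ν) hp h0 hq hq0 hc hc hC hC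
  have h3 : 0 ≤ ∫ x, c x ^ 2 ∂(densityLaw ν q) := integral_nonneg fun _ => sq_nonneg _
  simp only [← pow_two] at h
  have := (abs_le.1 h).1
  nlinarith

/-- If `eQ` and `e` have the same integrals as `fQ` under `q` and as `f` under `p` against
`c = eQ - e`, then `eQ - e` is controlled by `fQ - f` and the Hellinger distance. -/
theorem integral_sq_sub_densityLaw_le (hp : Measurable p) (h0 : ∀ x, 0 ≤ p x)
    (hq : Measurable q) (hq0 : ∀ x, 0 ≤ q x) [IsFiniteMeasure (densityLaw ν p)]
    [IsFiniteMeasure (densityLaw ν q)] {e eQ f fQ : X → ℝ} (he : Measurable e)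
    (heQ : Measurable eQ) (hf : Measurable f) (hfQ : Measurable fQ)
    {B : ℝ} (hBe : ∀ x, |e x| ≤ B) (hBeQ : ∀ x, |eQ x| ≤ B) (hBf : ∀ x, |f x| ≤ B)
    (hBfQ : ∀ x, |fQ x| ≤ B)
    (hQ : ∫ x, (eQ x - e x) * fQ x ∂(densityLaw ν q) =
      ∫ x, (eQ x - e x) * eQ x ∂(densityLaw ν q))
    (hP : ∫ x, (eQ x - e x) * f x ∂(densityLaw ν p) =
      ∫ x, (eQ x - e x) * e x ∂(densityLaw ν p)) :
    ∫ x, (eQ x - e x) ^ 2 ∂(densityLaw ν q) ≤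
      2 * ∫ x, (fQ x - f x) ^ 2 ∂(densityLaw ν q) + 40 * B ^ 2 * hellingerSq ν p q := by
  have hsub : ∀ {u v : X → ℝ}, (∀ x, |u x| ≤ B) → (∀ x, |v x| ≤ B) → ∀ x, |u x - v x| ≤ 2 * B :=
    fun hu hv x => (abs_sub _ _).trans (by linarith [hu x, hv x])
  have be : BoundedMeasurable e := ⟨he, B, hBe⟩
  have beQ : BoundedMeasurable eQ := ⟨heQ, B, hBeQ⟩
  have bf : BoundedMeasurable f := ⟨hf, B, hBf⟩
  have bfQ : BoundedMeasurable fQ := ⟨hfQ, B, hBfQ⟩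
  -- Both functions are bounded by `2 * B`, so the Hellinger coefficient is `4 (2B)² + (2B)² = 20
  -- B²`. It doubles to `40 B²` once the two quarters of `∫ (eQ - e)²`, from here and from `e3`, are
  -- absorbed on the left.
  have key := abs_integral_densityLaw_sub_le (ν := ν) (G := fun x => f x - e x)
    (c := fun x => eQ x - e x) hp h0 hq hq0 (hf.sub he) (heQ.sub he) (hsub hBf hBe) (hsub hBeQ hBe)
  have e1 : ∫ x, (f x - e x) * (eQ x - e x) ∂(densityLaw ν p) = 0 := by
    rw [← sub_eq_zero, ← integral_sub (BoundedMeasurable.integrable (by fun_prop))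
      (BoundedMeasurable.integrable (by fun_prop))] at hP
    rw [← hP]
    congr 1; ext x; ring
  -- The moment equation under `q` replaces `eQ` by `fQ`; then `fQ - e = (fQ - f) + (f - e)`, and
  -- the last summand is orthogonal to `eQ - e` under `p` by `e1`.
  have e2 : ∫ x, (eQ x - e x) ^ 2 ∂(densityLaw ν q) =
      ∫ x, (f x - e x) * (eQ x - e x) ∂(densityLaw ν q) +
        ∫ x, (eQ x - e x) * (fQ x - f x) ∂(densityLaw ν q) := by
    have h : ∫ x, (eQ x - e x) ^ 2 ∂(densityLaw ν q) =
        ∫ x, ((eQ x - e x) * eQ x - (eQ x - e x) * e x) ∂(densityLaw ν q) := by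
      congr 1; ext x; ring
    rw [h, integral_sub (BoundedMeasurable.integrable (by fun_prop))
      (BoundedMeasurable.integrable (by fun_prop)), ← hQ,
      ← integral_sub (BoundedMeasurable.integrable (by fun_prop))
      (BoundedMeasurable.integrable (by fun_prop)),
      ← integral_add (BoundedMeasurable.integrable (by fun_prop))
      (BoundedMeasurable.integrable (by fun_prop))]
    congr 1; ext x; ring
  have e3 : ∫ x, (eQ x - e x) * (fQ x - f x) ∂(densityLaw ν q) ≤
      1 / 4 * ∫ x, (eQ x - e x) ^ 2 ∂(densityLaw ν q) +
        ∫ x, (fQ x - f x) ^ 2 ∂(densityLaw ν q) := by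
    rw [← integral_const_mul, ← integral_add (BoundedMeasurable.integrable (by fun_prop))
      (BoundedMeasurable.integrable (by fun_prop))]
    refine integral_mono (BoundedMeasurable.integrable (by fun_prop))
      (BoundedMeasurable.integrable (by fun_prop)) fun x => ?_
    simp only
    nlinarith [sq_nonneg (1 / 2 * (eQ x - e x) - (fQ x - f x))]
  rw [e1, sub_zero] at key
  have := (abs_le.1 key).2
  have h3 : 0 ≤ ∫ x, (eQ x - e x) ^ 2 ∂(densityLaw ν q) := integral_nonneg fun _ => sq_nonneg _
  nlinarith

end Density

/-! ## Submodels differentiable in quadratic mean -/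

/-- Square integrable functions are approximated in `L²` by bounded ones. -/
theorem exists_boundedMeasurable_approx {X : Type*} {m m0 : MeasurableSpace X} (hm : m ≤ m0)
    {P : Measure[m0] X} {f : X → ℝ} (hf : Measurable[m] f) (hf2 : MemLp f 2 P) {ε : ℝ}
    (hε : 0 < ε) :
    ∃ g : X → ℝ, @BoundedMeasurable X m g ∧ ∫ x, (f x - g x) ^ 2 ∂P ≤ ε := by
  set g : ℕ → X → ℝ := fun n x => max (-(n : ℝ)) (min (f x) n) with hg
  have hgm : ∀ n, @BoundedMeasurable X m (g n) := fun n =>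
    ⟨measurable_const.max (hf.min measurable_const), n, fun x => by
      have : (0 : ℝ) ≤ n := n.cast_nonneg
      exact abs_le.2 ⟨le_max_left _ _, max_le (by linarith) (min_le_right _ _)⟩⟩
  have hle : ∀ n x, |f x - g n x| ≤ |f x| := fun n x => by
    have : (0 : ℝ) ≤ n := n.cast_nonneg
    simp only [hg]
    rcases le_total (f x) n with h | h
    · rcases le_total (-(n : ℝ)) (f x) with h' | h'
      · simp [h, h']
      · rw [min_eq_left h, max_eq_left h', abs_of_nonpos (by linarith),
          abs_of_nonpos (by linarith)]
        linarith
    · rw [min_eq_right h, max_eq_right (by linarith), abs_of_nonneg (by linarith),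
        abs_of_nonneg (by linarith)]
      linarith
  have ht : Tendsto (fun n => ∫ x, (f x - g n x) ^ 2 ∂P) atTop (𝓝 (∫ _, (0 : ℝ) ∂P)) := by
    refine tendsto_integral_of_dominated_convergence (fun x => f x ^ 2) (fun n => ?_)
      hf2.integrable_sq (fun n => .of_forall fun x => ?_) (.of_forall fun x => ?_)
    · exact (((hf.sub (hgm n).1).pow_const 2).mono hm le_rfl).aestronglyMeasurable
    · rw [Real.norm_eq_abs, abs_of_nonneg (sq_nonneg _)]
      exact sq_le_sq.2 (hle n x)
    · refine tendsto_const_nhds.congr' ?_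
      obtain ⟨N, hN⟩ := exists_nat_ge |f x|
      filter_upwards [eventually_ge_atTop N] with n hn
      have : |f x| ≤ n := hN.trans (by exact_mod_cast hn)
      have := abs_le.1 this
      simp [hg, this.1, this.2]
  rw [integral_zero] at ht
  obtain ⟨n, hn⟩ := (ht.eventually_le_const hε).exists
  exact ⟨g n, hgm n, hn⟩

namespace QMDSubmodel

variable {X : Type*} [MeasurableSpace X] {P : Measure X} (M : QMDSubmodel P)

theorem law_eq_densityLaw (t : ℝ) : M.law t = densityLaw M.ν (M.p t) := rfl

theorem law_zero : M.law 0 = P := M.base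

/-- A measurable version of the score. -/
def mscore : X → ℝ := M.memLp_score.1.mk M.score

theorem measurable_mscore : Measurable M.mscore :=
  M.memLp_score.1.stronglyMeasurable_mk.measurable

theorem score_ae_eq : M.score =ᵐ[P] M.mscore := M.memLp_score.1.ae_eq_mk

theorem memLp_mscore : MemLp M.mscore 2 P := (memLp_congr_ae M.score_ae_eq).1 M.memLp_score

/-- The score is determined only `P`-almost everywhere, but the factor `√(p 0)` vanishes on the part
of `ν` that `P` does not see, so the measurable version may be used under `ν`. -/
theorem score_mul_sqrt_ae_eq :
    (fun x => M.score x * √(M.p 0 x)) =ᵐ[M.ν] fun x => M.mscore x * √(M.p 0 x) := by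
  have h : M.score =ᵐ[M.ν.withDensity fun x => ENNReal.ofReal (M.p 0 x)] M.mscore := by
    rw [M.base]; exact M.score_ae_eq
  have h' := (ae_withDensity_iff (M.measurable_p 0).ennreal_ofReal).1 h
  filter_upwards [h'] with x hx
  rcases (M.nonneg_p 0 x).eq_or_lt with h0 | h0
  · simp [← h0]
  · rw [hx (by simpa using h0)]

/-- The remainder in the first order expansion of the root density. -/
def rem (t : ℝ) (x : X) : ℝ := √(M.p t x) - √(M.p 0 x) - t / 2 * (M.mscore x * √(M.p 0 x))

theorem integral_rem_sq_le {ε : ℝ} (hε : 0 < ε) :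
    ∀ᶠ t in 𝓝 (0 : ℝ), ∫ x, M.rem t x ^ 2 ∂M.ν ≤ (ε * |t|) ^ 2 := by
  filter_upwards [M.qmd.bound (c := ε ^ 2) (by positivity)] with t ht
  have : ∫ x, M.rem t x ^ 2 ∂M.ν =
      ∫ x, (√(M.p t x) - √(M.p 0 x) - t / 2 * M.score x * √(M.p 0 x)) ^ 2 ∂M.ν := by
    refine integral_congr_ae ?_
    filter_upwards [M.score_mul_sqrt_ae_eq] with x hx
    rw [rem, ← hx, mul_assoc]
  rw [this, mul_pow, sq_abs]
  refine (le_abs_self _).trans (ht.trans_eq ?_)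
  rw [Real.norm_eq_abs, abs_of_nonneg (sq_nonneg t)]

theorem memLp_mscore_mul_sqrt : MemLp (fun x => M.mscore x * √(M.p 0 x)) 2 M.ν :=
  memLp_mul_sqrt (M.measurable_p 0) (M.nonneg_p 0) M.measurable_mscore (by
    rw [← M.law_eq_densityLaw, M.law_zero]; exact M.memLp_mscore.integrable_sq)

theorem memLp_mul_sub_sqrt {t : ℝ} {F : X → ℝ} (hF : Measurable F)
    (h0 : Integrable (fun x => F x ^ 2) P) (ht : Integrable (fun x => F x ^ 2) (M.law t)) :
    MemLp (fun x => F x * (√(M.p t x) - √(M.p 0 x))) 2 M.ν ∧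
    MemLp (fun x => F x * (√(M.p t x) + √(M.p 0 x))) 2 M.ν := by
  rw [← M.law_zero] at h0
  have h1 := memLp_mul_sqrt (M.measurable_p 0) (M.nonneg_p 0) hF h0
  have h2 := memLp_mul_sqrt (M.measurable_p t) (M.nonneg_p t) hF ht
  constructor
  · simpa only [mul_sub] using! h2.sub h1
  · simpa only [mul_add] using! h2.add h1

theorem integral_sq_mul_add_sqrt_le {t : ℝ} {F : X → ℝ}
    (h0 : Integrable (fun x => F x ^ 2) P) (ht : Integrable (fun x => F x ^ 2) (M.law t)) {C : ℝ}
    (hC0 : ∫ x, F x ^ 2 ∂P ≤ C ^ 2) (hCt : ∫ x, F x ^ 2 ∂(M.law t) ≤ C ^ 2) :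
    ∫ x, (F x * (√(M.p t x) - √(M.p 0 x))) ^ 2 ∂M.ν ≤ (2 * C) ^ 2 ∧
    ∫ x, (F x * (√(M.p t x) + √(M.p 0 x))) ^ 2 ∂M.ν ≤ (2 * C) ^ 2 := by
  rw [← M.law_zero] at h0 hC0
  rw [law_eq_densityLaw] at h0 hC0 ht hCt
  rw [integral_densityLaw (M.measurable_p _) (M.nonneg_p _)] at hC0 hCt
  rw [integrable_densityLaw_iff (M.measurable_p _) (M.nonneg_p _)] at h0 ht
  have key : ∫ x, (2 * (F x ^ 2 * M.p t x) + 2 * (F x ^ 2 * M.p 0 x)) ∂M.ν ≤ (2 * C) ^ 2 := by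
    rw [integral_add (ht.const_mul 2) (h0.const_mul 2), integral_const_mul, integral_const_mul]
    linarith
  constructor <;>
  · refine le_trans (integral_mono_of_nonneg (.of_forall fun _ => sq_nonneg _)
      ((ht.const_mul 2).add (h0.const_mul 2)) (.of_forall fun x => ?_)) key
    have e1 := Real.sq_sqrt (M.nonneg_p 0 x)
    have e2 := Real.sq_sqrt (M.nonneg_p t x)
    simp only [Pi.add_apply]
    rw [← e1, ← e2, Real.sqrt_sq (Real.sqrt_nonneg _), Real.sqrt_sq (Real.sqrt_nonneg _)]
    nlinarith [sq_nonneg (F x * (√(M.p t x) + √(M.p 0 x))),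
      sq_nonneg (F x * (√(M.p t x) - √(M.p 0 x)))]

variable [IsProbabilityMeasure P]

instance : IsProbabilityMeasure (densityLaw M.ν (M.p 0)) := by
  rw [← M.law_eq_densityLaw, M.law_zero]; infer_instance

theorem memLp_rem {t : ℝ} [IsProbabilityMeasure (densityLaw M.ν (M.p t))] :
    MemLp (M.rem t) 2 M.ν :=
  ((memLp_sqrt (M.measurable_p t) (M.nonneg_p t)).sub
    (memLp_sqrt (M.measurable_p 0) (M.nonneg_p 0))).sub
    (M.memLp_mscore_mul_sqrt.const_mul (t / 2))

theorem exists_hellingerSq_le :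
    ∃ C : ℝ, 0 ≤ C ∧ ∀ᶠ t in 𝓝 (0 : ℝ), hellingerSq M.ν (M.p 0) (M.p t) ≤ (C * |t|) ^ 2 := by
  set S := ∫ x, (M.mscore x * √(M.p 0 x)) ^ 2 ∂M.ν with hS
  have hS0 : 0 ≤ S := integral_nonneg fun _ => sq_nonneg _
  refine ⟨√(2 + S), Real.sqrt_nonneg _, ?_⟩
  filter_upwards [M.integral_rem_sq_le one_pos, M.isProb] with t ht hp
  have : IsProbabilityMeasure (densityLaw M.ν (M.p t)) := hp
  have i1 := M.memLp_rem (t := t).integrable_sq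
  have i2 := M.memLp_mscore_mul_sqrt.integrable_sq
  rw [mul_pow, Real.sq_sqrt (by positivity), sq_abs]
  calc hellingerSq M.ν (M.p 0) (M.p t)
      ≤ ∫ x, (2 * M.rem t x ^ 2 + t ^ 2 * (M.mscore x * √(M.p 0 x)) ^ 2) ∂M.ν := by
        refine integral_mono (integrable_hellinger (M.measurable_p 0) (M.nonneg_p 0)
          (M.measurable_p t) (M.nonneg_p t)) ((i1.const_mul 2).add (i2.const_mul _)) fun x => ?_
        have : √(M.p t x) - √(M.p 0 x) = M.rem t x + t / 2 * (M.mscore x * √(M.p 0 x)) := by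
          rw [rem]; ring
        simp only [this]
        nlinarith [sq_nonneg (M.rem t x - t / 2 * (M.mscore x * √(M.p 0 x))),
          sq_nonneg (t * (M.mscore x * √(M.p 0 x)))]
    _ = 2 * ∫ x, M.rem t x ^ 2 ∂M.ν + t ^ 2 * S := by
        rw [integral_add (i1.const_mul 2) (i2.const_mul _), integral_const_mul,
          integral_const_mul]
    _ ≤ (2 + S) * t ^ 2 := by
        rw [one_mul, sq_abs] at ht
        linarith

theorem eventually_mul_abs_le (C : ℝ) {ε : ℝ} (hε : 0 < ε) : ∀ᶠ t in 𝓝 (0 : ℝ), C * |t| ≤ ε := by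
  have : Tendsto (fun t : ℝ => C * |t|) (𝓝 0) (𝓝 0) := by
    have : Continuous fun t : ℝ => C * |t| := by fun_prop
    simpa using this.tendsto 0
  exact this.eventually_le_const hε

/-- Arithmetic for `integral_sq_mul_sub_sqrt_le`: `I₁` stands for the remainder of the root density,
`I₂` for the truncated part of the score, and `I₃` for the bounded part, which gains an extra factor
`t²`. -/
theorem le_of_three_terms {B K E η ε t I I₁ I₂ I₃ : ℝ}
    (hI : I ≤ 2 * B ^ 2 * I₁ + t ^ 2 * B ^ 2 * I₂ + t ^ 2 * K ^ 2 * I₃) (h₁ : I₁ ≤ η * t ^ 2)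
    (h₂ : I₂ ≤ η) (h₀ : 0 ≤ I₃) (h₃ : I₃ ≤ E * t ^ 2) (hE : K ^ 2 * E * |t| ≤ ε ^ 2 / 4)
    (ht : |t| ≤ 1) (hη : B ^ 2 * η ≤ ε ^ 2 / 4) : I ≤ ε ^ 2 * t ^ 2 := by
  have f1 : 2 * B ^ 2 * I₁ ≤ 2 * (ε ^ 2 / 4) * t ^ 2 :=
    calc _ ≤ 2 * B ^ 2 * (η * t ^ 2) := by gcongr
      _ = 2 * (B ^ 2 * η) * t ^ 2 := by ring
      _ ≤ _ := by gcongr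
  have f2 : t ^ 2 * B ^ 2 * I₂ ≤ ε ^ 2 / 4 * t ^ 2 :=
    calc _ ≤ t ^ 2 * B ^ 2 * η := by gcongr
      _ = (B ^ 2 * η) * t ^ 2 := by ring
      _ ≤ _ := by gcongr
  have f3 : t ^ 2 * K ^ 2 * I₃ ≤ ε ^ 2 / 4 * t ^ 2 := by
    rcases eq_or_ne t 0 with rfl | ht0
    · simp
    have hE0 : 0 ≤ E := by
      have : 0 < t ^ 2 := by positivity
      nlinarith
    have ht2 : t ^ 2 ≤ |t| := by
      rw [← sq_abs]; nlinarith [abs_nonneg t]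
    calc _ ≤ t ^ 2 * K ^ 2 * (E * t ^ 2) := by gcongr
      _ ≤ t ^ 2 * K ^ 2 * (E * |t|) := by gcongr
      _ = (K ^ 2 * E * |t|) * t ^ 2 := by ring
      _ ≤ _ := by gcongr
  linarith

/-- For uniformly bounded functions of size `O(t)` in `L²`, multiplication with the increment of
the root density is `o(t)`. -/
theorem integral_sq_mul_sub_sqrt_le (B C : ℝ) {ε : ℝ} (hε : 0 < ε) :
    ∀ᶠ t in 𝓝 (0 : ℝ), ∀ c : X → ℝ, Measurable c → (∀ x, |c x| ≤ B) →
      ∫ x, c x ^ 2 ∂(M.law t) ≤ C * t ^ 2 →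
      ∫ x, (c x * (√(M.p t x) - √(M.p 0 x))) ^ 2 ∂M.ν ≤ (ε * |t|) ^ 2 := by
  obtain ⟨D, hD0, hD⟩ := M.exists_hellingerSq_le
  -- Chosen so that `B² η ≤ ε² / 4`; the `+ 1` keeps the denominator positive when `B = 0`.
  set η : ℝ := ε ^ 2 / (4 * (B ^ 2 + 1)) with hη
  have hη0 : 0 < η := by positivity
  -- With the score split as `k + (s - k)`, the bound on `c` controls the product with `s - k`,
  -- while the bound on `k` leaves `c` itself, which is small in `L²`. Since `k` does not depend on
  -- `c`, the range of `t` is uniform in `c`; this is needed because `c` will vary with `t`.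
  obtain ⟨k, ⟨hk, K, hK⟩, hkη⟩ := exists_boundedMeasurable_approx le_rfl M.measurable_mscore
    M.memLp_mscore hη0
  have h2 := M.integral_rem_sq_le (ε := √η) (by positivity)
  have h3 := eventually_mul_abs_le (K ^ 2 * (2 * C + 5 * B ^ 2 * D ^ 2)) (ε := ε ^ 2 / 4)
    (by positivity)
  have h4 := eventually_mul_abs_le 1 one_pos
  filter_upwards [hD, h2, M.isProb, h3, h4] with t hDt hρ hp h3 h4 c hc hB hCt
  have : IsProbabilityMeasure (densityLaw M.ν (M.p t)) := hp
  rw [M.law_eq_densityLaw] at hCt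
  have hcb : BoundedMeasurable c := ⟨hc, B, hB⟩
  have hkb : BoundedMeasurable k := ⟨hk, K, hK⟩
  have hcP := integral_sq_densityLaw_le (ν := M.ν) (M.measurable_p 0) (M.nonneg_p 0) (M.measurable_p t)
    (M.nonneg_p t) hc hB
  have i1 := M.memLp_rem (t := t).integrable_sq
  have j2 : Integrable (fun x => (M.mscore x - k x) ^ 2) (densityLaw M.ν (M.p 0)) := by
    rw [← M.law_eq_densityLaw, M.law_zero]
    exact (M.memLp_mscore.sub (hkb.memLp 2)).integrable_sq
  have j3 : Integrable (fun x => c x ^ 2) (densityLaw M.ν (M.p 0)) := (hcb.pow 2).integrable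
  have e2 := integral_densityLaw (ν := M.ν) (M.measurable_p 0) (M.nonneg_p 0)
    fun x => (M.mscore x - k x) ^ 2
  have e3 := integral_densityLaw (ν := M.ν) (M.measurable_p 0) (M.nonneg_p 0) fun x => c x ^ 2
  rw [integrable_densityLaw_iff (M.measurable_p 0) (M.nonneg_p 0)] at j2 j3
  have main : ∫ x, (c x * (√(M.p t x) - √(M.p 0 x))) ^ 2 ∂M.ν ≤
      2 * B ^ 2 * ∫ x, M.rem t x ^ 2 ∂M.ν +
      t ^ 2 * B ^ 2 * ∫ x, (M.mscore x - k x) ^ 2 * M.p 0 x ∂M.ν +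
      t ^ 2 * K ^ 2 * ∫ x, c x ^ 2 * M.p 0 x ∂M.ν := by
    have j12 : Integrable (fun x => 2 * B ^ 2 * M.rem t x ^ 2 +
        t ^ 2 * B ^ 2 * ((M.mscore x - k x) ^ 2 * M.p 0 x)) M.ν :=
      (i1.const_mul _).add (j2.const_mul _)
    rw [← integral_const_mul, ← integral_const_mul, ← integral_const_mul,
      ← integral_add (i1.const_mul _) (j2.const_mul _), ← integral_add j12 (j3.const_mul _)]
    refine integral_mono_of_nonneg (.of_forall fun _ => sq_nonneg _)
      (j12.add (j3.const_mul _)) (.of_forall fun x => ?_)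
    have e : √(M.p t x) - √(M.p 0 x) = M.rem t x + t / 2 * (M.mscore x * √(M.p 0 x)) := by
      rw [rem]; ring
    have hp0 := Real.sq_sqrt (M.nonneg_p 0 x)
    have hc2 : c x ^ 2 ≤ B ^ 2 := by
      rw [← sq_abs]; exact pow_le_pow_left₀ (abs_nonneg _) (hB x) 2
    have hk2 : k x ^ 2 ≤ K ^ 2 := by
      rw [← sq_abs]; exact pow_le_pow_left₀ (abs_nonneg _) (hK x) 2
    simp only [e]
    generalize √(M.p 0 x) = r at hp0
    calc (c x * (M.rem t x + t / 2 * (M.mscore x * r))) ^ 2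
        ≤ 2 * (c x ^ 2 * M.rem t x ^ 2) + t ^ 2 / 2 * (c x ^ 2 * M.mscore x ^ 2) * M.p 0 x := by
          rw [← hp0]
          nlinarith [sq_nonneg (c x * (M.rem t x - t / 2 * (M.mscore x * r)))]
      _ ≤ 2 * (B ^ 2 * M.rem t x ^ 2) +
          t ^ 2 / 2 * (2 * (B ^ 2 * (M.mscore x - k x) ^ 2) + 2 * (c x ^ 2 * K ^ 2)) * M.p 0 x := by
          have := M.nonneg_p 0 x
          gcongr
          calc c x ^ 2 * M.mscore x ^ 2
              ≤ 2 * (c x ^ 2 * (M.mscore x - k x) ^ 2) + 2 * (c x ^ 2 * k x ^ 2) := by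
                nlinarith [sq_nonneg (c x * (M.mscore x - 2 * k x))]
            _ ≤ _ := by gcongr
      _ = _ := by ring
  rw [← e2, ← e3, ← M.law_eq_densityLaw, M.law_zero] at main
  rw [← M.law_eq_densityLaw 0, M.law_zero] at hcP
  rw [mul_pow, Real.sq_sqrt hη0.le, sq_abs] at hρ
  rw [mul_pow, sq_abs] at hDt ⊢
  have hcP' : ∫ x, c x ^ 2 ∂P ≤ (2 * C + 5 * B ^ 2 * D ^ 2) * t ^ 2 := by
    nlinarith [sq_nonneg B, mul_le_mul_of_nonneg_left hDt (show 0 ≤ 5 * B ^ 2 by positivity)]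
  have hηB : B ^ 2 * η ≤ ε ^ 2 / 4 := by
    have : (B ^ 2 + 1) * η = ε ^ 2 / 4 := by rw [hη]; field_simp
    nlinarith
  exact le_of_three_terms main hρ hkη (integral_nonneg fun _ => sq_nonneg _) hcP' h3
    (by linarith) hηB

/-- Expectations of functions with bounded second moments are differentiable along the
submodel. -/
theorem hasDerivAt_integral {F : X → ℝ} (hF : Measurable F) (h0 : Integrable (fun x => F x ^ 2) P)
    {C : ℝ} (hC : ∀ᶠ t in 𝓝 (0 : ℝ), Integrable (fun x => F x ^ 2) (M.law t) ∧
      ∫ x, F x ^ 2 ∂(M.law t) ≤ C) :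
    HasDerivAt (fun t => ∫ x, F x ∂(M.law t)) (∫ x, F x * M.score x ∂P) 0 := by
  obtain ⟨D, hD0, hD⟩ := M.exists_hellingerSq_le
  have hC0 : 0 ≤ C := (integral_nonneg fun _ => sq_nonneg _).trans hC.self_of_nhds.2
  have hCP : ∫ x, F x ^ 2 ∂P ≤ √C ^ 2 := by
    rw [Real.sq_sqrt hC0]; simpa only [M.law_zero] using hC.self_of_nhds.2
  rw [hasDerivAt_iff_isLittleO, Asymptotics.isLittleO_iff]
  intro ε hε
  set η := ε / (4 * (2 * √C + 1)) with hη
  have hη0 : 0 < η := by positivity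
  have hηC : 2 * √C * η ≤ ε / 4 := by
    have : (2 * √C + 1) * η = ε / 4 := by rw [hη]; field_simp
    nlinarith
  -- As `F` is unbounded, `F (√p_t - √p_0)` is only bounded in `L²(ν)`, not small. The truncated
  -- score `k` lets the increment be paired with a bounded factor instead, leaving a small error
  -- from `s - k`.
  obtain ⟨k, hkb, hkη⟩ := exists_boundedMeasurable_approx le_rfl M.measurable_mscore
    M.memLp_mscore (show 0 < η ^ 2 by positivity)
  obtain ⟨hk, K', hK'⟩ := id hkb
  obtain ⟨K, hK0, hK⟩ : ∃ K : ℝ, 0 ≤ K ∧ ∀ x, |k x| ≤ K :=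
    ⟨|K'|, abs_nonneg _, fun x => (hK' x).trans (le_abs_self _)⟩
  have h3 := eventually_mul_abs_le (√C * (K * D)) (ε := ε / 4) (by positivity)
  filter_upwards [hC, hD, M.integral_rem_sq_le hη0, M.isProb, h3] with t hCt hDt hρ hp h3
  have : IsProbabilityMeasure (densityLaw M.ν (M.p t)) := hp
  have : IsProbabilityMeasure (M.law t) := hp
  obtain ⟨hit, hCt⟩ := hCt
  rw [← Real.sq_sqrt hC0] at hCt
  obtain ⟨m1, m2⟩ := M.memLp_mul_sub_sqrt hF h0 hit
  obtain ⟨b1, b2⟩ := M.integral_sq_mul_add_sqrt_le h0 hit hCP hCt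
  have m3 : MemLp (fun x => F x * √(M.p 0 x)) 2 M.ν :=
    memLp_mul_sqrt (M.measurable_p 0) (M.nonneg_p 0) hF
      (by rw [← M.law_eq_densityLaw, M.law_zero]; exact h0)
  have m4 : MemLp (fun x => (M.mscore x - k x) * √(M.p 0 x)) 2 M.ν :=
    memLp_mul_sqrt (M.measurable_p 0) (M.nonneg_p 0) (M.measurable_mscore.sub hk)
      (by rw [← M.law_eq_densityLaw, M.law_zero]
          exact (M.memLp_mscore.sub (hkb.memLp 2)).integrable_sq)
  have m5 : MemLp (fun x => k x * (√(M.p t x) - √(M.p 0 x))) 2 M.ν :=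
    (M.memLp_mul_sub_sqrt hk (hkb.pow 2).integrable
      (by rw [M.law_eq_densityLaw]; exact (hkb.pow 2).integrable)).1
  have b3 : ∫ x, (F x * √(M.p 0 x)) ^ 2 ∂M.ν ≤ √C ^ 2 := by
    rwa [integral_mul_sqrt_sq (M.measurable_p 0) (M.nonneg_p 0), ← M.law_eq_densityLaw,
      M.law_zero]
  have b4 : ∫ x, ((M.mscore x - k x) * √(M.p 0 x)) ^ 2 ∂M.ν ≤ η ^ 2 := by
    rwa [integral_mul_sqrt_sq (M.measurable_p 0) (M.nonneg_p 0), ← M.law_eq_densityLaw,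
      M.law_zero]
  have b5 : ∫ x, (k x * (√(M.p t x) - √(M.p 0 x))) ^ 2 ∂M.ν ≤ (K * (D * |t|)) ^ 2 := by
    rw [mul_pow K]
    refine le_trans ?_ (mul_le_mul_of_nonneg_left hDt (sq_nonneg K))
    rw [hellingerSq, ← integral_const_mul]
    refine integral_mono m5.integrable_sq ((integrable_hellinger (M.measurable_p 0) (M.nonneg_p 0)
      (M.measurable_p t) (M.nonneg_p t)).const_mul _) fun x => ?_
    simp only [mul_pow]
    refine mul_le_mul_of_nonneg_right ?_ (sq_nonneg _)
    rw [← sq_abs]; exact pow_le_pow_left₀ (abs_nonneg _) (hK x) 2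
  have c1 := abs_integral_mul_le_of_sq_le m2 M.memLp_rem (by positivity) (by positivity) b2 hρ
  have c2 := abs_integral_mul_le_of_sq_le m1 m4 (by positivity) hη0.le b1 b4
  have c3 := abs_integral_mul_le_of_sq_le m3 m5 (by positivity) (by positivity) b3 b5
  have i1 : Integrable (fun x => F x * (√(M.p t x) + √(M.p 0 x)) * M.rem t x) M.ν :=
    m2.integrable_mul (M.memLp_rem (t := t))
  have i2 : Integrable (fun x => F x * (√(M.p t x) - √(M.p 0 x)) *
      ((M.mscore x - k x) * √(M.p 0 x))) M.ν := m1.integrable_mul m4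
  have i3 : Integrable (fun x => F x * √(M.p 0 x) * (k x * (√(M.p t x) - √(M.p 0 x)))) M.ν :=
    m3.integrable_mul m5
  have i23 : Integrable (fun x => F x * (√(M.p t x) - √(M.p 0 x)) *
      ((M.mscore x - k x) * √(M.p 0 x)) + F x * √(M.p 0 x) *
      (k x * (√(M.p t x) - √(M.p 0 x)))) M.ν := i2.add i3
  have hFi0 : Integrable F P := (memLp_two_of_integrable_sq hF h0).integrable one_le_two
  have hFit : Integrable F (densityLaw M.ν (M.p t)) :=
    (memLp_two_of_integrable_sq hF hit).integrable one_le_two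
  have hFs : Integrable (fun x => F x * M.mscore x) P :=
    (memLp_two_of_integrable_sq hF h0).integrable_mul M.memLp_mscore
  have hs : ∫ x, F x * M.score x ∂P = ∫ x, F x * M.mscore x * M.p 0 x ∂M.ν := by
    rw [← integral_densityLaw (M.measurable_p 0) (M.nonneg_p 0), ← M.law_eq_densityLaw,
      M.law_zero]
    refine integral_congr_ae ?_
    filter_upwards [M.score_ae_eq] with x hx
    rw [hx]
  have i4 : Integrable (fun x => F x * M.mscore x * M.p 0 x) M.ν := by
    rw [← integrable_densityLaw_iff (M.measurable_p 0) (M.nonneg_p 0), ← M.law_eq_densityLaw,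
      M.law_zero]
    exact hFs
  -- Substituting the expansion of `√p_t - √p_0` leaves the remainder term and `t / 2` times the
  -- pairing of `F (√p_t - √p_0)` with `s √p_0`, which is then split along `s = (s - k) + k`.
  have expand : ∫ x, F x ∂(M.law t) - ∫ x, F x ∂(M.law 0) - (t - 0) • ∫ x, F x * M.score x ∂P =
      ∫ x, F x * (√(M.p t x) + √(M.p 0 x)) * M.rem t x ∂M.ν +
      t / 2 * (∫ x, F x * (√(M.p t x) - √(M.p 0 x)) * ((M.mscore x - k x) * √(M.p 0 x)) ∂M.ν +
        ∫ x, F x * √(M.p 0 x) * (k x * (√(M.p t x) - √(M.p 0 x))) ∂M.ν) := by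
    rw [hs, M.law_eq_densityLaw, M.law_eq_densityLaw, integral_densityLaw_sub (M.measurable_p 0)
      (M.nonneg_p 0) (M.measurable_p t) (M.nonneg_p t) (M.law_zero.symm ▸ hFi0 :) hFit]
    rw [← integral_add i2 i3, ← integral_const_mul, ← integral_add i1 (i23.const_mul _)]
    rw [sub_zero, smul_eq_mul, ← integral_const_mul, ← integral_sub _ (i4.const_mul _)]
    · congr 1; ext x
      have e := Real.sq_sqrt (M.nonneg_p 0 x)
      simp only [rem]
      rw [← e, Real.sqrt_sq (Real.sqrt_nonneg _)]
      ring
    · refine (m2.integrable_mul ((memLp_sqrt (M.measurable_p t) (M.nonneg_p t)).sub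
        (memLp_sqrt (M.measurable_p 0) (M.nonneg_p 0)))).congr (.of_forall fun x => ?_)
      simp only [Pi.mul_apply, Pi.sub_apply]
      ring
  rw [expand, sub_zero, Real.norm_eq_abs, Real.norm_eq_abs]
  refine (abs_add_le _ _).trans ?_
  rw [abs_mul, abs_div, abs_two]
  have c4 := (abs_add_le _ _).trans (add_le_add c2 c3)
  have ht0 := abs_nonneg t
  calc _ ≤ 2 * √C * (η * |t|) + |t| / 2 * (2 * √C * η + √C * (K * (D * |t|))) := by gcongr
    _ = (2 * √C * η) * |t| + |t| / 2 * (2 * √C * η + √C * (K * D) * |t|) := by ring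
    _ ≤ ε / 4 * |t| + |t| / 2 * (ε / 4 + ε / 4) := by gcongr
    _ ≤ ε * |t| := by nlinarith

end QMDSubmodel

/-! ## Bounded versions of the nuisance functions -/

theorem integral_mul_condExp {X : Type*} {m m0 : MeasurableSpace X} (hm : m ≤ m0)
    {Q : Measure[m0] X} [IsFiniteMeasure Q] {c f : X → ℝ} (hc : @BoundedMeasurable X m c)
    (hf : Integrable f Q) : ∫ x, c x * (Q[f | m]) x ∂Q = ∫ x, c x * f x ∂Q := by
  have hcf : Integrable (fun x => c x * f x) Q := by
    obtain ⟨h, C, hC⟩ := hc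
    exact hf.bdd_mul (h.mono hm le_rfl).aestronglyMeasurable (.of_forall hC)
  have h := condExp_mul_of_stronglyMeasurable_left (μ := Q) hc.1.stronglyMeasurable hcf hf
  rw [← integral_condExp hm (f := fun x => c x * f x)]
  exact (integral_congr_ae h).symm

/-- Truncation to the interval `[a, b]`. -/
def clip (a b x : ℝ) : ℝ := max a (min b x)

theorem measurable_clip (a b : ℝ) : Measurable (clip a b) :=
  measurable_const.max (measurable_const.min measurable_id)

theorem le_clip (a b x : ℝ) : a ≤ clip a b x := le_max_left _ _

theorem clip_le {a b : ℝ} (h : a ≤ b) (x : ℝ) : clip a b x ≤ b := max_le h (min_le_left _ _)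

theorem clip_eq {a b x : ℝ} (ha : a ≤ x) (hb : x ≤ b) : clip a b x = x := by
  rw [clip, min_eq_right hb, max_eq_right ha]

/-- Everywhere bounded functions `π`, `δ`, `κ` which represent `E[A ∣ m₁]`, `E[A ∣ m₂]` and
`Var(π ∣ m₂)` under the law `Q`. -/
structure IsNuisance {X : Type*} (m₁ m₂ : MeasurableSpace X) [MeasurableSpace X] (Q : Measure X)
    (A : X → ℝ) (ε : ℝ) (π δ κ : X → ℝ) : Prop where
  measurable_pi : Measurable[m₁] π
  measurable_delta : Measurable[m₂] δ
  measurable_kappa : Measurable[m₂] κ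
  abs_pi_le : ∀ x, |π x| ≤ 1
  abs_delta_le : ∀ x, |δ x| ≤ 1
  le_kappa : ∀ x, ε ≤ κ x
  kappa_le : ∀ x, κ x ≤ 1 + ε
  integral_pi : ∀ c : X → ℝ, @BoundedMeasurable X m₁ c → ∫ x, c x * π x ∂Q = ∫ x, c x * A x ∂Q
  integral_delta : ∀ c : X → ℝ, @BoundedMeasurable X m₂ c →
    ∫ x, c x * δ x ∂Q = ∫ x, c x * A x ∂Q
  integral_kappa : ∀ c : X → ℝ, @BoundedMeasurable X m₂ c →
    ∫ x, c x * κ x ∂Q = ∫ x, c x * (π x ^ 2 - δ x ^ 2) ∂Q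

namespace Obs

variable {𝒵 ℒ : Type*}

theorem treatInd_one : (treatInd 1 : Obs 𝒵 ℒ → ℝ) = A := by
  ext o
  simp only [treatInd, A]
  generalize treat o = a
  fin_cases a <;> simp

theorem treatInd_nonneg (a : Fin 2) (o : Obs 𝒵 ℒ) : 0 ≤ treatInd a o := by
  unfold treatInd; split_ifs <;> norm_num

theorem treatInd_le_one (a : Fin 2) (o : Obs 𝒵 ℒ) : treatInd a o ≤ 1 := by
  unfold treatInd; split_ifs <;> norm_num

variable [MeasurableSpace 𝒵] [MeasurableSpace ℒ]

theorem measurable_Z : Measurable (Z : Obs 𝒵 ℒ → 𝒵) := measurable_fst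

theorem measurable_treat : Measurable (treat : Obs 𝒵 ℒ → Fin 2) := measurable_snd.fst

theorem measurable_Y : Measurable (Y : Obs 𝒵 ℒ → ℝ) := measurable_snd.snd.fst

theorem measurable_L : Measurable (L : Obs 𝒵 ℒ → ℒ) := measurable_snd.snd.snd

theorem measurable_treatInd (a : Fin 2) : Measurable (treatInd a : Obs 𝒵 ℒ → ℝ) :=
  Measurable.ite (measurable_treat (measurableSet_singleton a)) measurable_const measurable_const

theorem boundedMeasurable_treatInd (a : Fin 2) :
    BoundedMeasurable (treatInd a : Obs 𝒵 ℒ → ℝ) :=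
  ⟨measurable_treatInd a, 1, fun o => by
    rw [abs_of_nonneg (treatInd_nonneg a o)]; exact treatInd_le_one a o⟩

theorem boundedMeasurable_A : BoundedMeasurable (A : Obs 𝒵 ℒ → ℝ) :=
  treatInd_one (𝒵 := 𝒵) (ℒ := ℒ) ▸ boundedMeasurable_treatInd 1

theorem sigmaZL_le : (sigmaZL : MeasurableSpace (Obs 𝒵 ℒ)) ≤ Prod.instMeasurableSpace :=
  (measurable_Z.prodMk measurable_L).comap_le

theorem sigmaL_le_sigmaZL : (sigmaL : MeasurableSpace (Obs 𝒵 ℒ)) ≤ sigmaZL := by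
  rintro s ⟨t, ht, rfl⟩
  exact ⟨Prod.snd ⁻¹' t, measurable_snd ht, rfl⟩

theorem sigmaL_le : (sigmaL : MeasurableSpace (Obs 𝒵 ℒ)) ≤ Prod.instMeasurableSpace :=
  measurable_L.comap_le

end Obs

/-! ### Propensities, positivity and the weighted form of the functional. -/

section

open Obs

variable {𝒵 ℒ : Type*} [MeasurableSpace 𝒵] [MeasurableSpace ℒ] {Q : Measure (Obs 𝒵 ℒ)}
  [IsProbabilityMeasure Q]

theorem condExp_mem_Icc {X : Type*} {m m0 : MeasurableSpace X} (hm : m ≤ m0) {Q : Measure[m0] X}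
    [IsProbabilityMeasure Q] {f : X → ℝ} (hf : Integrable f Q) (h : ∀ᵐ x ∂Q, 0 ≤ f x ∧ f x ≤ 1) :
    ∀ᵐ x ∂Q, 0 ≤ (Q[f | m]) x ∧ (Q[f | m]) x ≤ 1 := by
  have h1 := condExp_mono (m := m) hf (integrable_const (1 : ℝ)) (h.mono fun x hx => hx.2)
  have h0 := condExp_nonneg (m := m) (μ := Q) (f := f) (h.mono fun x hx => hx.1)
  rw [condExp_const hm] at h1
  filter_upwards [h0, h1] with x h0 h1 using ⟨h0, h1⟩

theorem propensity_mem_Icc (Q : Measure (Obs 𝒵 ℒ)) [IsProbabilityMeasure Q] (a : Fin 2) :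
    ∀ᵐ o ∂Q, 0 ≤ propensity Q a o ∧ propensity Q a o ≤ 1 :=
  condExp_mem_Icc sigmaZL_le (boundedMeasurable_treatInd a).integrable
    (.of_forall fun o => ⟨treatInd_nonneg a o, treatInd_le_one a o⟩)

theorem condExp_propensity (Q : Measure (Obs 𝒵 ℒ)) [IsProbabilityMeasure Q] (a : Fin 2) :
    Q[propensity Q a | sigmaL] =ᵐ[Q] Q[treatInd a | sigmaL] :=
  condExp_condExp_of_le sigmaL_le_sigmaZL sigmaZL_le

theorem memLp_propensity (Q : Measure (Obs 𝒵 ℒ)) [IsProbabilityMeasure Q] (a : Fin 2) (r : ENNReal) :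
    MemLp (propensity Q a) r Q :=
  .of_bound integrable_condExp.aestronglyMeasurable 1 <| by
    filter_upwards [propensity_mem_Icc Q a] with o ho
    rw [Real.norm_eq_abs, abs_of_nonneg ho.1]; exact ho.2

theorem integrable_A_mul_propensity : Integrable (fun o => A o * propensity Q 1 o) Q :=
  (boundedMeasurable_A.memLp 2).integrable_mul (memLp_propensity Q 1 2)

/-- Conditioning on `(Z, L)` first replaces `A` by the propensity. This is what makes the covariance
`κ` a conditional variance, hence bounded below under positivity. -/
theorem condExp_A_mul_propensity :
    Q[fun o => A o * propensity Q 1 o | sigmaL] =ᵐ[Q] Q[propensity Q 1 ^ 2 | sigmaL] := by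
  have h1 : Q[fun o => A o * propensity Q 1 o | sigmaZL] =ᵐ[Q] propensity Q 1 ^ 2 := by
    have h := condExp_mul_of_stronglyMeasurable_right (μ := Q) (m := sigmaZL)
      (f := A) (g := propensity Q 1) stronglyMeasurable_condExp integrable_A_mul_propensity
      boundedMeasurable_A.integrable
    refine h.trans (.of_eq ?_)
    rw [propensity, treatInd_one, pow_two]
  exact (condExp_condExp_of_le sigmaL_le_sigmaZL sigmaZL_le).symm.trans (condExp_congr_ae h1)

theorem kappa_ae_eq : (trueNuisance Q).κ =ᵐ[Q] Var[propensity Q 1; Q | sigmaL] := by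
  have h1 := condVar_ae_eq_condExp_sq_sub_sq_condExp (sigmaL_le (𝒵 := 𝒵) (ℒ := ℒ))
    (memLp_propensity Q 1 2)
  filter_upwards [h1, condExp_A_mul_propensity (Q := Q), condExp_propensity Q 1]
    with o h1 h2 h3
  rw [treatInd_one] at h3
  simp only [trueNuisance, condCovariance]
  rw [h1, h2]
  simp only [Pi.sub_apply, Pi.pow_apply]
  rw [← h3]
  ring

/-- Bounded versions of `π`, `δ` and `κ` exist under positivity. -/
theorem exists_isNuisance {ε : ℝ} (hpos : PositivityWith Q ε) (hε : 0 < ε) :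
    ∃ π δ κ : Obs 𝒵 ℒ → ℝ, IsNuisance sigmaZL sigmaL Q A ε π δ κ ∧ π =ᵐ[Q] (trueNuisance Q).π ∧
      δ =ᵐ[Q] (trueNuisance Q).δ ∧ κ =ᵐ[Q] (trueNuisance Q).κ := by
  have hδ := condExp_mem_Icc (Q := Q) (f := A) (sigmaL_le (𝒵 := 𝒵) (ℒ := ℒ)) boundedMeasurable_A.integrable
    (.of_forall fun o => by
      rw [← treatInd_one]; exact ⟨treatInd_nonneg 1 o, treatInd_le_one 1 o⟩)
  have hAπ : ∀ᵐ o ∂Q, 0 ≤ A o * propensity Q 1 o ∧ A o * propensity Q 1 o ≤ 1 := by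
    filter_upwards [propensity_mem_Icc Q 1] with o ho
    rw [← treatInd_one]
    exact ⟨mul_nonneg (treatInd_nonneg 1 o) ho.1,
      mul_le_one₀ (treatInd_le_one 1 o) ho.1 ho.2⟩
  -- The true `κ` is at most `1`; the cap `1 + ε` makes the clipping interval nonempty for every `ε
  -- > 0` without first proving `ε ≤ 1`.
  have hκ : ∀ᵐ o ∂Q, ε ≤ (trueNuisance Q).κ o ∧ (trueNuisance Q).κ o ≤ 1 + ε := by
    filter_upwards [hpos 1, kappa_ae_eq (Q := Q), hδ, condExp_propensity Q 1,
      condExp_mem_Icc (sigmaL_le (𝒵 := 𝒵) (ℒ := ℒ)) integrable_A_mul_propensity hAπ]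
      with o h1 h2 h3 h4 h5
    refine ⟨h2 ▸ h1, ?_⟩
    simp only [trueNuisance, condCovariance]
    rw [h4, treatInd_one]
    nlinarith [h5.2, mul_self_nonneg ((Q[A | sigmaL]) o)]
  have e1 : (fun o => clip 0 1 ((trueNuisance Q).π o)) =ᵐ[Q] (trueNuisance Q).π := by
    filter_upwards [propensity_mem_Icc Q 1] with o ho using clip_eq ho.1 ho.2
  have e2 : (fun o => clip 0 1 ((trueNuisance Q).δ o)) =ᵐ[Q] (trueNuisance Q).δ := by
    filter_upwards [hδ] with o ho using clip_eq ho.1 ho.2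
  have e3 : (fun o => clip ε (1 + ε) ((trueNuisance Q).κ o)) =ᵐ[Q] (trueNuisance Q).κ := by
    filter_upwards [hκ] with o ho using clip_eq ho.1 ho.2
  have mκ : StronglyMeasurable[sigmaL] (trueNuisance Q).κ :=
    stronglyMeasurable_condExp.sub (stronglyMeasurable_condExp.mul stronglyMeasurable_condExp)
  have mπ : Measurable[sigmaZL] fun o => clip 0 1 ((trueNuisance Q).π o) :=
    (measurable_clip 0 1).comp stronglyMeasurable_condExp.measurable
  have mδ : Measurable[sigmaL] fun o => clip 0 1 ((trueNuisance Q).δ o) :=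
    (measurable_clip 0 1).comp stronglyMeasurable_condExp.measurable
  have bπ : ∀ o, |clip 0 1 ((trueNuisance Q).π o)| ≤ 1 := fun o => by
    rw [abs_of_nonneg (le_clip _ _ _)]; exact clip_le zero_le_one _
  have bδ : ∀ o, |clip 0 1 ((trueNuisance Q).δ o)| ≤ 1 := fun o => by
    rw [abs_of_nonneg (le_clip _ _ _)]; exact clip_le zero_le_one _
  refine ⟨fun o => clip 0 1 ((trueNuisance Q).π o), fun o => clip 0 1 ((trueNuisance Q).δ o),
    fun o => clip ε (1 + ε) ((trueNuisance Q).κ o), ⟨mπ, mδ,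
      (measurable_clip _ _).comp mκ.measurable, bπ, bδ, fun o => le_clip _ _ _,
      fun o => clip_le (by linarith) _, fun c hc => ?_, fun c hc => ?_, fun c hc => ?_⟩, e1, e2, e3⟩
  · rw [← integral_mul_condExp sigmaZL_le hc boundedMeasurable_A.integrable, ← treatInd_one]
    refine integral_congr_ae ?_
    filter_upwards [e1] with o ho
    rw [ho]; rfl
  · rw [← integral_mul_condExp sigmaL_le hc boundedMeasurable_A.integrable]
    refine integral_congr_ae ?_
    filter_upwards [e2] with o ho
    rw [ho]; rfl
  · have hc' := hc.mono sigmaL_le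
    have hb1 : BoundedMeasurable fun o => clip 0 1 ((trueNuisance Q).π o) :=
      ⟨mπ.mono sigmaZL_le le_rfl, 1, bπ⟩
    have hb2 : BoundedMeasurable fun o => clip 0 1 ((trueNuisance Q).δ o) :=
      ⟨mδ.mono sigmaL_le le_rfl, 1, bδ⟩
    have i1 : Integrable (propensity Q 1 ^ 2) Q := (memLp_propensity Q 1 2).integrable_sq
    have h1 := integral_mul_condExp sigmaL_le hc i1
    have h2 : ∫ o, c o * clip ε (1 + ε) ((trueNuisance Q).κ o) ∂Q =
        ∫ o, (c o * (Q[propensity Q 1 ^ 2 | sigmaL]) o -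
          c o * clip 0 1 ((trueNuisance Q).δ o) ^ 2) ∂Q := by
      refine integral_congr_ae ?_
      filter_upwards [e3, e2, condExp_A_mul_propensity (Q := Q), condExp_propensity Q 1]
        with o h3 h2 h4 h5
      rw [h3, h2]
      simp only [trueNuisance, condCovariance]
      rw [h4, h5, treatInd_one]
      ring
    have i2 : Integrable (fun o => c o * (Q[propensity Q 1 ^ 2 | sigmaL]) o) Q := by
      obtain ⟨h, C, hC⟩ := hc'
      exact integrable_condExp.bdd_mul h.aestronglyMeasurable (.of_forall hC)
    rw [h2, integral_sub i2 (BoundedMeasurable.integrable (by fun_prop)), h1]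
    simp only [mul_sub]
    rw [integral_sub (BoundedMeasurable.integrable (by fun_prop))
      (BoundedMeasurable.integrable (by fun_prop))]
    congr 1
    refine integral_congr_ae ?_
    filter_upwards [e1] with o ho
    rw [ho]; rfl

theorem IsNuisance.boundedMeasurable_inv {X : Type*} {m₁ m₂ m0 : MeasurableSpace X}
    {Q : Measure X} {A : X → ℝ} {ε : ℝ} {π δ κ : X → ℝ} (hε : 0 < ε)
    (h : IsNuisance m₁ m₂ Q A ε π δ κ) : @BoundedMeasurable X m₂ fun x => (κ x)⁻¹ :=
  ⟨h.measurable_kappa.inv, ε⁻¹, fun x => by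
    have := hε.trans_le (h.le_kappa x)
    rw [abs_of_nonneg (by positivity)]
    exact inv_anti₀ hε (h.le_kappa x)⟩

/-- The functional in terms of bounded versions of the nuisance functions. -/
theorem psiAda_eq_integral {ε : ℝ} (hε : 0 < ε) {π δ κ : Obs 𝒵 ℒ → ℝ}
    (h : IsNuisance sigmaZL sigmaL Q A ε π δ κ) (hπ : π =ᵐ[Q] (trueNuisance Q).π)
    (hδ : δ =ᵐ[Q] (trueNuisance Q).δ) (hκ : κ =ᵐ[Q] (trueNuisance Q).κ) (hY : MemLp Y 2 Q) :
    psiAda Q = ∫ o, Y o * ((π o - δ o) * (κ o)⁻¹) ∂Q := by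
  have hinv := h.boundedMeasurable_inv hε
  have hYi : Integrable Y Q := hY.integrable one_le_two
  have hYπ : Integrable (fun o => Y o * propensity Q 1 o) Q :=
    hY.integrable_mul (memLp_propensity Q 1 2)
  have bdd : ∀ {c f : Obs 𝒵 ℒ → ℝ}, @BoundedMeasurable _ sigmaL c → Integrable f Q →
      Integrable (fun o => c o * f o) Q := fun hc hf => by
    obtain ⟨hc, C, hC⟩ := hc.mono sigmaL_le
    exact hf.bdd_mul hc.aestronglyMeasurable (.of_forall hC)
  have hδb : @BoundedMeasurable _ sigmaL fun o => (κ o)⁻¹ * δ o :=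
    hinv.mul ⟨h.measurable_delta, 1, h.abs_delta_le⟩
  have e : psiAda Q = ∫ o, ((κ o)⁻¹ * (Q[fun o => Y o * propensity Q 1 o | sigmaL]) o -
      (κ o)⁻¹ * δ o * (Q[Y | sigmaL]) o) ∂Q := by
    refine integral_congr_ae ?_
    filter_upwards [hδ, hκ, condExp_propensity Q 1] with o h2 h3 h5
    rw [h2, h3]
    simp only [trueNuisance, condCovariance]
    rw [h5, treatInd_one]
    ring
  rw [e, integral_sub (bdd hinv integrable_condExp) (bdd hδb integrable_condExp),
    integral_mul_condExp sigmaL_le hinv hYπ, integral_mul_condExp sigmaL_le hδb hYi,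
    ← integral_sub (bdd hinv hYπ) (bdd hδb hYi)]
  refine integral_congr_ae ?_
  filter_upwards [hπ] with o ho
  rw [ho]
  simp only [trueNuisance]
  ring

end

/-! ## The second order remainder -/

namespace IsNuisance

section Basic

variable {X : Type*} {m₁ m₂ m0 : MeasurableSpace X} {Q : Measure X}
  {A : X → ℝ} {ε : ℝ} {π δ κ : X → ℝ}

theorem bdd_pi (h : IsNuisance m₁ m₂ Q A ε π δ κ) : @BoundedMeasurable X m₁ π :=
  ⟨h.measurable_pi, 1, h.abs_pi_le⟩

theorem bdd_delta (h : IsNuisance m₁ m₂ Q A ε π δ κ) : @BoundedMeasurable X m₂ δ :=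
  ⟨h.measurable_delta, 1, h.abs_delta_le⟩

theorem abs_kappa_le (hε : 0 < ε) (h : IsNuisance m₁ m₂ Q A ε π δ κ) (x : X) :
    |κ x| ≤ 1 + ε := by
  rw [abs_of_nonneg (hε.le.trans (h.le_kappa x))]
  exact h.kappa_le x

theorem bdd_kappa (hε : 0 < ε) (h : IsNuisance m₁ m₂ Q A ε π δ κ) : @BoundedMeasurable X m₂ κ :=
  ⟨h.measurable_kappa, 1 + ε, h.abs_kappa_le hε⟩

theorem kappa_pos (hε : 0 < ε) (h : IsNuisance m₁ m₂ Q A ε π δ κ) (x : X) : 0 < κ x :=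
  hε.trans_le (h.le_kappa x)

theorem abs_inv_kappa_le (hε : 0 < ε) (h : IsNuisance m₁ m₂ Q A ε π δ κ) (x : X) :
    |(κ x)⁻¹| ≤ ε⁻¹ := by
  rw [abs_of_pos (inv_pos.2 (h.kappa_pos hε x))]
  exact inv_anti₀ hε (h.le_kappa x)

theorem abs_weight_le (hε : 0 < ε) (h : IsNuisance m₁ m₂ Q A ε π δ κ) (x : X) :
    |(π x - δ x) * (κ x)⁻¹| ≤ 2 * ε⁻¹ := by
  rw [abs_mul]
  exact mul_le_mul ((abs_sub _ _).trans (by linarith [h.abs_pi_le x, h.abs_delta_le x]))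
    (h.abs_inv_kappa_le hε x) (abs_nonneg _) zero_le_two

variable [IsFiniteMeasure Q]

theorem integral_pi_sub (hm : m₁ ≤ m0) (hA : BoundedMeasurable A)
    (h : IsNuisance m₁ m₂ Q A ε π δ κ) {c : X → ℝ} (hc : @BoundedMeasurable X m₁ c) :
    ∫ x, c x * (π x - A x) ∂Q = 0 := by
  have h1 := hc.mono hm
  have h2 := h.bdd_pi.mono hm
  simp only [mul_sub]
  rw [integral_sub (BoundedMeasurable.integrable (by fun_prop))
    (BoundedMeasurable.integrable (by fun_prop)), h.integral_pi c hc, sub_self]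

theorem integral_delta_sub (hm : m₂ ≤ m0) (hA : BoundedMeasurable A)
    (h : IsNuisance m₁ m₂ Q A ε π δ κ) {c : X → ℝ} (hc : @BoundedMeasurable X m₂ c) :
    ∫ x, c x * (δ x - A x) ∂Q = 0 := by
  have h1 := hc.mono hm
  have h2 := h.bdd_delta.mono hm
  simp only [mul_sub]
  rw [integral_sub (BoundedMeasurable.integrable (by fun_prop))
    (BoundedMeasurable.integrable (by fun_prop)), h.integral_delta c hc, sub_self]

theorem integral_kappa_sub (hm : m₁ ≤ m0) (hm' : m₂ ≤ m0) (hε : 0 < ε)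
    (h : IsNuisance m₁ m₂ Q A ε π δ κ) {c : X → ℝ} (hc : @BoundedMeasurable X m₂ c) :
    ∫ x, c x * (κ x - (π x ^ 2 - δ x ^ 2)) ∂Q = 0 := by
  have h1 := hc.mono hm'
  have h2 := h.bdd_pi.mono hm
  have h3 := h.bdd_delta.mono hm'
  have h4 := (h.bdd_kappa hε).mono hm'
  have : ∫ x, c x * (κ x - (π x ^ 2 - δ x ^ 2)) ∂Q =
      ∫ x, c x * κ x - c x * (π x ^ 2 - δ x ^ 2) ∂Q := by simp only [mul_sub]
  rw [this, integral_sub (BoundedMeasurable.integrable (by fun_prop))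
    (BoundedMeasurable.integrable (by fun_prop)), h.integral_kappa c hc, sub_self]

end Basic

section Rates

variable {X : Type*} {m₁ m₂ m0 : MeasurableSpace X} {ν : Measure X} {p q A : X → ℝ} {ε : ℝ}
  {π δ κ πQ δQ κQ : X → ℝ} [IsProbabilityMeasure (densityLaw ν q)]

/-- The part of the influence function which comes from the estimation of the nuisance
functions, for bounded `ξ`, `η`, `γ`. -/
def nuisancePart (A π δ κ ξ η γ : X → ℝ) (x : X) : ℝ :=
  (κ x)⁻¹ * (ξ x * (A x - π x) - η x * (A x - δ x)) -
    γ x * (κ x)⁻¹ * ((A x - δ x) ^ 2 - (A x - π x) ^ 2 - κ x)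

/-- An exact von Mises expansion, with no smallness assumed. The first and last terms on the right
are products of nuisance errors; the two middle ones pair an error with `ξ - η` or `ξ w - γ`, which
will be conditionally centred under `p`. -/
theorem remainder_eq (hm : m₁ ≤ m0) (hm' : m₂ ≤ m₁) (hε : 0 < ε) (hA : BoundedMeasurable A)
    (hP : IsNuisance m₁ m₂ (densityLaw ν p) A ε π δ κ)
    (hQ : IsNuisance m₁ m₂ (densityLaw ν q) A ε πQ δQ κQ) {ξ η γ : X → ℝ}
    (hξ : @BoundedMeasurable X m₁ ξ) (hη : @BoundedMeasurable X m₂ η)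
    (hγ : @BoundedMeasurable X m₂ γ) :
    ∫ x, ξ x * ((πQ x - δQ x) * (κQ x)⁻¹ - (π x - δ x) * (κ x)⁻¹) ∂(densityLaw ν q) -
      ∫ x, nuisancePart A π δ κ ξ η γ x ∂(densityLaw ν q) =
    - ∫ x, ξ x * (κ x)⁻¹ * (κQ x)⁻¹ * ((πQ x - π x) - (δQ x - δ x) -
        (π x - δ x) * (κ x)⁻¹ * (κQ x - κ x)) * (κQ x - κ x) ∂(densityLaw ν q)
      - ∫ x, (ξ x - η x) * ((κ x)⁻¹ * (δQ x - δ x)) ∂(densityLaw ν q)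
      - ∫ x, (ξ x * ((π x - δ x) * (κ x)⁻¹) - γ x) * ((κ x)⁻¹ * (κQ x - κ x)) ∂(densityLaw ν q)
      - ∫ x, γ x * (κ x)⁻¹ * ((πQ x - π x) ^ 2 - (δQ x - δ x) ^ 2) ∂(densityLaw ν q) := by
  have w2 := hP.boundedMeasurable_inv hε
  have w1 := w2.mono hm'
  have z1 := hQ.integral_pi_sub hm hA (hξ.mul w1)
  have z2 := hQ.integral_delta_sub (hm'.trans hm) hA (hη.mul w2)
  have z3 := hQ.integral_kappa_sub hm (hm'.trans hm) hε (hγ.mul w2)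
  have z4 := hQ.integral_pi_sub hm hA (((hγ.mul w2).mono hm').mul hP.bdd_pi)
  have z5 := hQ.integral_delta_sub (hm'.trans hm) hA ((hγ.mul w2).mul hP.bdd_delta)
  have w := w1.mono hm
  have b1 := hP.bdd_pi.mono hm
  have b2 := hP.bdd_delta.mono (hm'.trans hm)
  have b3 := hQ.bdd_pi.mono hm
  have b4 := hQ.bdd_delta.mono (hm'.trans hm)
  have b5 := (hP.bdd_kappa hε).mono (hm'.trans hm)
  have b6 := (hQ.bdd_kappa hε).mono (hm'.trans hm)
  have wQ := (hQ.boundedMeasurable_inv hε).mono (hm'.trans hm)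
  have bξ := hξ.mono hm
  have bη := hη.mono (hm'.trans hm)
  have bγ := hγ.mono (hm'.trans hm)
  have hB : BoundedMeasurable (nuisancePart A π δ κ ξ η γ) := by
    unfold nuisancePart; fun_prop
  have I : ∀ {f : X → ℝ}, BoundedMeasurable f → Integrable f (densityLaw ν q) :=
    fun h => h.integrable
  rw [← integral_neg, ← integral_sub (I (by fun_prop)) (I hB),
    ← integral_sub (I (by fun_prop)) (I (by fun_prop)),
    ← integral_sub (I (by fun_prop)) (I (by fun_prop)),
    ← integral_sub (I (by fun_prop)) (I (by fun_prop)), ← sub_eq_zero,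
    ← integral_sub (I (by fun_prop)) (I (by fun_prop))]
  -- This combination of moment equations under `q` is precisely the discrepancy between the two
  -- sides. What then remains is pointwise algebra, expanding `(πQ - δQ) / κQ` to second order
  -- around `(π - δ) / κ`.
  have z : ∫ x, (ξ x * (κ x)⁻¹ * (πQ x - A x) - η x * (κ x)⁻¹ * (δQ x - A x) -
      γ x * (κ x)⁻¹ * (κQ x - (πQ x ^ 2 - δQ x ^ 2)) -
      2 * (γ x * (κ x)⁻¹ * π x * (πQ x - A x)) + 2 * (γ x * (κ x)⁻¹ * δ x * (δQ x - A x)))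
      ∂(densityLaw ν q) = 0 := by
    rw [integral_add (I (by fun_prop)) (I (by fun_prop)),
      integral_sub (I (by fun_prop)) (I (by fun_prop)),
      integral_sub (I (by fun_prop)) (I (by fun_prop)),
      integral_sub (I (by fun_prop)) (I (by fun_prop)), integral_const_mul, integral_const_mul,
      z1, z2, z3, z4, z5]
    ring
  rw [← z]
  refine integral_congr_ae (.of_forall fun x => ?_)
  have k1 : κ x * (κ x)⁻¹ = 1 := mul_inv_cancel₀ (hP.kappa_pos hε x).ne'
  have k2 : κQ x * (κQ x)⁻¹ = 1 := mul_inv_cancel₀ (hQ.kappa_pos hε x).ne'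
  simp only [nuisancePart]
  generalize (κ x)⁻¹ = w at k1 ⊢
  generalize (κQ x)⁻¹ = wQ at k2 ⊢
  linear_combination ξ x * ((πQ x - δQ x) - (π x - δ x) * w * (κQ x - κ x)) * (w * k2 - wQ * k1)

variable [IsProbabilityMeasure (densityLaw ν p)]

/-- The constant in the rate of the nuisance functions. -/
def rate (ε : ℝ) : ℝ := 1280 + 40 * (1 + ε) ^ 2

/-- The general rate applies with `f = fQ = A` and `B = 1`, since the regressed variable does not
depend on the law. -/
theorem integral_pi_sub_sq_le (hm : m₁ ≤ m0) (hp : Measurable p) (h0 : ∀ x, 0 ≤ p x)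
    (hq : Measurable q) (hq0 : ∀ x, 0 ≤ q x) (hA : Measurable A) (hA1 : ∀ x, |A x| ≤ 1)
    (hP : IsNuisance m₁ m₂ (densityLaw ν p) A ε π δ κ)
    (hQ : IsNuisance m₁ m₂ (densityLaw ν q) A ε πQ δQ κQ) :
    ∫ x, (πQ x - π x) ^ 2 ∂(densityLaw ν q) ≤ 40 * hellingerSq ν p q := by
  have hc := hQ.bdd_pi.sub hP.bdd_pi
  have h := integral_sq_sub_densityLaw_le (ν := ν) hp h0 hq hq0
    (hP.measurable_pi.mono hm le_rfl) (hQ.measurable_pi.mono hm le_rfl) hA hA hP.abs_pi_le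
    hQ.abs_pi_le hA1 hA1 (hQ.integral_pi _ hc).symm (hP.integral_pi _ hc).symm
  simpa using h

theorem integral_delta_sub_sq_le (hm : m₂ ≤ m0) (hp : Measurable p) (h0 : ∀ x, 0 ≤ p x)
    (hq : Measurable q) (hq0 : ∀ x, 0 ≤ q x) (hA : Measurable A) (hA1 : ∀ x, |A x| ≤ 1)
    (hP : IsNuisance m₁ m₂ (densityLaw ν p) A ε π δ κ)
    (hQ : IsNuisance m₁ m₂ (densityLaw ν q) A ε πQ δQ κQ) :
    ∫ x, (δQ x - δ x) ^ 2 ∂(densityLaw ν q) ≤ 40 * hellingerSq ν p q := by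
  have hc := hQ.bdd_delta.sub hP.bdd_delta
  have h := integral_sq_sub_densityLaw_le (ν := ν) hp h0 hq hq0
    (hP.measurable_delta.mono hm le_rfl) (hQ.measurable_delta.mono hm le_rfl) hA hA
    hP.abs_delta_le hQ.abs_delta_le hA1 hA1 (hQ.integral_delta _ hc).symm
    (hP.integral_delta _ hc).symm
  simpa using h

theorem abs_sq_sub_sq_le {x y : ℝ} (hx : |x| ≤ 1) (hy : |y| ≤ 1) : |x ^ 2 - y ^ 2| ≤ 1 := by
  have h1 := (sq_le_one_iff_abs_le_one x).2 hx
  have h2 := (sq_le_one_iff_abs_le_one y).2 hy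
  exact abs_le.2 ⟨by nlinarith [sq_nonneg x], by nlinarith [sq_nonneg y]⟩

/-- Here the regressed variable `π² - δ²` itself changes with the law, so the rates for `π` and `δ`
enter. They contribute `2 (8 · 40 + 8 · 40) = 1280` to `rate`, and the bound `1 + ε` on `κ`
contributes `40 (1 + ε)²`. -/
theorem integral_kappa_sub_sq_le (hm : m₁ ≤ m0) (hm' : m₂ ≤ m0) (hε : 0 < ε) (hp : Measurable p)
    (h0 : ∀ x, 0 ≤ p x) (hq : Measurable q) (hq0 : ∀ x, 0 ≤ q x) (hA : Measurable A)
    (hA1 : ∀ x, |A x| ≤ 1) (hP : IsNuisance m₁ m₂ (densityLaw ν p) A ε π δ κ)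
    (hQ : IsNuisance m₁ m₂ (densityLaw ν q) A ε πQ δQ κQ) :
    ∫ x, (κQ x - κ x) ^ 2 ∂(densityLaw ν q) ≤ rate ε * hellingerSq ν p q := by
  have hc := (hQ.bdd_kappa hε).sub (hP.bdd_kappa hε)
  have b1 := hP.bdd_pi.mono hm
  have b2 := hP.bdd_delta.mono hm'
  have b3 := hQ.bdd_pi.mono hm
  have b4 := hQ.bdd_delta.mono hm'
  have h := integral_sq_sub_densityLaw_le (ν := ν) hp h0 hq hq0
    (hP.measurable_kappa.mono hm' le_rfl) (hQ.measurable_kappa.mono hm' le_rfl)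
    ((b1.1.pow_const 2).sub (b2.1.pow_const 2)) ((b3.1.pow_const 2).sub (b4.1.pow_const 2))
    (hP.abs_kappa_le hε) (hQ.abs_kappa_le hε)
    (fun x => (abs_sq_sub_sq_le (hP.abs_pi_le x) (hP.abs_delta_le x)).trans (by linarith))
    (fun x => (abs_sq_sub_sq_le (hQ.abs_pi_le x) (hQ.abs_delta_le x)).trans (by linarith))
    (hQ.integral_kappa _ hc).symm (hP.integral_kappa _ hc).symm
  have h1 := integral_pi_sub_sq_le hm hp h0 hq hq0 hA hA1 hP hQ
  have h2 := integral_delta_sub_sq_le hm' hp h0 hq hq0 hA hA1 hP hQ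
  have h3 : ∫ x, ((πQ x ^ 2 - δQ x ^ 2) - (π x ^ 2 - δ x ^ 2)) ^ 2 ∂(densityLaw ν q) ≤
      8 * ∫ x, (πQ x - π x) ^ 2 ∂(densityLaw ν q) +
        8 * ∫ x, (δQ x - δ x) ^ 2 ∂(densityLaw ν q) := by
    rw [← integral_const_mul, ← integral_const_mul,
      ← integral_add (BoundedMeasurable.integrable (by fun_prop))
      (BoundedMeasurable.integrable (by fun_prop))]
    refine integral_mono (BoundedMeasurable.integrable (by fun_prop))
      (BoundedMeasurable.integrable (by fun_prop)) fun x => ?_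
    have e : (πQ x ^ 2 - δQ x ^ 2) - (π x ^ 2 - δ x ^ 2) =
      (πQ x + π x) * (πQ x - π x) - (δQ x + δ x) * (δQ x - δ x) := by ring
    have s : ∀ u v : ℝ, |u| ≤ 1 → |v| ≤ 1 → (u + v) ^ 2 ≤ 4 := fun u v hu hv => by
      have h : |u + v| ≤ 2 := (abs_add_le u v).trans (by linarith)
      rw [← sq_abs]; nlinarith [abs_nonneg (u + v)]
    have s1 := mul_le_mul_of_nonneg_right (s _ _ (hQ.abs_pi_le x) (hP.abs_pi_le x))
      (sq_nonneg (πQ x - π x))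
    have s2 := mul_le_mul_of_nonneg_right (s _ _ (hQ.abs_delta_le x) (hP.abs_delta_le x))
      (sq_nonneg (δQ x - δ x))
    simp only [e]
    rw [← mul_pow] at s1 s2
    nlinarith [sq_nonneg ((πQ x + π x) * (πQ x - π x) + (δQ x + δ x) * (δQ x - δ x))]
  simp only [Pi.sub_apply] at h
  rw [rate]
  linarith

/-- The remainder is of second order: it is bounded by the squared Hellinger distance. -/
theorem exists_abs_remainder_le (hm : m₁ ≤ m0) (hm' : m₂ ≤ m₁) (hε : 0 < ε) (hp : Measurable p)
    (h0 : ∀ x, 0 ≤ p x) (hA : Measurable A) (hA1 : ∀ x, |A x| ≤ 1)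
    (hP : IsNuisance m₁ m₂ (densityLaw ν p) A ε π δ κ) {ξ η γ : X → ℝ}
    (hξ : @BoundedMeasurable X m₁ ξ) (hη : @BoundedMeasurable X m₂ η)
    (hγ : @BoundedMeasurable X m₂ γ)
    (hξη : ∀ c : X → ℝ, @BoundedMeasurable X m₂ c →
      ∫ x, (ξ x - η x) * c x ∂(densityLaw ν p) = 0)
    (hξγ : ∀ c : X → ℝ, @BoundedMeasurable X m₂ c →
      ∫ x, (ξ x * ((π x - δ x) * (κ x)⁻¹) - γ x) * c x ∂(densityLaw ν p) = 0) :
    ∃ C : ℝ, ∀ q : X → ℝ, Measurable q → (∀ x, 0 ≤ q x) →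
      IsProbabilityMeasure (densityLaw ν q) → ∀ πQ δQ κQ : X → ℝ,
      IsNuisance m₁ m₂ (densityLaw ν q) A ε πQ δQ κQ →
      |∫ x, ξ x * ((πQ x - δQ x) * (κQ x)⁻¹ - (π x - δ x) * (κ x)⁻¹) ∂(densityLaw ν q) -
        ∫ x, nuisancePart A π δ κ ξ η γ x ∂(densityLaw ν q)| ≤ C * hellingerSq ν p q := by
  obtain ⟨-, K₁, hK₁⟩ := id hξ
  obtain ⟨-, K₂, hK₂⟩ := id hη
  obtain ⟨-, K₃, hK₃⟩ := id hγ
  set e : ℝ := ε⁻¹ with he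
  have he0 : 0 < e := inv_pos.2 hε
  set R := rate ε with hR
  have hR40 : 40 ≤ R := by rw [hR, rate]; nlinarith [sq_nonneg (1 + ε)]
  -- The four summands bound the four terms of `remainder_eq` in order. They involve only `ε` and
  -- the bounds on `ξ`, `η`, `γ`, so the constant is uniform in `q`.
  refine ⟨K₁ * e * e * ((3 + 2 * e) * (3 * R)) +
    (1 / 4 * (e ^ 2 * R) + (4 * (K₁ + K₂) ^ 2 + (K₁ + K₂) * (e * 2))) +
    (1 / 4 * (e ^ 2 * R) + (4 * (K₁ * (2 * e) + K₃) ^ 2 +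
      (K₁ * (2 * e) + K₃) * (e * (2 * (1 + ε))))) +
    K₃ * e * (2 * R), fun q hq hq0 hqP πQ δQ κQ hQ => ?_⟩
  rw [remainder_eq hm hm' hε ⟨hA, 1, hA1⟩ hP hQ hξ hη hγ]
  have w2 := hP.boundedMeasurable_inv hε
  have w := w2.mono (hm'.trans hm)
  have b1 := hP.bdd_pi.mono hm
  have b2 := hP.bdd_delta.mono (hm'.trans hm)
  have b3 := hQ.bdd_pi.mono hm
  have b4 := hQ.bdd_delta.mono (hm'.trans hm)
  have b5 := (hP.bdd_kappa hε).mono (hm'.trans hm)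
  have b6 := (hQ.bdd_kappa hε).mono (hm'.trans hm)
  have wQ := (hQ.boundedMeasurable_inv hε).mono (hm'.trans hm)
  have bξ := hξ.mono hm
  have bη := hη.mono (hm'.trans hm)
  have bγ := hγ.mono (hm'.trans hm)
  have rπ := integral_pi_sub_sq_le hm hp h0 hq hq0 hA hA1 hP hQ
  have rδ := integral_delta_sub_sq_le (hm'.trans hm) hp h0 hq hq0 hA hA1 hP hQ
  have rκ := integral_kappa_sub_sq_le hm (hm'.trans hm) hε hp h0 hq hq0 hA hA1 hP hQ
  set D := hellingerSq ν p q with hD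
  have hD0 : 0 ≤ D := integral_nonneg fun _ => sq_nonneg _
  have rπ' := rπ.trans (mul_le_mul_of_nonneg_right hR40 hD0)
  have rδ' := rδ.trans (mul_le_mul_of_nonneg_right hR40 hD0)
  have I : ∀ {f : X → ℝ}, BoundedMeasurable f → Integrable f (densityLaw ν q) :=
    fun h => h.integrable
  have pull : ∀ {u v : X → ℝ}, BoundedMeasurable v → (∀ x, |u x| ≤ e) →
      ∫ x, (u x * v x) ^ 2 ∂(densityLaw ν q) ≤ e ^ 2 * ∫ x, v x ^ 2 ∂(densityLaw ν q) := by
    intro u v hv hu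
    rw [← integral_const_mul]
    refine integral_mono_of_nonneg (.of_forall fun _ => sq_nonneg _) (I (by fun_prop))
      (.of_forall fun x => ?_)
    simp only [mul_pow]
    refine mul_le_mul_of_nonneg_right ?_ (sq_nonneg _)
    rw [← sq_abs]; exact pow_le_pow_left₀ (abs_nonneg _) (hu x) 2
  have t2 : |∫ x, (ξ x - η x) * ((κ x)⁻¹ * (δQ x - δ x)) ∂(densityLaw ν q)| ≤
      (1 / 4 * (e ^ 2 * R) + (4 * (K₁ + K₂) ^ 2 + (K₁ + K₂) * (e * 2))) * D := by
    -- The same integral under `p` vanishes because `δQ - δ` and `κ` are `m₂`-measurable; this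
    -- raises a term of apparent first order to second order. The term `t3` is treated in the same
    -- way.
    have h := abs_integral_densityLaw_sub_le (ν := ν) hp h0 hq hq0 (bξ.sub bη).1
      (c := fun x => (κ x)⁻¹ * (δQ x - δ x)) (w.mul (b4.sub b2)).1
      (B := K₁ + K₂) (C := e * 2)
      (fun x => (abs_sub _ _).trans (add_le_add (hK₁ x) (hK₂ x))) (fun x => by
        rw [abs_mul]
        exact mul_le_mul (hP.abs_inv_kappa_le hε x) ((abs_sub _ _).trans
          (by linarith [hQ.abs_delta_le x, hP.abs_delta_le x])) (abs_nonneg _) he0.le)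
    rw [hξη _ (w2.mul (hQ.bdd_delta.sub hP.bdd_delta)), sub_zero] at h
    refine h.trans ?_
    have := (pull (b4.sub b2) (hP.abs_inv_kappa_le hε)).trans
      (mul_le_mul_of_nonneg_left rδ' (sq_nonneg e))
    linarith
  have t3 : |∫ x, (ξ x * ((π x - δ x) * (κ x)⁻¹) - γ x) * ((κ x)⁻¹ * (κQ x - κ x))
      ∂(densityLaw ν q)| ≤ (1 / 4 * (e ^ 2 * R) + (4 * (K₁ * (2 * e) + K₃) ^ 2 +
      (K₁ * (2 * e) + K₃) * (e * (2 * (1 + ε))))) * D := by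
    have h := abs_integral_densityLaw_sub_le (ν := ν) hp h0 hq hq0
      (G := fun x => ξ x * ((π x - δ x) * (κ x)⁻¹) - γ x)
      ((bξ.mul ((b1.sub b2).mul w)).sub bγ).1
      (c := fun x => (κ x)⁻¹ * (κQ x - κ x)) (w.mul (b6.sub b5)).1
      (B := K₁ * (2 * e) + K₃) (C := e * (2 * (1 + ε)))
      (fun x => (abs_sub _ _).trans (add_le_add (by
        rw [abs_mul]
        exact mul_le_mul (hK₁ x) (hP.abs_weight_le hε x) (abs_nonneg _)
          ((abs_nonneg _).trans (hK₁ x))) (hK₃ x))) (fun x => by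
        rw [abs_mul]
        exact mul_le_mul (hP.abs_inv_kappa_le hε x) ((abs_sub _ _).trans
          (by linarith [hQ.abs_kappa_le hε x, hP.abs_kappa_le hε x])) (abs_nonneg _) he0.le)
    rw [hξγ _ (w2.mul ((hQ.bdd_kappa hε).sub (hP.bdd_kappa hε))), sub_zero] at h
    refine h.trans ?_
    have := (pull (b6.sub b5) (hP.abs_inv_kappa_le hε)).trans
      (mul_le_mul_of_nonneg_left rκ (sq_nonneg e))
    linarith
  have t4 : |∫ x, γ x * (κ x)⁻¹ * ((πQ x - π x) ^ 2 - (δQ x - δ x) ^ 2) ∂(densityLaw ν q)| ≤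
      K₃ * e * (2 * R) * D := by
    have h : |∫ x, γ x * (κ x)⁻¹ * ((πQ x - π x) ^ 2 - (δQ x - δ x) ^ 2) ∂(densityLaw ν q)| ≤
        ∫ x, K₃ * e * ((πQ x - π x) ^ 2 + (δQ x - δ x) ^ 2) ∂(densityLaw ν q) := by
      refine abs_integral_le_integral_abs.trans (integral_mono_of_nonneg
        (.of_forall fun _ => abs_nonneg _) (I (by fun_prop)) (.of_forall fun x => ?_))
      simp only [abs_mul]
      have hK := (abs_nonneg _).trans (hK₃ x)
      refine mul_le_mul (mul_le_mul (hK₃ x) (hP.abs_inv_kappa_le hε x) (abs_nonneg _) hK)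
        ?_ (abs_nonneg _) (by positivity)
      exact abs_le.2 ⟨by linarith [sq_nonneg (πQ x - π x)], by linarith [sq_nonneg (δQ x - δ x)]⟩
    rw [integral_const_mul, integral_add (I (by fun_prop)) (I (by fun_prop))] at h
    have hK0 : 0 ≤ K₃ * e := by
      -- A point of the space is needed only to read off `0 ≤ K₃` from the pointwise bound.
      obtain ⟨x⟩ : Nonempty X := (densityLaw ν q).nonempty_of_neZero
      exact mul_nonneg ((abs_nonneg _).trans (hK₃ x)) he0.le
    refine h.trans ((mul_le_mul_of_nonneg_left (add_le_add rπ' rδ') hK0).trans_eq (by ring))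
  have t1 : |∫ x, ξ x * (κ x)⁻¹ * (κQ x)⁻¹ * ((πQ x - π x) - (δQ x - δ x) -
        (π x - δ x) * (κ x)⁻¹ * (κQ x - κ x)) * (κQ x - κ x) ∂(densityLaw ν q)| ≤
      K₁ * e * e * ((3 + 2 * e) * (3 * R)) * D := by
    have h : |∫ x, ξ x * (κ x)⁻¹ * (κQ x)⁻¹ * ((πQ x - π x) - (δQ x - δ x) -
        (π x - δ x) * (κ x)⁻¹ * (κQ x - κ x)) * (κQ x - κ x) ∂(densityLaw ν q)| ≤
        ∫ x, K₁ * e * e * ((3 + 2 * e) *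
          ((πQ x - π x) ^ 2 + (δQ x - δ x) ^ 2 + (κQ x - κ x) ^ 2)) ∂(densityLaw ν q) := by
      refine abs_integral_le_integral_abs.trans (integral_mono_of_nonneg
        (.of_forall fun _ => abs_nonneg _) (I (by fun_prop)) (.of_forall fun x => ?_))
      simp only
      rw [mul_assoc (ξ x * (κ x)⁻¹ * (κQ x)⁻¹), abs_mul, abs_mul, abs_mul]
      have hK := (abs_nonneg _).trans (hK₁ x)
      refine mul_le_mul (mul_le_mul (mul_le_mul (hK₁ x) (hP.abs_inv_kappa_le hε x)
        (abs_nonneg _) hK) (hQ.abs_inv_kappa_le hε x) (abs_nonneg _) (by positivity))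
        ?_ (abs_nonneg _) (by positivity)
      have hw := abs_le.1 (hP.abs_weight_le hε x)
      generalize (π x - δ x) * (κ x)⁻¹ = h at hw ⊢
      generalize πQ x - π x = a
      generalize δQ x - δ x = d
      generalize κQ x - κ x = k
      have hk : |h * k ^ 2| ≤ 2 * e * k ^ 2 := by
        rw [abs_mul, abs_of_nonneg (sq_nonneg k)]
        exact mul_le_mul_of_nonneg_right (abs_le.2 hw) (sq_nonneg k)
      have hk' := abs_le.1 hk
      have hea : 0 ≤ e * a ^ 2 := by positivity
      have hed : 0 ≤ e * d ^ 2 := by positivity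
      have hek : 0 ≤ e * k ^ 2 := by positivity
      refine abs_le.2 ⟨?_, ?_⟩
      · nlinarith [sq_nonneg (a + k), sq_nonneg (d - k), sq_nonneg a, sq_nonneg d, sq_nonneg k]
      · nlinarith [sq_nonneg (a - k), sq_nonneg (d + k), sq_nonneg a, sq_nonneg d, sq_nonneg k]
    rw [integral_const_mul, integral_const_mul, integral_add (I (by fun_prop)) (I (by fun_prop)),
      integral_add (I (by fun_prop)) (I (by fun_prop))] at h
    have hK0 : 0 ≤ K₁ * e * e := by
      obtain ⟨x⟩ : Nonempty X := (densityLaw ν q).nonempty_of_neZero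
      have := (abs_nonneg _).trans (hK₁ x)
      positivity
    refine h.trans ((mul_le_mul_of_nonneg_left (mul_le_mul_of_nonneg_left
      (add_le_add (add_le_add rπ' rδ') rκ) (by positivity)) hK0).trans_eq (by ring))
  rw [add_mul, add_mul, add_mul]
  refine (abs_sub _ _).trans (add_le_add ((abs_sub _ _).trans (add_le_add
    ((abs_sub _ _).trans (add_le_add ?_ t2)) t3)) t4)
  rwa [abs_neg]

end Rates

end IsNuisance

/-! ## Approximation by bounded nuisance functions -/

section CondExp

variable {X : Type*} {m m0 : MeasurableSpace X} {Q : Measure X}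

/-- Clipping changes the conditional expectation only on a null set, but makes the bound hold
everywhere, as the test-function framework requires. -/
theorem exists_boundedMeasurable_condExp {f : X → ℝ} (hf : BoundedMeasurable f) :
    ∃ g : X → ℝ, @BoundedMeasurable X m g ∧ g =ᵐ[Q] Q[f | m] := by
  obtain ⟨-, C, hC⟩ := hf
  have h : ∀ᵐ x ∂Q, |(Q[f | m]) x| ≤ (C.toNNReal : ℝ) :=
    ae_bdd_abs_condExp_of_ae_bdd_abs (.of_forall fun x => (hC x).trans (Real.le_coe_toNNReal C))
  refine ⟨fun x => clip (-(C.toNNReal : ℝ)) C.toNNReal ((Q[f | m]) x),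
    ⟨(measurable_clip _ _).comp stronglyMeasurable_condExp.measurable, C.toNNReal, fun x => ?_⟩, ?_⟩
  · have : (0 : ℝ) ≤ C.toNNReal := NNReal.coe_nonneg _
    exact abs_le.2 ⟨le_clip _ _ _, clip_le (by linarith) _⟩
  · filter_upwards [h] with x hx using clip_eq (abs_le.1 hx).1 (abs_le.1 hx).2

variable [IsProbabilityMeasure Q]

theorem integral_sub_condExp_mul (hm : m ≤ m0) {f g c : X → ℝ} (hf : Integrable f Q)
    (hg : g =ᵐ[Q] Q[f | m]) (hc : @BoundedMeasurable X m c) :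
    ∫ x, (f x - g x) * c x ∂Q = 0 := by
  have bdd : ∀ {u : X → ℝ}, Integrable u Q → Integrable (fun x => c x * u x) Q := fun hu => by
    obtain ⟨hc, C, hC⟩ := hc.mono hm
    exact hu.bdd_mul hc.aestronglyMeasurable (.of_forall hC)
  have h : ∫ x, (f x - g x) * c x ∂Q = ∫ x, (c x * f x - c x * (Q[f | m]) x) ∂Q := by
    refine integral_congr_ae ?_
    filter_upwards [hg] with x hx
    rw [hx]; ring
  rw [h, integral_sub (bdd hf) (bdd integrable_condExp), integral_mul_condExp hm hc hf, sub_self]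

/-- The contraction property follows from nonnegativity of the conditional variance. -/
theorem integral_condExp_sq_le (hm : m ≤ m0) {f : X → ℝ} (hf : MemLp f 2 Q) :
    ∫ x, (Q[f | m]) x ^ 2 ∂Q ≤ ∫ x, f x ^ 2 ∂Q := by
  have h : ∀ᵐ x ∂Q, (Q[f | m]) x ^ 2 ≤ (Q[f ^ 2 | m]) x := by
    have h0 : 0 ≤ᵐ[Q] Var[f; Q | m] := condExp_nonneg (.of_forall fun x => sq_nonneg _)
    filter_upwards [condVar_ae_eq_condExp_sq_sub_sq_condExp hm hf, h0] with x h1 h2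
    rw [h1] at h2
    simpa using h2
  calc _ ≤ ∫ x, (Q[f ^ 2 | m]) x ∂Q :=
        integral_mono_ae (hf.condExp one_le_two).integrable_sq integrable_condExp h
    _ = _ := integral_condExp hm

theorem integral_sub_sq_le_of_condExp (hm : m ≤ m0) {f f' g g' : X → ℝ} (hf : MemLp f 2 Q)
    (hf' : MemLp f' 2 Q) (hg : g =ᵐ[Q] Q[f | m]) (hg' : g' =ᵐ[Q] Q[f' | m]) :
    ∫ x, (g x - g' x) ^ 2 ∂Q ≤ ∫ x, (f x - f' x) ^ 2 ∂Q := by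
  refine le_trans (le_of_eq ?_) (integral_condExp_sq_le hm (hf.sub hf'))
  refine integral_congr_ae ?_
  filter_upwards [hg, hg', condExp_sub (hf.integrable one_le_two) (hf'.integrable one_le_two) m]
    with x h1 h2 h3
  rw [h1, h2, ← Pi.sub_apply (Q[f | m]), ← h3]; rfl

end CondExp

namespace IsNuisance

variable {X : Type*} {m₁ m₂ m0 : MeasurableSpace X} {A : X → ℝ} {ε : ℝ} {π δ κ : X → ℝ}

theorem bdd_weight (hm' : m₂ ≤ m₁) (hε : 0 < ε) {Q : Measure X}
    (h : IsNuisance m₁ m₂ Q A ε π δ κ) :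
    @BoundedMeasurable X m₁ fun x => (π x - δ x) * (κ x)⁻¹ :=
  (h.bdd_pi.sub (h.bdd_delta.mono hm')).mul ((h.boundedMeasurable_inv hε).mono hm')

/-- `nuisancePart` is linear in `(ξ, η, γ)` with bounded coefficients, so `L²` approximation of
these three functions passes to it. -/
theorem nuisancePart_sub_sq_le (hε : 0 < ε) {P : Measure X} (hA1 : ∀ x, |A x| ≤ 1)
    (hP : IsNuisance m₁ m₂ P A ε π δ κ) (ξ η γ ξ' η' γ' : X → ℝ) (x : X) :
    (nuisancePart A π δ κ ξ' η' γ' x - nuisancePart A π δ κ ξ η γ x) ^ 2 ≤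
      3 * ε⁻¹ ^ 2 * (4 * (ξ x - ξ' x) ^ 2 + 4 * (η x - η' x) ^ 2 +
        (9 + ε) ^ 2 * (γ x - γ' x) ^ 2) := by
  have e : nuisancePart A π δ κ ξ' η' γ' x - nuisancePart A π δ κ ξ η γ x =
      (κ x)⁻¹ * ((ξ' x - ξ x) * (A x - π x) - (η' x - η x) * (A x - δ x) -
        (γ' x - γ x) * ((A x - δ x) ^ 2 - (A x - π x) ^ 2 - κ x)) := by
    simp only [nuisancePart]; ring
  have h1 : (A x - π x) ^ 2 ≤ 4 := by
    have : |A x - π x| ≤ 2 := (abs_sub _ _).trans (by linarith [hA1 x, hP.abs_pi_le x])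
    rw [← sq_abs]; nlinarith [abs_nonneg (A x - π x)]
  have h2 : (A x - δ x) ^ 2 ≤ 4 := by
    have : |A x - δ x| ≤ 2 := (abs_sub _ _).trans (by linarith [hA1 x, hP.abs_delta_le x])
    rw [← sq_abs]; nlinarith [abs_nonneg (A x - δ x)]
  have h3 : ((A x - δ x) ^ 2 - (A x - π x) ^ 2 - κ x) ^ 2 ≤ (9 + ε) ^ 2 := by
    have := abs_le.1 (hP.abs_kappa_le hε x)
    exact sq_le_sq' (by linarith [sq_nonneg (A x - δ x)]) (by linarith [sq_nonneg (A x - π x)])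
  have h4 : (κ x)⁻¹ ^ 2 ≤ ε⁻¹ ^ 2 := by
    rw [← sq_abs]; exact pow_le_pow_left₀ (abs_nonneg _) (hP.abs_inv_kappa_le hε x) 2
  rw [e, mul_pow]
  generalize (A x - δ x) ^ 2 - (A x - π x) ^ 2 - κ x = G at h3
  generalize A x - π x = a at h1
  generalize A x - δ x = d at h2
  calc (κ x)⁻¹ ^ 2 * ((ξ' x - ξ x) * a - (η' x - η x) * d - (γ' x - γ x) * G) ^ 2
      ≤ ε⁻¹ ^ 2 * (3 * ((ξ x - ξ' x) ^ 2 * a ^ 2 + (η x - η' x) ^ 2 * d ^ 2 +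
          (γ x - γ' x) ^ 2 * G ^ 2)) := by
        refine mul_le_mul h4 ?_ (sq_nonneg _) (sq_nonneg _)
        generalize hu : (ξ' x - ξ x) * a = u
        generalize hv : (η' x - η x) * d = v
        generalize hw : (γ' x - γ x) * G = w
        have eu : (ξ x - ξ' x) ^ 2 * a ^ 2 = u ^ 2 := by rw [← hu]; ring
        have ev : (η x - η' x) ^ 2 * d ^ 2 = v ^ 2 := by rw [← hv]; ring
        have ew : (γ x - γ' x) ^ 2 * G ^ 2 = w ^ 2 := by rw [← hw]; ring
        rw [eu, ev, ew]
        nlinarith [sq_nonneg (u + v), sq_nonneg (u + w), sq_nonneg (v - w)]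
    _ ≤ ε⁻¹ ^ 2 * (3 * ((ξ x - ξ' x) ^ 2 * 4 + (η x - η' x) ^ 2 * 4 +
          (γ x - γ' x) ^ 2 * (9 + ε) ^ 2)) := by gcongr
    _ = _ := by ring

theorem memLp_mul_weight (hm : m₁ ≤ m0) (hm' : m₂ ≤ m₁) (hε : 0 < ε) {P : Measure X}
    (hP : IsNuisance m₁ m₂ P A ε π δ κ) {ξ : X → ℝ} (hξ : MemLp ξ 2 P) :
    MemLp (fun x => ξ x * ((π x - δ x) * (κ x)⁻¹)) 2 P := by
  have h := ((hP.bdd_weight hm' hε).mono hm).1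
  refine MemLp.of_le_mul (c := 2 * ε⁻¹) hξ (hξ.1.mul h.aestronglyMeasurable)
    (.of_forall fun x => ?_)
  rw [norm_mul, mul_comm]
  exact mul_le_mul_of_nonneg_right (hP.abs_weight_le hε x) (norm_nonneg _)

theorem memLp_nuisancePart (hm : m₁ ≤ m0) (hm' : m₂ ≤ m₁) (hε : 0 < ε) {P : Measure X}
    (hA : Measurable A) (hA1 : ∀ x, |A x| ≤ 1) (hP : IsNuisance m₁ m₂ P A ε π δ κ)
    {ξ η γ : X → ℝ} (hξ : MemLp ξ 2 P) (hη : MemLp η 2 P) (hγ : MemLp γ 2 P) :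
    MemLp (nuisancePart A π δ κ ξ η γ) 2 P := by
  have hAb : BoundedMeasurable A := ⟨hA, 1, hA1⟩
  have w := ((hP.boundedMeasurable_inv hε).mono hm').mono hm
  have b1 := hP.bdd_pi.mono hm
  have b2 := hP.bdd_delta.mono (hm'.trans hm)
  have b3 := (hP.bdd_kappa hε).mono (hm'.trans hm)
  have key : ∀ {f c : X → ℝ}, MemLp f 2 P → BoundedMeasurable c →
      MemLp (fun x => f x * c x) 2 P := fun {f c} hf hc => by
    obtain ⟨hc, C, hC⟩ := hc
    refine MemLp.of_le_mul (c := C) hf (hf.1.mul hc.aestronglyMeasurable) (.of_forall fun x => ?_)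
    rw [norm_mul, mul_comm]
    exact mul_le_mul_of_nonneg_right (hC x) (norm_nonneg _)
  have h1 := key hξ (c := fun x => (κ x)⁻¹ * (A x - π x)) (by fun_prop)
  have h2 := key hη (c := fun x => (κ x)⁻¹ * (A x - δ x)) (by fun_prop)
  have h3 := key hγ (c := fun x => (κ x)⁻¹ * ((A x - δ x) ^ 2 - (A x - π x) ^ 2 - κ x))
    (by fun_prop)
  refine ((h1.sub h2).sub h3).ae_eq (.of_forall fun x => ?_)
  simp only [nuisancePart, Pi.sub_apply]
  ring

/-- Bounded approximations of the nuisance functions `ξ`, `η`, `γ`. -/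
theorem exists_bounded_approx (hm : m₁ ≤ m0) (hm' : m₂ ≤ m₁) (hε : 0 < ε) {P : Measure X}
    [IsProbabilityMeasure P] (hA1 : ∀ x, |A x| ≤ 1)
    (hP : IsNuisance m₁ m₂ P A ε π δ κ) {ξ η γ : X → ℝ} (hξm : Measurable[m₁] ξ)
    (hξ : MemLp ξ 2 P) (hη : η =ᵐ[P] P[ξ | m₂])
    (hγ : γ =ᵐ[P] P[fun x => ξ x * ((π x - δ x) * (κ x)⁻¹) | m₂]) :
    ∃ C : ℝ, 0 ≤ C ∧ ∀ r : ℝ, 0 < r → ∃ ξ' η' γ' : X → ℝ, @BoundedMeasurable X m₁ ξ' ∧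
      @BoundedMeasurable X m₂ η' ∧ @BoundedMeasurable X m₂ γ' ∧
      (∀ c : X → ℝ, @BoundedMeasurable X m₂ c → ∫ x, (ξ' x - η' x) * c x ∂P = 0) ∧
      (∀ c : X → ℝ, @BoundedMeasurable X m₂ c →
        ∫ x, (ξ' x * ((π x - δ x) * (κ x)⁻¹) - γ' x) * c x ∂P = 0) ∧
      ∫ x, (ξ x - ξ' x) ^ 2 ∂P ≤ r ^ 2 ∧
      ∫ x, (nuisancePart A π δ κ ξ' η' γ' x - nuisancePart A π δ κ ξ η γ x) ^ 2 ∂P ≤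
        (C * r) ^ 2 := by
  refine ⟨√(3 * ε⁻¹ ^ 2 * (8 + (9 + ε) ^ 2 * (2 * ε⁻¹) ^ 2)), Real.sqrt_nonneg _, fun r hr => ?_⟩
  obtain ⟨ξ', hξ', hr'⟩ := exists_boundedMeasurable_approx hm hξm hξ
    (show 0 < r ^ 2 by positivity)
  have bw := (hP.bdd_weight hm' hε).mono hm
  have bξ' := hξ'.mono hm
  have bξh : BoundedMeasurable fun x => ξ' x * ((π x - δ x) * (κ x)⁻¹) := bξ'.mul bw
  -- Only `ξ` is truncated: `η'` and `γ'` are recomputed from `ξ'` by conditioning, so that the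
  -- orthogonality relations hold exactly, and the contraction property keeps them close to `η` and
  -- `γ`.
  obtain ⟨η', bη', hη'⟩ := exists_boundedMeasurable_condExp (m := m₂) (Q := P) bξ'
  obtain ⟨γ', bγ', hγ'⟩ := exists_boundedMeasurable_condExp (m := m₂) (Q := P) bξh
  have hm2 := hm'.trans hm
  refine ⟨ξ', η', γ', hξ', bη', bγ',
    fun c hc => integral_sub_condExp_mul hm2 bξ'.integrable hη' hc,
    fun c hc => integral_sub_condExp_mul hm2 bξh.integrable hγ' hc, hr', ?_⟩
  have hξw := hP.memLp_mul_weight hm hm' hε hξ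
  have lη : MemLp η 2 P := (memLp_congr_ae hη).2 (hξ.condExp one_le_two)
  have lγ : MemLp γ 2 P := (memLp_congr_ae hγ).2 (hξw.condExp one_le_two)
  have i1 : Integrable (fun x => (ξ x - ξ' x) ^ 2) P :=
    (hξ.sub (bξ'.memLp 2)).integrable_sq
  have i2 : Integrable (fun x => (η x - η' x) ^ 2) P :=
    (lη.sub ((bη'.mono hm2).memLp 2)).integrable_sq
  have i3 : Integrable (fun x => (γ x - γ' x) ^ 2) P :=
    (lγ.sub ((bγ'.mono hm2).memLp 2)).integrable_sq
  have e2 := integral_sub_sq_le_of_condExp hm2 hξ (bξ'.memLp 2) hη hη'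
  have e3 := integral_sub_sq_le_of_condExp hm2 hξw (bξh.memLp 2) hγ hγ'
  have e4 : ∫ x, (ξ x * ((π x - δ x) * (κ x)⁻¹) - ξ' x * ((π x - δ x) * (κ x)⁻¹)) ^ 2 ∂P ≤
      (2 * ε⁻¹) ^ 2 * ∫ x, (ξ x - ξ' x) ^ 2 ∂P := by
    rw [← integral_const_mul]
    refine integral_mono_of_nonneg (.of_forall fun _ => sq_nonneg _) (i1.const_mul _)
      (.of_forall fun x => ?_)
    simp only [← sub_mul, mul_pow (ξ x - ξ' x)]
    rw [mul_comm]
    refine mul_le_mul_of_nonneg_right ?_ (sq_nonneg _)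
    rw [← sq_abs]; exact pow_le_pow_left₀ (abs_nonneg _) (hP.abs_weight_le hε x) 2
  have i12 : Integrable (fun x => 4 * (ξ x - ξ' x) ^ 2 + 4 * (η x - η' x) ^ 2) P :=
    (i1.const_mul 4).add (i2.const_mul 4)
  have i123 : Integrable (fun x => 4 * (ξ x - ξ' x) ^ 2 + 4 * (η x - η' x) ^ 2 +
      (9 + ε) ^ 2 * (γ x - γ' x) ^ 2) P := i12.add (i3.const_mul _)
  rw [mul_pow, Real.sq_sqrt (by positivity)]
  calc _ ≤ ∫ x, 3 * ε⁻¹ ^ 2 * (4 * (ξ x - ξ' x) ^ 2 + 4 * (η x - η' x) ^ 2 +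
        (9 + ε) ^ 2 * (γ x - γ' x) ^ 2) ∂P :=
        integral_mono_of_nonneg (.of_forall fun _ => sq_nonneg _) (i123.const_mul _)
          (.of_forall fun x => hP.nuisancePart_sub_sq_le hε hA1 ξ η γ ξ' η' γ' x)
    _ = 3 * ε⁻¹ ^ 2 * (4 * ∫ x, (ξ x - ξ' x) ^ 2 ∂P + 4 * ∫ x, (η x - η' x) ^ 2 ∂P +
        (9 + ε) ^ 2 * ∫ x, (γ x - γ' x) ^ 2 ∂P) := by
        rw [integral_const_mul, integral_add i12 (i3.const_mul _),
          integral_add (i1.const_mul 4) (i2.const_mul 4), integral_const_mul, integral_const_mul,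
          integral_const_mul]
    _ ≤ 3 * ε⁻¹ ^ 2 * (4 * r ^ 2 + 4 * r ^ 2 + (9 + ε) ^ 2 * ((2 * ε⁻¹) ^ 2 * r ^ 2)) := by
        have h2 := e2.trans hr'
        have h3 := (e3.trans e4).trans (mul_le_mul_of_nonneg_left hr' (sq_nonneg (2 * ε⁻¹)))
        gcongr
    _ = _ := by ring

end IsNuisance

/-! ### The nuisance part has mean zero. -/

section Centred

variable {X : Type*} {m₁ m₂ m0 : MeasurableSpace X} {P : Measure X} [IsProbabilityMeasure P]
  {A : X → ℝ} {ε : ℝ} {π δ κ ξ η γ : X → ℝ}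

namespace IsNuisance

/-- This is the second order bound at `q = p`: the weights coincide and the Hellinger distance is
zero, so only the integral of `nuisancePart` survives. -/
theorem integral_nuisancePart_eq_zero_of_bounded (hm : m₁ ≤ m0) (hm' : m₂ ≤ m₁) (hε : 0 < ε)
    (hA : Measurable A) (hA1 : ∀ x, |A x| ≤ 1) (hP : IsNuisance m₁ m₂ P A ε π δ κ)
    (hξ : @BoundedMeasurable X m₁ ξ) (hη : @BoundedMeasurable X m₂ η)
    (hγ : @BoundedMeasurable X m₂ γ)
    (hξη : ∀ c : X → ℝ, @BoundedMeasurable X m₂ c → ∫ x, (ξ x - η x) * c x ∂P = 0)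
    (hξγ : ∀ c : X → ℝ, @BoundedMeasurable X m₂ c →
      ∫ x, (ξ x * ((π x - δ x) * (κ x)⁻¹) - γ x) * c x ∂P = 0) :
    ∫ x, nuisancePart A π δ κ ξ η γ x ∂P = 0 := by
  have e : densityLaw P (fun _ => 1) = P := by simp [densityLaw]
  have hp : IsProbabilityMeasure (densityLaw P fun _ => 1) := by rw [e]; infer_instance
  rw [← e] at hP hξη hξγ
  obtain ⟨C, hC⟩ := exists_abs_remainder_le hm hm' hε measurable_const (fun _ => zero_le_one)
    hA hA1 hP hξ hη hγ hξη hξγ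
  have h := hC (fun _ => 1) measurable_const (fun _ => zero_le_one) hp π δ κ hP
  rw [e] at h
  simpa [hellingerSq] using h

theorem integral_nuisancePart_eq_zero (hm : m₁ ≤ m0) (hm' : m₂ ≤ m₁) (hε : 0 < ε)
    (hA : Measurable A) (hA1 : ∀ x, |A x| ≤ 1) (hP : IsNuisance m₁ m₂ P A ε π δ κ)
    (hξm : Measurable[m₁] ξ) (hξ : MemLp ξ 2 P) (hη : η =ᵐ[P] P[ξ | m₂])
    (hγ : γ =ᵐ[P] P[fun x => ξ x * ((π x - δ x) * (κ x)⁻¹) | m₂]) :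
    ∫ x, nuisancePart A π δ κ ξ η γ x ∂P = 0 := by
  obtain ⟨C, hC, happ⟩ := hP.exists_bounded_approx hm hm' hε hA1 hξm hξ hη hγ
  have hB := hP.memLp_nuisancePart hm hm' hε hA hA1 hξ ((memLp_congr_ae hη).2
    (hξ.condExp one_le_two)) ((memLp_congr_ae hγ).2
    ((hP.memLp_mul_weight hm hm' hε hξ).condExp one_le_two))
  have key : ∀ r : ℝ, 0 < r → |∫ x, nuisancePart A π δ κ ξ η γ x ∂P| ≤ C * r := fun r hr => by
    obtain ⟨ξ', η', γ', bξ, bη, bγ, oη, oγ, -, hle⟩ := happ r hr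
    have h0 := integral_nuisancePart_eq_zero_of_bounded hm hm' hε hA hA1 hP bξ bη bγ oη oγ
    have hB' := hP.memLp_nuisancePart hm hm' hε hA hA1 ((bξ.mono hm).memLp 2)
      ((bη.mono (hm'.trans hm)).memLp 2) ((bγ.mono (hm'.trans hm)).memLp 2)
    have h := abs_integral_mul_le_of_sq_le (hB'.sub hB) (memLp_const (1 : ℝ)) (by positivity)
      zero_le_one hle (by simp)
    simp only [mul_one, Pi.sub_apply] at h
    rwa [integral_sub (hB'.integrable one_le_two) (hB.integrable one_le_two), h0, zero_sub,
      abs_neg] at h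
  refine abs_eq_zero.1 (le_antisymm (le_of_forall_pos_le_add fun r hr => ?_) (abs_nonneg _))
  refine (key (r / (C + 1)) (by positivity)).trans ?_
  rw [zero_add, mul_div_assoc', div_le_iff₀ (by positivity)]
  nlinarith

end IsNuisance

end Centred

/-! ### Rate of the weight in `L²`. -/

section Weight

variable {X : Type*} {m₁ m₂ m0 : MeasurableSpace X} {ν : Measure X} {p q A : X → ℝ} {ε : ℝ}
  {π δ κ πQ δQ κQ : X → ℝ} [IsProbabilityMeasure (densityLaw ν p)]
  [IsProbabilityMeasure (densityLaw ν q)]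

theorem IsNuisance.integral_weight_sub_sq_le (hm : m₁ ≤ m0) (hm' : m₂ ≤ m₁) (hε : 0 < ε)
    (hp : Measurable p) (h0 : ∀ x, 0 ≤ p x) (hq : Measurable q) (hq0 : ∀ x, 0 ≤ q x)
    (hA : Measurable A) (hA1 : ∀ x, |A x| ≤ 1)
    (hP : IsNuisance m₁ m₂ (densityLaw ν p) A ε π δ κ)
    (hQ : IsNuisance m₁ m₂ (densityLaw ν q) A ε πQ δQ κQ) :
    ∫ x, ((πQ x - δQ x) * (κQ x)⁻¹ - (π x - δ x) * (κ x)⁻¹) ^ 2 ∂(densityLaw ν q) ≤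
      3 * ε⁻¹ ^ 2 * (80 + (2 * ε⁻¹) ^ 2 * rate ε) * hellingerSq ν p q := by
  have rπ := integral_pi_sub_sq_le hm hp h0 hq hq0 hA hA1 hP hQ
  have rδ := integral_delta_sub_sq_le (hm'.trans hm) hp h0 hq hq0 hA hA1 hP hQ
  have rκ := integral_kappa_sub_sq_le hm (hm'.trans hm) hε hp h0 hq hq0 hA hA1 hP hQ
  have b1 := hP.bdd_pi.mono hm
  have b2 := hP.bdd_delta.mono (hm'.trans hm)
  have b3 := hQ.bdd_pi.mono hm
  have b4 := hQ.bdd_delta.mono (hm'.trans hm)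
  have b5 := (hP.bdd_kappa hε).mono (hm'.trans hm)
  have b6 := (hQ.bdd_kappa hε).mono (hm'.trans hm)
  have I : ∀ {f : X → ℝ}, BoundedMeasurable f → Integrable f (densityLaw ν q) :=
    fun h => h.integrable
  calc _ ≤ ∫ x, 3 * ε⁻¹ ^ 2 * ((πQ x - π x) ^ 2 + (δQ x - δ x) ^ 2 +
        (2 * ε⁻¹) ^ 2 * (κQ x - κ x) ^ 2) ∂(densityLaw ν q) := by
        refine integral_mono_of_nonneg (.of_forall fun _ => sq_nonneg _) (I (by fun_prop))
          (.of_forall fun x => ?_)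
        have k1 : κ x * (κ x)⁻¹ = 1 := mul_inv_cancel₀ (hP.kappa_pos hε x).ne'
        have k2 : κQ x * (κQ x)⁻¹ = 1 := mul_inv_cancel₀ (hQ.kappa_pos hε x).ne'
        have hh := hP.abs_weight_le hε x
        have hw := hQ.abs_inv_kappa_le hε x
        simp only
        have e : (πQ x - δQ x) * (κQ x)⁻¹ - (π x - δ x) * (κ x)⁻¹ =
            (κQ x)⁻¹ * ((πQ x - π x) - (δQ x - δ x) -
              (π x - δ x) * (κ x)⁻¹ * (κQ x - κ x)) := by
          generalize (κ x)⁻¹ = w at k1 ⊢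
          generalize (κQ x)⁻¹ = wQ at k2 ⊢
          linear_combination (π x - δ x) * (w * k2 - wQ * k1)
        rw [e, mul_pow]
        generalize (π x - δ x) * (κ x)⁻¹ = h at hh ⊢
        generalize πQ x - π x = a
        generalize δQ x - δ x = d
        generalize κQ x - κ x = k
        have hh2 : h ^ 2 ≤ (2 * ε⁻¹) ^ 2 := by
          rw [← sq_abs]; exact pow_le_pow_left₀ (abs_nonneg _) hh 2
        have hw2 : (κQ x)⁻¹ ^ 2 ≤ ε⁻¹ ^ 2 := by
          rw [← sq_abs]; exact pow_le_pow_left₀ (abs_nonneg _) hw 2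
        calc _ ≤ ε⁻¹ ^ 2 * (3 * (a ^ 2 + d ^ 2 + h ^ 2 * k ^ 2)) := by
              refine mul_le_mul hw2 ?_ (sq_nonneg _) (sq_nonneg _)
              nlinarith [sq_nonneg (a + d), sq_nonneg (a + h * k), sq_nonneg (d - h * k)]
          _ ≤ ε⁻¹ ^ 2 * (3 * (a ^ 2 + d ^ 2 + (2 * ε⁻¹) ^ 2 * k ^ 2)) := by gcongr
          _ = _ := by ring
    _ = 3 * ε⁻¹ ^ 2 * (∫ x, (πQ x - π x) ^ 2 ∂(densityLaw ν q) +
        ∫ x, (δQ x - δ x) ^ 2 ∂(densityLaw ν q) +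
        (2 * ε⁻¹) ^ 2 * ∫ x, (κQ x - κ x) ^ 2 ∂(densityLaw ν q)) := by
        rw [integral_const_mul, integral_add (I (by fun_prop)) (I (by fun_prop)),
          integral_add (I (by fun_prop)) (I (by fun_prop)), integral_const_mul]
    _ ≤ 3 * ε⁻¹ ^ 2 * (40 * hellingerSq ν p q + 40 * hellingerSq ν p q +
        (2 * ε⁻¹) ^ 2 * (rate ε * hellingerSq ν p q)) := by gcongr
    _ = _ := by ring

end Weight

/-! ## The pathwise derivative -/

namespace QMDSubmodel

open IsNuisance

variable {X : Type*} {m₁ m₂ m0 : MeasurableSpace X} {P : Measure X} [IsProbabilityMeasure P]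
  (M : QMDSubmodel P)

theorem hasDerivAt_integral_of_bounded {F : X → ℝ} (hF : BoundedMeasurable F) :
    HasDerivAt (fun t => ∫ x, F x ∂(M.law t)) (∫ x, F x * M.score x ∂P) 0 := by
  obtain ⟨hFm, C, hC⟩ := id hF
  refine M.hasDerivAt_integral hFm (hF.pow 2).integrable (C := C ^ 2) ?_
  filter_upwards [M.isProb] with t ht
  have : IsProbabilityMeasure (M.law t) := ht
  refine ⟨(hF.pow 2).integrable, ?_⟩
  refine (integral_mono (hF.pow 2).integrable (integrable_const (C ^ 2)) fun x => ?_).trans_eq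
    (by simp)
  simp only
  rw [← sq_abs]; exact pow_le_pow_left₀ (abs_nonneg _) (hC x) 2

theorem integral_score_eq_zero : ∫ x, M.score x ∂P = 0 := by
  have h := M.hasDerivAt_integral_of_bounded (BoundedMeasurable.const 1)
  have h' : HasDerivAt (fun t => ∫ _, (1 : ℝ) ∂(M.law t)) 0 0 := by
    refine (hasDerivAt_const (0 : ℝ) (1 : ℝ)).congr_of_eventuallyEq ?_
    filter_upwards [M.isProb] with t ht
    have : IsProbabilityMeasure (M.law t) := ht
    simp
  simpa using h.unique h'

theorem eventually_abs_sub_le {f : ℝ → ℝ} {f' : ℝ} (h : HasDerivAt f f' 0) {ε : ℝ} (hε : 0 < ε) :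
    ∀ᶠ t in 𝓝 (0 : ℝ), |f t - f 0 - t * f'| ≤ ε * |t| := by
  rw [hasDerivAt_iff_isLittleO] at h
  filter_upwards [h.bound hε] with t ht
  simpa using ht

set_option maxHeartbeats 800000 in
/-- The derivative of `t ↦ ∫ Y (π_t - δ_t) / κ_t dP_t` along a submodel. -/
theorem hasDerivAt_of_isNuisance (hm : m₁ ≤ m0) (hm' : m₂ ≤ m₁) {A Y : X → ℝ} {ε₀ : ℝ}
    (hε₀ : 0 < ε₀) (hA : Measurable A) (hA1 : ∀ x, |A x| ≤ 1) (hY : Measurable Y)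
    (hY2 : MemLp Y 2 P) {C₀ : ℝ} (hC₀ : ∀ᶠ t in 𝓝 (0 : ℝ),
      Integrable (fun x => Y x ^ 2) (M.law t) ∧ ∫ x, Y x ^ 2 ∂(M.law t) ≤ C₀)
    {π δ κ ξ η γ : X → ℝ} (hP : IsNuisance m₁ m₂ P A ε₀ π δ κ)
    (hξm : Measurable[m₁] ξ) (hξ : ξ =ᵐ[P] P[Y | m₁]) (hη : η =ᵐ[P] P[ξ | m₂])
    (hγ : γ =ᵐ[P] P[fun x => ξ x * ((π x - δ x) * (κ x)⁻¹) | m₂])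
    {Ψ : ℝ → ℝ} (hΨ0 : Ψ 0 = ∫ x, Y x * ((π x - δ x) * (κ x)⁻¹) ∂P)
    (hΨ : ∀ᶠ t in 𝓝 (0 : ℝ), ∃ πQ δQ κQ, IsNuisance m₁ m₂ (M.law t) A ε₀ πQ δQ κQ ∧
      Ψ t = ∫ x, Y x * ((πQ x - δQ x) * (κQ x)⁻¹) ∂(M.law t)) :
    HasDerivAt Ψ (∫ x, (Y x * ((π x - δ x) * (κ x)⁻¹) + nuisancePart A π δ κ ξ η γ x) *
      M.score x ∂P) 0 := by
  have hm2 := hm'.trans hm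
  have hYi : Integrable Y P := hY2.integrable one_le_two
  have hξ2 : MemLp ξ 2 P := (memLp_congr_ae hξ).2 (hY2.condExp one_le_two)
  have hξw := hP.memLp_mul_weight hm hm' hε₀ hξ2
  have hη2 : MemLp η 2 P := (memLp_congr_ae hη).2 (hξ2.condExp one_le_two)
  have hγ2 : MemLp γ 2 P := (memLp_congr_ae hγ).2 (hξw.condExp one_le_two)
  have hB2 := hP.memLp_nuisancePart hm hm' hε₀ hA hA1 hξ2 hη2 hγ2
  have hYw := hP.memLp_mul_weight hm hm' hε₀ hY2
  have bw := (hP.bdd_weight hm' hε₀).mono hm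
  have hP0 : IsNuisance m₁ m₂ (densityLaw M.ν (M.p 0)) A ε₀ π δ κ := by
    rw [← M.law_eq_densityLaw, M.law_zero]; exact hP
  obtain ⟨D, hD0, hD⟩ := M.exists_hellingerSq_le
  obtain ⟨C₁, hC₁0, happ⟩ := hP.exists_bounded_approx hm hm' hε₀ hA1 hξm hξ2 hη hγ
  -- the rate of the weights
  set W : ℝ := 3 * ε₀⁻¹ ^ 2 * (80 + (2 * ε₀⁻¹) ^ 2 * IsNuisance.rate ε₀) with hW
  have hrate : 0 ≤ IsNuisance.rate ε₀ := by rw [IsNuisance.rate]; positivity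
  have hW0 : 0 ≤ W := by positivity
  set W' : ℝ := √(2 * W + 5 * (4 * ε₀⁻¹) ^ 2) with hW'
  set S : ℝ := √(∫ x, M.score x ^ 2 ∂P) with hS
  have hS2 : ∫ x, M.score x ^ 2 ∂P ≤ S ^ 2 := by
    rw [hS, Real.sq_sqrt (integral_nonneg fun _ => sq_nonneg _)]
  rw [hasDerivAt_iff_isLittleO, Asymptotics.isLittleO_iff]
  intro ε hε
  -- The accuracy of `ξ'` is fixed before `t`. It enters through `E2` with factor `W' * D` and
  -- through `E4` with factor `C₁ * S`, which together may cost `ε / 6`.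
  set r : ℝ := ε / (6 * (W' * D + C₁ * S + 1)) with hr
  have hpos : 0 < W' * D + C₁ * S + 1 := by positivity
  have hr0 : 0 < r := by positivity
  have hrε : (W' * D + C₁ * S) * r ≤ ε / 6 := by
    have : (W' * D + C₁ * S + 1) * r = ε / 6 := by
      rw [hr]; field_simp [hpos.ne']
    nlinarith
  obtain ⟨ξ', η', γ', bξ', bη', bγ', oη, oγ, aξ, aB⟩ := happ r hr0
  -- `C₂` may blow up as `r` shrinks, since it depends on the bounds of `ξ'`, `η'`, `γ'`; this is
  -- harmless because it multiplies `t²` and `r` is already fixed.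
  obtain ⟨C₂, hC₂⟩ := IsNuisance.exists_abs_remainder_le hm hm' hε₀ (M.measurable_p 0)
    (M.nonneg_p 0) hA hA1 hP0 bξ' bη' bγ'
    (by rw [← M.law_eq_densityLaw, M.law_zero]; exact oη)
    (by rw [← M.law_eq_densityLaw, M.law_zero]; exact oγ)
  have bA : BoundedMeasurable A := ⟨hA, 1, hA1⟩
  have bξ := bξ'.mono hm
  have bB : BoundedMeasurable (nuisancePart A π δ κ ξ' η' γ') := by
    have b1 := hP.bdd_pi.mono hm
    have b2 := hP.bdd_delta.mono hm2
    have b3 := (hP.bdd_kappa hε₀).mono hm2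
    have b4 := (hP.boundedMeasurable_inv hε₀).mono hm2
    have b5 := bη'.mono hm2
    have b6 := bγ'.mono hm2
    unfold nuisancePart
    fun_prop
  -- the influence function of the bounded problem is centred
  have hBzero := hP.integral_nuisancePart_eq_zero_of_bounded hm hm' hε₀ hA hA1 bξ' bη' bγ' oη oγ
  obtain ⟨-, K, hK⟩ := id bξ
  set F : X → ℝ := fun x => Y x - ξ' x with hF
  have hFm : Measurable F := hY.sub bξ.1
  set CF : ℝ := √(2 * C₀ + 2 * K ^ 2) with hCF
  have hFt : ∀ᶠ t in 𝓝 (0 : ℝ), Integrable (fun x => F x ^ 2) (M.law t) ∧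
      ∫ x, F x ^ 2 ∂(M.law t) ≤ CF ^ 2 := by
    filter_upwards [hC₀, M.isProb] with t ht hp
    have : IsProbabilityMeasure (M.law t) := hp
    have i1 : Integrable (fun x => F x ^ 2) (M.law t) :=
      ((memLp_two_of_integrable_sq hY ht.1).sub (bξ.memLp 2)).integrable_sq
    have i0 : 0 ≤ ∫ x, Y x ^ 2 ∂(M.law t) := integral_nonneg fun _ => sq_nonneg _
    refine ⟨i1, ?_⟩
    rw [hCF, Real.sq_sqrt (by nlinarith [ht.2, sq_nonneg K])]
    calc _ ≤ ∫ x, (2 * Y x ^ 2 + 2 * K ^ 2) ∂(M.law t) := by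
          refine integral_mono i1 ((ht.1.const_mul 2).add (integrable_const _)) fun x => ?_
          have : ξ' x ^ 2 ≤ K ^ 2 := by
            rw [← sq_abs]; exact pow_le_pow_left₀ (abs_nonneg _) (hK x) 2
          simp only [hF]
          nlinarith [sq_nonneg (Y x + ξ' x)]
      _ = 2 * ∫ x, Y x ^ 2 ∂(M.law t) + 2 * K ^ 2 := by
          rw [integral_add (ht.1.const_mul 2) (integrable_const _), integral_const_mul]; simp
      _ ≤ _ := by linarith [ht.2]
  have hF0 : Integrable (fun x => F x ^ 2) P ∧ ∫ x, F x ^ 2 ∂P ≤ CF ^ 2 := by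
    simpa only [M.law_zero] using hFt.self_of_nhds
  set τ : ℝ := ε / (6 * (2 * CF + 1)) with hτ
  have hpos' : 0 < 2 * CF + 1 := by positivity
  have hτ0 : 0 < τ := by positivity
  have hτε : 2 * CF * τ ≤ ε / 6 := by
    have : (2 * CF + 1) * τ = ε / 6 := by
      rw [hτ]; field_simp [hpos'.ne']
    nlinarith
  -- the first order terms
  have hYt : ∀ᶠ t in 𝓝 (0 : ℝ),
      Integrable (fun x => (Y x * ((π x - δ x) * (κ x)⁻¹)) ^ 2) (M.law t) ∧
      ∫ x, (Y x * ((π x - δ x) * (κ x)⁻¹)) ^ 2 ∂(M.law t) ≤ (2 * ε₀⁻¹) ^ 2 * C₀ := by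
    filter_upwards [hC₀] with t ht
    have hle : ∀ x, (Y x * ((π x - δ x) * (κ x)⁻¹)) ^ 2 ≤ (2 * ε₀⁻¹) ^ 2 * Y x ^ 2 := fun x => by
      rw [mul_pow, mul_comm]
      refine mul_le_mul_of_nonneg_right ?_ (sq_nonneg _)
      rw [← sq_abs]; exact pow_le_pow_left₀ (abs_nonneg _) (hP.abs_weight_le hε₀ x) 2
    have i : Integrable (fun x => (Y x * ((π x - δ x) * (κ x)⁻¹)) ^ 2) (M.law t) :=
      (ht.1.const_mul ((2 * ε₀⁻¹) ^ 2)).mono' ((hY.mul bw.1).pow_const 2).aestronglyMeasurable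
        (.of_forall fun x => by
          rw [Real.norm_eq_abs, abs_of_nonneg (sq_nonneg _)]; exact hle x)
    refine ⟨i, (integral_mono i (ht.1.const_mul _) hle).trans ?_⟩
    rw [integral_const_mul]
    exact mul_le_mul_of_nonneg_left ht.2 (by positivity)
  have d1 := eventually_abs_sub_le
    (M.hasDerivAt_integral (F := fun x => Y x * ((π x - δ x) * (κ x)⁻¹)) (hY.mul bw.1) hYw.integrable_sq hYt)
    (show 0 < ε / 6 by positivity)
  have d2 := eventually_abs_sub_le (M.hasDerivAt_integral_of_bounded bB)
    (show 0 < ε / 6 by positivity)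
  have d3 := M.integral_sq_mul_sub_sqrt_le (4 * ε₀⁻¹) (W * D ^ 2) hτ0
  have d4 := eventually_mul_abs_le (|C₂| * D ^ 2) (show 0 < ε / 6 by positivity)
  filter_upwards [hΨ, hD, hFt, hC₀, M.isProb, d1, d2, d3, d4]
    with t ⟨πQ, δQ, κQ, hQ, hΨt⟩ hDt hFt hYt hp d1 d2 d3 d4
  have : IsProbabilityMeasure (densityLaw M.ν (M.p t)) := hp
  have : IsProbabilityMeasure (M.law t) := hp
  have bwQ := (hQ.bdd_weight hm' hε₀).mono hm
  have hDt' : hellingerSq M.ν (M.p 0) (M.p t) ≤ D ^ 2 * t ^ 2 := by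
    rwa [mul_pow, sq_abs] at hDt
  set c : X → ℝ := fun x => (πQ x - δQ x) * (κQ x)⁻¹ - (π x - δ x) * (κ x)⁻¹ with hc
  have bc₁ : @BoundedMeasurable X m₁ c := (hQ.bdd_weight hm' hε₀).sub (hP.bdd_weight hm' hε₀)
  have bc : BoundedMeasurable c := bc₁.mono hm
  have hcB : ∀ x, |c x| ≤ 4 * ε₀⁻¹ := fun x => (abs_sub _ _).trans (by
    linarith [hP.abs_weight_le hε₀ x, hQ.abs_weight_le hε₀ x])
  have hcQ : ∫ x, c x ^ 2 ∂(densityLaw M.ν (M.p t)) ≤ W * D ^ 2 * t ^ 2 := by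
    refine (hP0.integral_weight_sub_sq_le hm hm' hε₀ (M.measurable_p 0) (M.nonneg_p 0)
      (M.measurable_p t) (M.nonneg_p t) hA hA1 hQ).trans ?_
    rw [mul_assoc W]
    exact mul_le_mul_of_nonneg_left hDt' hW0
  have hcP : ∫ x, c x ^ 2 ∂P ≤ (W' * D * |t|) ^ 2 := by
    have h := integral_sq_densityLaw_le (ν := M.ν) (M.measurable_p 0) (M.nonneg_p 0)
      (M.measurable_p t) (M.nonneg_p t) bc.1 hcB
    rw [← M.law_eq_densityLaw 0, M.law_zero] at h
    rw [mul_pow, mul_pow, hW', Real.sq_sqrt (by positivity), sq_abs]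
    have := mul_le_mul_of_nonneg_left hDt' (show 0 ≤ 5 * (4 * ε₀⁻¹) ^ 2 by positivity)
    linarith
  -- the two error terms
  have iF0 : Integrable (fun x => F x * c x) P :=
    (memLp_two_of_integrable_sq hFm hF0.1).integrable_mul (bc.memLp 2)
  have iFt : Integrable (fun x => F x * c x) (M.law t) :=
    (memLp_two_of_integrable_sq hFm hFt.1).integrable_mul (bc.memLp 2)
  -- The unbounded `F` is paired with the sum of the root densities, where it is bounded in `L²(ν)`;
  -- all the smallness comes from `c` times their difference.
  have E1 : |∫ x, F x * c x ∂(M.law t) - ∫ x, F x * c x ∂P| ≤ ε / 6 * |t| := by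
    have e : ∫ x, F x * c x ∂(M.law t) - ∫ x, F x * c x ∂P =
        ∫ x, F x * (√(M.p t x) + √(M.p 0 x)) * (c x * (√(M.p t x) - √(M.p 0 x))) ∂M.ν := by
      have h0 : Integrable (fun x => F x * c x) (densityLaw M.ν (M.p 0)) := by
        rw [← M.law_eq_densityLaw, M.law_zero]; exact iF0
      have h := integral_densityLaw_sub (M.measurable_p 0) (M.nonneg_p 0) (M.measurable_p t)
        (M.nonneg_p t) h0 iFt
      rw [← M.law_eq_densityLaw, ← M.law_eq_densityLaw, M.law_zero] at h
      rw [h]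
      congr 1; ext x; ring
    have m1 := (M.memLp_mul_sub_sqrt hFm hF0.1 hFt.1).2
    have m2 := (M.memLp_mul_sub_sqrt (t := t) bc.1 (bc.pow 2).integrable (bc.pow 2).integrable).1
    have b1 := (M.integral_sq_mul_add_sqrt_le hF0.1 hFt.1 hF0.2 hFt.2).2
    have b2 := d3 c bc.1 hcB hcQ
    rw [e]
    refine (abs_integral_mul_le_of_sq_le m1 m2 (by positivity) (by positivity) b1 b2).trans ?_
    calc _ = 2 * CF * τ * |t| := by ring
      _ ≤ _ := by gcongr
  -- Since `c` is `m₁`-measurable, `Y` may be replaced by `ξ` under `P`. No such replacement is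
  -- available under `M.law t`, whose regression function is different.
  have E2 : |∫ x, F x * c x ∂P| ≤ W' * D * r * |t| := by
    have e : ∫ x, F x * c x ∂P = ∫ x, (ξ x - ξ' x) * c x ∂P := by
      have h := integral_sub_condExp_mul hm hYi hξ bc₁
      have i2 : Integrable (fun x => (ξ x - ξ' x) * c x) P :=
        (hξ2.sub (bξ.memLp 2)).integrable_mul (bc.memLp 2)
      rw [← sub_eq_zero, ← integral_sub iF0 i2, ← h]
      congr 1; ext x; simp only [hF]; ring
    rw [e]
    refine (abs_integral_mul_le_of_sq_le (hξ2.sub (bξ.memLp 2)) (bc.memLp 2) hr0.le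
      (by positivity) aξ hcP).trans_eq (by ring)
  have E3 : |∫ x, ξ' x * c x ∂(M.law t) - ∫ x, nuisancePart A π δ κ ξ' η' γ' x ∂(M.law t)| ≤
      ε / 6 * |t| := by
    refine (hC₂ (M.p t) (M.measurable_p t) (M.nonneg_p t) hp πQ δQ κQ hQ).trans ?_
    have hH0 : 0 ≤ hellingerSq M.ν (M.p 0) (M.p t) := integral_nonneg fun _ => sq_nonneg _
    calc _ ≤ |C₂| * hellingerSq M.ν (M.p 0) (M.p t) :=
          mul_le_mul_of_nonneg_right (le_abs_self _) hH0
      _ ≤ |C₂| * (D ^ 2 * t ^ 2) := mul_le_mul_of_nonneg_left hDt' (abs_nonneg _)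
      _ = |C₂| * D ^ 2 * |t| * |t| := by rw [← sq_abs t]; ring
      _ ≤ _ := mul_le_mul_of_nonneg_right d4 (abs_nonneg _)
  have E4 : |∫ x, nuisancePart A π δ κ ξ' η' γ' x * M.score x ∂P -
      ∫ x, nuisancePart A π δ κ ξ η γ x * M.score x ∂P| ≤ C₁ * S * r := by
    have i1 : Integrable (fun x => nuisancePart A π δ κ ξ' η' γ' x * M.score x) P :=
      (bB.memLp 2).integrable_mul M.memLp_score
    have i2 : Integrable (fun x => nuisancePart A π δ κ ξ η γ x * M.score x) P :=
      hB2.integrable_mul M.memLp_score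
    rw [← integral_sub i1 i2]
    simp only [← sub_mul]
    refine (abs_integral_mul_le_of_sq_le ((bB.memLp 2).sub hB2) M.memLp_score (by positivity)
      (Real.sqrt_nonneg _) aB hS2).trans_eq (by ring)
  have expand : Ψ t - Ψ 0 - (t - 0) • ∫ x, (Y x * ((π x - δ x) * (κ x)⁻¹) +
      nuisancePart A π δ κ ξ η γ x) * M.score x ∂P =
      (∫ x, Y x * ((π x - δ x) * (κ x)⁻¹) ∂(M.law t) - ∫ x, Y x * ((π x - δ x) * (κ x)⁻¹) ∂P -
        t * ∫ x, Y x * ((π x - δ x) * (κ x)⁻¹) * M.score x ∂P) +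
      (∫ x, nuisancePart A π δ κ ξ' η' γ' x ∂(M.law t) -
        ∫ x, nuisancePart A π δ κ ξ' η' γ' x ∂P -
        t * ∫ x, nuisancePart A π δ κ ξ' η' γ' x * M.score x ∂P) +
      (∫ x, F x * c x ∂(M.law t) - ∫ x, F x * c x ∂P) + ∫ x, F x * c x ∂P +
      (∫ x, ξ' x * c x ∂(M.law t) - ∫ x, nuisancePart A π δ κ ξ' η' γ' x ∂(M.law t)) +
      t * (∫ x, nuisancePart A π δ κ ξ' η' γ' x * M.score x ∂P -
        ∫ x, nuisancePart A π δ κ ξ η γ x * M.score x ∂P) := by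
    have i1 : Integrable (fun x => ξ' x * c x) (M.law t) := (bξ.mul bc).integrable
    have i2 : Integrable (fun x => Y x * ((π x - δ x) * (κ x)⁻¹)) (M.law t) :=
      (memLp_two_of_integrable_sq hY hYt.1).integrable_mul (bw.memLp 2)
    have i3 : Integrable (fun x => F x * c x + ξ' x * c x) (M.law t) := iFt.add i1
    have e1 : Ψ t = ∫ x, F x * c x ∂(M.law t) + ∫ x, ξ' x * c x ∂(M.law t) +
        ∫ x, Y x * ((π x - δ x) * (κ x)⁻¹) ∂(M.law t) := by
      rw [hΨt, ← integral_add iFt i1, ← integral_add i3 i2]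
      congr 1; ext x; simp only [hF, hc]; ring
    have e2 : ∫ x, (Y x * ((π x - δ x) * (κ x)⁻¹) + nuisancePart A π δ κ ξ η γ x) *
        M.score x ∂P = ∫ x, Y x * ((π x - δ x) * (κ x)⁻¹) * M.score x ∂P +
        ∫ x, nuisancePart A π δ κ ξ η γ x * M.score x ∂P := by
      simp only [add_mul]
      exact integral_add (hYw.integrable_mul M.memLp_score) (hB2.integrable_mul M.memLp_score)
    rw [e1, hΨ0, e2, hBzero, smul_eq_mul]
    ring
  rw [M.law_zero] at d1 d2
  rw [expand, sub_zero, Real.norm_eq_abs, Real.norm_eq_abs]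
  have ht0 := abs_nonneg t
  have E4' : |t * (∫ x, nuisancePart A π δ κ ξ' η' γ' x * M.score x ∂P -
      ∫ x, nuisancePart A π δ κ ξ η γ x * M.score x ∂P)| ≤ C₁ * S * r * |t| := by
    rw [abs_mul, mul_comm]
    exact mul_le_mul_of_nonneg_right E4 ht0
  have total : ∀ {a₁ a₂ a₃ a₄ a₅ a₆ : ℝ}, |a₁ + a₂ + a₃ + a₄ + a₅ + a₆| ≤
      |a₁| + |a₂| + |a₃| + |a₄| + |a₅| + |a₆| := fun {a₁ a₂ a₃ a₄ a₅ a₆} => by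
    linarith [abs_add_le (a₁ + a₂ + a₃ + a₄ + a₅) a₆, abs_add_le (a₁ + a₂ + a₃ + a₄) a₅,
      abs_add_le (a₁ + a₂ + a₃) a₄, abs_add_le (a₁ + a₂) a₃, abs_add_le a₁ a₂]
  refine total.trans ?_
  have hfin := mul_le_mul_of_nonneg_right hrε ht0
  have hεt := mul_nonneg hε.le ht0
  linarith

end QMDSubmodel

/-! ## The influence function of `psiAda` -/

section

open Obs

variable {𝒵 ℒ : Type*} [MeasurableSpace 𝒵] [MeasurableSpace ℒ] {P : Measure (Obs 𝒵 ℒ)}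
  {ε : ℝ} {π δ κ : Obs 𝒵 ℒ → ℝ}

theorem Obs.abs_A_le {𝒵 ℒ : Type*} (o : Obs 𝒵 ℒ) : |o.A| ≤ 1 := by
  rw [← treatInd_one, abs_of_nonneg (treatInd_nonneg 1 o)]
  exact treatInd_le_one 1 o

theorem phiAda_ae_eq (ψ : ℝ) (hε : 0 < ε) (h : IsNuisance sigmaZL sigmaL P A ε π δ κ)
    (hπ : π =ᵐ[P] (trueNuisance P).π) (hδ : δ =ᵐ[P] (trueNuisance P).δ)
    (hκ : κ =ᵐ[P] (trueNuisance P).κ) :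
    phiAda ψ (trueNuisance P) =ᵐ[P] fun o => Y o * ((π o - δ o) * (κ o)⁻¹) +
      IsNuisance.nuisancePart A π δ κ (trueNuisance P).ξ (trueNuisance P).η
        (trueNuisance P).γ o - ψ := by
  filter_upwards [hπ, hδ, hκ] with o hπ hδ hκ
  have hne : κ o * (κ o)⁻¹ = 1 := mul_inv_cancel₀ (h.kappa_pos hε o).ne'
  simp only [phiAda, IsNuisance.nuisancePart]
  rw [← hπ, ← hδ, ← hκ]
  ring

variable [IsProbabilityMeasure P]

theorem eta_ae_eq : (trueNuisance P).η =ᵐ[P] P[(trueNuisance P).ξ | sigmaL] :=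
  (condExp_condExp_of_le sigmaL_le_sigmaZL sigmaZL_le).symm

/-- By the tower property `ξ` may be replaced by `Y`, after which `1 / κ` and `δ` are pulled out of
the conditioning on `L`. This form of `γ` supplies the orthogonality of `ξ w - γ` to functions of
`L`. -/
theorem gamma_ae_eq (hε : 0 < ε) (h : IsNuisance sigmaZL sigmaL P A ε π δ κ)
    (hπ : π =ᵐ[P] (trueNuisance P).π) (hδ : δ =ᵐ[P] (trueNuisance P).δ)
    (hκ : κ =ᵐ[P] (trueNuisance P).κ) (hY : MemLp Y 2 P) :
    (trueNuisance P).γ =ᵐ[P]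
      P[fun o => (trueNuisance P).ξ o * ((π o - δ o) * (κ o)⁻¹) | sigmaL] := by
  have hYi : Integrable Y P := hY.integrable one_le_two
  have hYπ : Integrable (fun o => Y o * propensity P 1 o) P :=
    hY.integrable_mul (memLp_propensity P 1 2)
  have hinv := h.boundedMeasurable_inv hε
  have hYw : Integrable (fun o => Y o * ((π o - δ o) * (κ o)⁻¹)) P :=
    (h.memLp_mul_weight sigmaZL_le sigmaL_le_sigmaZL hε hY).integrable one_le_two
  have hδb : @BoundedMeasurable _ sigmaL fun o => (κ o)⁻¹ * δ o := hinv.mul h.bdd_delta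
  have bdd : ∀ {c f : Obs 𝒵 ℒ → ℝ}, @BoundedMeasurable _ sigmaL c → Integrable f P →
      Integrable (fun o => c o * f o) P := fun hc hf => by
    obtain ⟨hc, C, hC⟩ := hc.mono sigmaL_le
    exact hf.bdd_mul hc.aestronglyMeasurable (.of_forall hC)
  have e1 : P[fun o => Y o * ((π o - δ o) * (κ o)⁻¹) | sigmaZL] =ᵐ[P]
      fun o => (trueNuisance P).ξ o * ((π o - δ o) * (κ o)⁻¹) :=
    condExp_mul_of_stronglyMeasurable_right
      (h.bdd_weight sigmaL_le_sigmaZL hε).1.stronglyMeasurable hYw hYi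
  have e2 : P[fun o => (trueNuisance P).ξ o * ((π o - δ o) * (κ o)⁻¹) | sigmaL] =ᵐ[P]
      P[fun o => Y o * ((π o - δ o) * (κ o)⁻¹) | sigmaL] :=
    (condExp_congr_ae e1.symm).trans (condExp_condExp_of_le sigmaL_le_sigmaZL sigmaZL_le)
  have e3 : (fun o => Y o * ((π o - δ o) * (κ o)⁻¹)) =ᵐ[P]
      (fun o => (κ o)⁻¹ * (Y o * propensity P 1 o)) - fun o => (κ o)⁻¹ * δ o * Y o := by
    filter_upwards [hπ] with o ho
    rw [ho]
    simp only [trueNuisance, Pi.sub_apply]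
    ring
  have e4 := condExp_mul_of_stronglyMeasurable_left (μ := P) hinv.1.stronglyMeasurable
    (bdd hinv hYπ) hYπ
  have e5 := condExp_mul_of_stronglyMeasurable_left (μ := P) hδb.1.stronglyMeasurable
    (bdd hδb hYi) hYi
  filter_upwards [e2, condExp_congr_ae (m := sigmaL) e3,
    condExp_sub (bdd hinv hYπ) (bdd hδb hYi) sigmaL, e4, e5, hδ, hκ, condExp_propensity P 1]
    with o e2 e3 e6 e4 e5 hδ hκ hp
  rw [e2, e3, e6, Pi.sub_apply]
  erw [e4, e5]
  simp only [Pi.mul_apply]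
  rw [hκ, hδ]
  simp only [trueNuisance, condCovariance]
  rw [hp, treatInd_one]
  ring

theorem memLp_nuisancePart_trueNuisance (hε : 0 < ε)
    (h : IsNuisance sigmaZL sigmaL P A ε π δ κ) (hπ : π =ᵐ[P] (trueNuisance P).π)
    (hδ : δ =ᵐ[P] (trueNuisance P).δ) (hκ : κ =ᵐ[P] (trueNuisance P).κ) (hY : MemLp Y 2 P) :
    MemLp (IsNuisance.nuisancePart A π δ κ (trueNuisance P).ξ (trueNuisance P).η
      (trueNuisance P).γ) 2 P := by
  have hξ : MemLp (trueNuisance P).ξ 2 P := hY.condExp one_le_two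
  exact h.memLp_nuisancePart sigmaZL_le sigmaL_le_sigmaZL hε boundedMeasurable_A.1 abs_A_le hξ
    (hY.condExp one_le_two) ((memLp_congr_ae (gamma_ae_eq hε h hπ hδ hκ hY)).2
      ((h.memLp_mul_weight sigmaZL_le sigmaL_le_sigmaZL hε hξ).condExp one_le_two))

theorem memLp_phiAda (hpos : Positivity P) (hY : MemLp Y 2 P) (ψ : ℝ) :
    MemLp (phiAda ψ (trueNuisance P)) 2 P := by
  obtain ⟨ε, hε, hpos⟩ := hpos
  obtain ⟨π, δ, κ, h, hπ, hδ, hκ⟩ := exists_isNuisance hpos hε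
  refine (memLp_congr_ae (phiAda_ae_eq ψ hε h hπ hδ hκ)).2 ?_
  exact ((h.memLp_mul_weight sigmaZL_le sigmaL_le_sigmaZL hε hY).add
    (memLp_nuisancePart_trueNuisance hε h hπ hδ hκ hY)).sub (memLp_const ψ)

theorem integral_phiAda (hpos : Positivity P) (hY : MemLp Y 2 P) :
    ∫ o, phiAda (psiAda P) (trueNuisance P) o ∂P = 0 := by
  obtain ⟨ε, hε, hpos⟩ := hpos
  obtain ⟨π, δ, κ, h, hπ, hδ, hκ⟩ := exists_isNuisance hpos hε
  have hξ : MemLp (trueNuisance P).ξ 2 P := hY.condExp one_le_two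
  have hγ := gamma_ae_eq hε h hπ hδ hκ hY
  have hw := h.memLp_mul_weight sigmaZL_le sigmaL_le_sigmaZL hε hY
  have hB := memLp_nuisancePart_trueNuisance hε h hπ hδ hκ hY
  have i1 := hw.integrable one_le_two
  have i2 := hB.integrable one_le_two
  have i12 : Integrable (fun o => Y o * ((π o - δ o) * (κ o)⁻¹) +
      IsNuisance.nuisancePart A π δ κ (trueNuisance P).ξ (trueNuisance P).η
        (trueNuisance P).γ o) P := i1.add i2
  have h0 : ∫ o, IsNuisance.nuisancePart A π δ κ (trueNuisance P).ξ (trueNuisance P).η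
      (trueNuisance P).γ o ∂P = 0 := h.integral_nuisancePart_eq_zero sigmaZL_le sigmaL_le_sigmaZL hε
    boundedMeasurable_A.1 abs_A_le stronglyMeasurable_condExp.measurable hξ eta_ae_eq hγ
  rw [integral_congr_ae (phiAda_ae_eq (psiAda P) hε h hπ hδ hκ),
    integral_sub i12 (integrable_const _), integral_add i1 i2, h0,
    ← psiAda_eq_integral hε h hπ hδ hκ hY]
  simp

theorem psiAda_eq (hpos : Positivity P) (hY : MemLp Y 2 P) :
    psiAda P = ∫ o, ((trueNuisance P).π o - (trueNuisance P).δ o) / (trueNuisance P).κ o * o.Y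
      ∂P := by
  obtain ⟨ε, hε, hpos⟩ := hpos
  obtain ⟨π, δ, κ, h, hπ, hδ, hκ⟩ := exists_isNuisance hpos hε
  rw [psiAda_eq_integral hε h hπ hδ hκ hY]
  refine integral_congr_ae ?_
  filter_upwards [hπ, hδ, hκ] with o hπ hδ hκ
  rw [hπ, hδ, hκ, div_eq_mul_inv, mul_comm]

theorem integral_sq_le_of_eLpNorm_le {X : Type*} [MeasurableSpace X] {μ : Measure X} {f : X → ℝ}
    (hf : Measurable f) {C : NNReal} (h : eLpNorm f 2 μ ≤ C) :
    MemLp f 2 μ ∧ ∫ x, f x ^ 2 ∂μ ≤ (C : ℝ) ^ 2 := by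
  have hm : MemLp f 2 μ := ⟨hf.aestronglyMeasurable, h.trans_lt ENNReal.coe_lt_top⟩
  refine ⟨hm, ?_⟩
  have e := hm.eLpNorm_eq_integral_rpow_norm two_ne_zero ENNReal.ofNat_ne_top
  simp only [ENNReal.toReal_ofNat, Real.rpow_ofNat, Real.norm_eq_abs, sq_abs] at e
  rw [e, ← ENNReal.ofReal_coe_nnreal, ENNReal.ofReal_le_ofReal_iff C.coe_nonneg] at h
  have h0 : 0 ≤ ∫ x, f x ^ 2 ∂μ := integral_nonneg fun _ => sq_nonneg _
  have h1 := pow_le_pow_left₀ (by positivity) h 2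
  rwa [← Real.rpow_natCast (_ ^ _), ← Real.rpow_mul h0, Nat.cast_ofNat,
    inv_mul_cancel₀ two_ne_zero, Real.rpow_one] at h1

/-- `phiAda` represents the pathwise derivative of `psiAda` along every regular submodel. -/
theorem hasDerivAt_psiAda (hY : MemLp Y 2 P) (M : QMDSubmodel P) (hM : M ∈ regularSubmodels P) :
    HasDerivAt (fun t => psiAda (M.law t))
      (∫ o, phiAda (psiAda P) (trueNuisance P) o * M.score o ∂P) 0 := by
  obtain ⟨⟨ε, hε, hpos⟩, C, hC⟩ := hM
  have hpos0 : PositivityWith P ε := M.law_zero ▸ hpos.self_of_nhds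
  obtain ⟨π, δ, κ, h, hπ, hδ, hκ⟩ := exists_isNuisance hpos0 hε
  have hξ : MemLp (trueNuisance P).ξ 2 P := hY.condExp one_le_two
  have hγ := gamma_ae_eq hε h hπ hδ hκ hY
  have hw := h.memLp_mul_weight sigmaZL_le sigmaL_le_sigmaZL hε hY
  have hB := memLp_nuisancePart_trueNuisance hε h hπ hδ hκ hY
  have hd := M.hasDerivAt_of_isNuisance (C₀ := (C : ℝ) ^ 2) (Ψ := fun t => psiAda (M.law t))
    sigmaZL_le sigmaL_le_sigmaZL hε boundedMeasurable_A.1 abs_A_le measurable_Y hY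
    (hC.mono fun t ht => by
      have := integral_sq_le_of_eLpNorm_le measurable_Y ht
      exact ⟨this.1.integrable_sq, this.2⟩) h
    stronglyMeasurable_condExp.measurable (.refl _ _) eta_ae_eq hγ
    (by simp only [M.law_zero]; exact psiAda_eq_integral hε h hπ hδ hκ hY) (by
      filter_upwards [hpos, hC, M.isProb] with t hpos hC hp
      have : IsProbabilityMeasure (M.law t) := hp
      obtain ⟨πQ, δQ, κQ, hQ, hπQ, hδQ, hκQ⟩ := exists_isNuisance hpos hε
      exact ⟨πQ, δQ, κQ, hQ, psiAda_eq_integral hε hQ hπQ hδQ hκQ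
        (integral_sq_le_of_eLpNorm_le measurable_Y hC).1⟩)
  convert hd using 1
  have hs : Integrable M.score P := M.memLp_score.integrable one_le_two
  have i1 := (hw.add hB).integrable_mul M.memLp_score
  have e : ∫ o, phiAda (psiAda P) (trueNuisance P) o * M.score o ∂P =
      ∫ o, ((Y o * ((π o - δ o) * (κ o)⁻¹) + IsNuisance.nuisancePart A π δ κ
        (trueNuisance P).ξ (trueNuisance P).η (trueNuisance P).γ o) * M.score o -
        psiAda P * M.score o) ∂P := by
    refine integral_congr_ae ?_
    filter_upwards [phiAda_ae_eq (psiAda P) hε h hπ hδ hκ] with o ho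
    rw [ho]; ring
  rw [e]
  refine (integral_sub i1 (hs.const_mul _)).trans ?_
  -- Scores have mean zero, so the centring constant in `phiAda` does not affect the derivative.
  rw [integral_const_mul, M.integral_score_eq_zero, mul_zero, sub_zero]
  rfl

end

/-! ## Conditional expectations under two comparable laws -/

section

variable {X : Type*} {m m' m0 : MeasurableSpace X} {P Q : Measure[m0] X} {c : ℝ} {f : X → ℝ}

theorem integral_le_mul_of_le_smul (hc : 0 ≤ c) (hQP : Q ≤ ENNReal.ofReal c • P)
    (h0 : 0 ≤ᵐ[P] f) (hf : Integrable f P) : ∫ x, f x ∂Q ≤ c * ∫ x, f x ∂P := by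
  have h := integral_mono_measure (f := f) hQP
    (Measure.ae_mono' Measure.smul_absolutelyContinuous h0) (hf.smul_measure ENNReal.ofReal_ne_top)
  rwa [integral_smul_measure, ENNReal.toReal_ofReal hc, smul_eq_mul] at h

theorem restrict_le_smul_restrict (hQP : Q ≤ ENNReal.ofReal c • P) (s : Set X) :
    Q.restrict s ≤ ENNReal.ofReal c • P.restrict s :=
  (Measure.restrict_mono_measure hQP s).trans_eq (Measure.restrict_smul _ _ _)

/-- Over an `m`-measurable set, one factor `c` is lost in passing from `P` to `Q`, where the
conditional expectation can be removed, and another in returning to `P`. -/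
theorem condExp_le_sq_mul_condExp [IsProbabilityMeasure P] [IsProbabilityMeasure Q] (hm : m ≤ m0)
    (hc : 0 ≤ c) (hQP : Q ≤ ENNReal.ofReal c • P) (hPQ : P ≤ ENNReal.ofReal c • Q)
    (h0 : ∀ x, 0 ≤ f x) (hf : Integrable f P) :
    ∀ᵐ x ∂P, (Q[f | m]) x ≤ c ^ 2 * (P[f | m]) x := by
  have hfQ : Integrable f Q := hf.of_measure_le_smul ENNReal.ofReal_ne_top hQP
  have hi : Integrable (Q[f | m]) P :=
    integrable_condExp.of_measure_le_smul ENNReal.ofReal_ne_top hPQ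
  have hn : 0 ≤ᵐ[Q] Q[f | m] := condExp_nonneg (.of_forall h0)
  have hs2 : StronglyMeasurable[m] fun x => c ^ 2 * (P[f | m]) x :=
    stronglyMeasurable_condExp.const_mul _
  refine ae_le_of_ae_le_trim (hm := hm) (ae_le_of_forall_setIntegral_le
    (hi.trim hm stronglyMeasurable_condExp)
    ((integrable_condExp.const_mul _).trim hm hs2) fun s hs _ => ?_)
  rw [← setIntegral_trim hm stronglyMeasurable_condExp hs, ← setIntegral_trim hm hs2 hs,
    integral_const_mul, setIntegral_condExp hm hf hs]
  calc ∫ x in s, (Q[f | m]) x ∂P ≤ c * ∫ x in s, (Q[f | m]) x ∂Q :=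
        integral_le_mul_of_le_smul hc (restrict_le_smul_restrict hPQ s)
          (ae_restrict_of_ae hn) integrable_condExp.integrableOn
    _ = c * ∫ x in s, f x ∂Q := by rw [setIntegral_condExp hm hfQ hs]
    _ ≤ c * (c * ∫ x in s, f x ∂P) := mul_le_mul_of_nonneg_left
        (integral_le_mul_of_le_smul hc (restrict_le_smul_restrict hQP s) (.of_forall h0)
          hf.integrableOn) hc
    _ = c ^ 2 * ∫ x in s, f x ∂P := by ring

theorem abs_condExp_sub_condExp_le [IsProbabilityMeasure P] [IsProbabilityMeasure Q] (hm : m ≤ m0)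
    (hc : 1 ≤ c) (hQP : Q ≤ ENNReal.ofReal c • P) (hPQ : P ≤ ENNReal.ofReal c • Q)
    (hf : Integrable f P) (h0 : ∀ x, 0 ≤ f x) (h1 : ∀ x, f x ≤ 1) :
    ∀ᵐ x ∂P, |(Q[f | m]) x - (P[f | m]) x| ≤ c ^ 2 - 1 := by
  have hc0 : 0 ≤ c := zero_le_one.trans hc
  have hac : P ≪ Q := Measure.absolutelyContinuous_of_le_smul hPQ
  have hfQ : Integrable f Q := hf.of_measure_le_smul ENNReal.ofReal_ne_top hQP
  have h01 : ∀ x, 0 ≤ f x ∧ f x ≤ 1 := fun x => ⟨h0 x, h1 x⟩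
  filter_upwards [condExp_le_sq_mul_condExp hm hc0 hQP hPQ h0 hf,
    hac.ae_le (condExp_le_sq_mul_condExp hm hc0 hPQ hQP h0 hfQ),
    condExp_mem_Icc hm hf (.of_forall h01), hac.ae_le (condExp_mem_Icc hm hfQ (.of_forall h01))]
    with x a1 a2 a3 a4
  have hc2 : 0 ≤ c ^ 2 - 1 := by nlinarith
  refine abs_le.2 ⟨?_, ?_⟩
  · nlinarith [mul_le_mul_of_nonneg_left a4.2 hc2]
  · nlinarith [mul_le_mul_of_nonneg_left a3.2 hc2]

/-- Conditional variances of propensities under comparable laws are comparable. -/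
theorem condVar_condExp_le [IsProbabilityMeasure P] [IsProbabilityMeasure Q] (hm : m ≤ m')
    (hm' : m' ≤ m0) (hc : 1 ≤ c) (hQP : Q ≤ ENNReal.ofReal c • P)
    (hPQ : P ≤ ENNReal.ofReal c • Q) (hf : Integrable f P) (h0 : ∀ x, 0 ≤ f x)
    (h1 : ∀ x, f x ≤ 1) :
    ∀ᵐ x ∂P, (Var[P[f | m']; P | m]) x ≤
      c ^ 2 * (Var[Q[f | m']; Q | m]) x + 4 * (c ^ 2 - 1) := by
  have hc0 : 0 ≤ c := zero_le_one.trans hc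
  have hac : P ≪ Q := Measure.absolutelyContinuous_of_le_smul hPQ
  have hfQ : Integrable f Q := hf.of_measure_le_smul ENNReal.ofReal_ne_top hQP
  have h01 : ∀ x, 0 ≤ f x ∧ f x ≤ 1 := fun x => ⟨h0 x, h1 x⟩
  have hmm := hm.trans hm'
  have sq_le : ∀ (μ : Measure[m0] X) [IsProbabilityMeasure μ], Integrable f μ →
      ∀ᵐ x ∂μ, |(μ[f | m']) x - (μ[μ[f | m'] | m]) x| ≤ 1 := fun μ _ hR => by
    filter_upwards [condExp_mem_Icc hm' hR (.of_forall h01),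
      condExp_mem_Icc hmm integrable_condExp (condExp_mem_Icc hm' hR (.of_forall h01))]
      with x a b
    exact abs_le.2 ⟨by linarith [a.1, b.2], by linarith [a.2, b.1]⟩
  have int_sq : ∀ (μ : Measure[m0] X) [IsProbabilityMeasure μ], Integrable f μ →
      Integrable ((μ[f | m'] - μ[μ[f | m'] | m]) ^ 2) μ := fun μ _ hR => by
    refine .of_bound ((integrable_condExp.sub integrable_condExp).1.pow 2) 1 ?_
    filter_upwards [sq_le μ hR] with x hx
    rw [Real.norm_eq_abs, abs_of_nonneg (sq_nonneg _)]
    exact sq_le_one_iff_abs_le_one _ |>.2 hx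
  have iQ := (int_sq Q hfQ)
  have iQP : Integrable ((Q[f | m'] - Q[Q[f | m'] | m]) ^ 2) P :=
    iQ.of_measure_le_smul ENNReal.ofReal_ne_top hPQ
  -- The difference of the two squares factors into a sum bounded by `2` and a difference bounded by
  -- `2 (c² - 1)`, whence the additive error. Changing the outer conditional expectation afterwards
  -- costs the factor `c²`.
  have hle : (P[f | m'] - P[P[f | m'] | m]) ^ 2 ≤ᵐ[P]
      (Q[f | m'] - Q[Q[f | m'] | m]) ^ 2 + fun _ => 4 * (c ^ 2 - 1) := by
    filter_upwards [sq_le P hf, hac.ae_le (sq_le Q hfQ),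
      abs_condExp_sub_condExp_le hm' hc hQP hPQ hf h0 h1,
      abs_condExp_sub_condExp_le hmm hc hQP hPQ hf h0 h1,
      condExp_condExp_of_le (μ := P) (f := f) hm hm',
      hac.ae_eq (condExp_condExp_of_le (μ := Q) (f := f) hm hm')] with x a b d e tP tQ
    simp only [Pi.pow_apply, Pi.sub_apply, Pi.add_apply]
    rw [tP] at a ⊢
    rw [tQ] at b ⊢
    set p := (P[f | m']) x
    set q := (Q[f | m']) x
    set p' := (P[f | m]) x
    set q' := (Q[f | m]) x
    have e1 : |(p - p') + (q - q')| ≤ 2 := (abs_add_le _ _).trans (by linarith)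
    have e2 : |(p' - q') - (p - q)| ≤ 2 * (c ^ 2 - 1) := by
      rw [abs_le] at d e ⊢
      constructor <;> linarith [d.1, d.2, e.1, e.2]
    have e3 : |((p - p') + (q - q')) * ((p' - q') - (p - q))| ≤ 2 * (2 * (c ^ 2 - 1)) := by
      rw [abs_mul]; exact mul_le_mul e1 e2 (abs_nonneg _) zero_le_two
    have e4 := (abs_le.1 e3).1
    nlinarith
  have hmono := condExp_mono (m := m) (int_sq P hf) (iQP.add (integrable_const _)) hle
  have hsq := condExp_le_sq_mul_condExp (f := (Q[f | m'] - Q[Q[f | m'] | m]) ^ 2) hmm hc0 hPQ hQP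
    (fun x => sq_nonneg _) iQ
  filter_upwards [hmono, condExp_add iQP (integrable_const (4 * (c ^ 2 - 1))) m, hac.ae_le hsq]
    with x a b d
  rw [b, Pi.add_apply, condExp_const hmm] at a
  exact a.trans (by simpa [condVar] using d)

end

/-! ## Submodels with bounded scores and the tangent space -/

section

/-- With `r = √(1 + u)` the error is exactly `(r - 1)² / 2`, while `u = (r - 1)(r + 1)` with `r + 1
≥ 1`. -/
theorem abs_sqrt_one_add_sub_le {u : ℝ} (hu : -1 ≤ u) : |√(1 + u) - 1 - u / 2| ≤ u ^ 2 / 2 := by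
  set r := √(1 + u)
  have hr : 0 ≤ r := Real.sqrt_nonneg _
  have h : r ^ 2 = 1 + u := Real.sq_sqrt (by linarith)
  have e : r - 1 - u / 2 = -((r - 1) ^ 2 / 2) := by linear_combination h / 2
  have hu2 : u ^ 2 = (r - 1) ^ 2 * (r + 1) ^ 2 := by
    rw [show u = r ^ 2 - 1 by linarith only [h]]; ring
  rw [e, abs_neg, abs_of_nonneg (by positivity), hu2]
  have : 1 ≤ (r + 1) ^ 2 := by nlinarith
  nlinarith [mul_le_mul_of_nonneg_left this (sq_nonneg (r - 1))]

variable {X : Type*} {g : X → ℝ}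

/-- The density `1 + t g`, truncated at zero. -/
def tiltDensity (g : X → ℝ) (t : ℝ) (x : X) : ℝ := max 0 (1 + t * g x)

theorem tiltDensity_zero (x : X) : tiltDensity g 0 x = 1 := by simp [tiltDensity]

theorem abs_mul_le_of_abs_le {K b t : ℝ} {x : X} (hK : ∀ x, |g x| ≤ K) (ht : K * |t| ≤ b) :
    |t * g x| ≤ b := by
  rw [abs_mul, mul_comm]
  exact (mul_le_mul_of_nonneg_right (hK x) (abs_nonneg t)).trans ht

theorem tiltDensity_eq {K t : ℝ} (hK : ∀ x, |g x| ≤ K) (ht : K * |t| ≤ 1) (x : X) :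
    tiltDensity g t x = 1 + t * g x :=
  max_eq_right (by linarith [(abs_le.1 (abs_mul_le_of_abs_le (x := x) hK ht)).1])

theorem eventually_mul_abs_le_of_pos (K : ℝ) {b : ℝ} (hb : 0 < b) :
    ∀ᶠ t in 𝓝 (0 : ℝ), K * |t| ≤ b := by
  have h : Tendsto (fun t : ℝ => K * |t|) (𝓝 0) (𝓝 0) := by
    have : Continuous fun t : ℝ => K * |t| := by fun_prop
    simpa using this.tendsto 0
  exact (h.eventually_lt_const hb).mono fun t ht => ht.le

variable [MeasurableSpace X] {P : Measure X}

theorem measurable_tiltDensity (hg : Measurable g) (t : ℝ) : Measurable (tiltDensity g t) :=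
  measurable_const.max ((hg.const_mul t).const_add 1)

theorem withDensity_tilt_le {K t : ℝ} (hK : ∀ x, |g x| ≤ K) (ht : K * |t| ≤ 1 / 2) :
    (P.withDensity fun x => ENNReal.ofReal (tiltDensity g t x)) ≤
      ENNReal.ofReal (1 + 2 * (K * |t|)) • P := by
  rw [← withDensity_const]
  refine withDensity_mono (.of_forall fun x => ENNReal.ofReal_le_ofReal ?_)
  have h := abs_le.1 (abs_mul_le_of_abs_le (x := x) (t := t) hK le_rfl)
  have : 0 ≤ K * |t| := (abs_nonneg _).trans (abs_mul_le_of_abs_le (x := x) (t := t) hK le_rfl)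
  rw [tiltDensity_eq hK (by linarith)]
  linarith [h.2]

/-- For `a = K |t| ≤ 1 / 2` one has `(1 + 2a)(1 - a) = 1 + a (1 - 2a) ≥ 1`, so the constant of the
upper comparison also serves in the reverse direction. -/
theorem le_smul_withDensity_tilt {K t : ℝ} (hg : Measurable g) (hK : ∀ x, |g x| ≤ K)
    (ht : K * |t| ≤ 1 / 2) :
    P ≤ ENNReal.ofReal (1 + 2 * (K * |t|)) •
      P.withDensity fun x => ENNReal.ofReal (tiltDensity g t x) := by
  rw [← withDensity_smul _ (measurable_tiltDensity hg t).ennreal_ofReal]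
  refine (withDensity_one (μ := P)).symm.le.trans (withDensity_mono (.of_forall fun x => ?_))
  have h := abs_le.1 (abs_mul_le_of_abs_le (x := x) (t := t) hK le_rfl)
  have h0 : 0 ≤ K * |t| := (abs_nonneg _).trans (abs_mul_le_of_abs_le (x := x) (t := t) hK le_rfl)
  rw [Pi.one_apply, Pi.smul_apply, smul_eq_mul, ← ENNReal.ofReal_mul (by positivity),
    ENNReal.one_le_ofReal, tiltDensity_eq hK (by linarith)]
  nlinarith [h.1]

theorem norm_toLp_sq {f : X → ℝ} (hf : MemLp f 2 P) : ‖hf.toLp f‖ ^ 2 = ∫ x, f x ^ 2 ∂P := by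
  rw [← real_inner_self_eq_norm_sq, L2.inner_def]
  refine integral_congr_ae ?_
  filter_upwards [hf.coeFn_toLp] with x hx
  rw [hx, real_inner_self_eq_norm_sq, Real.norm_eq_abs, sq_abs]

variable [IsProbabilityMeasure P]

theorem isProbabilityMeasure_tilt {K t : ℝ} (hg : Measurable g) (hK : ∀ x, |g x| ≤ K)
    (h0 : ∫ x, g x ∂P = 0) (ht : K * |t| ≤ 1) :
    IsProbabilityMeasure (P.withDensity fun x => ENNReal.ofReal (tiltDensity g t x)) := by
  have hi : Integrable g P := BoundedMeasurable.integrable ⟨hg, K, hK⟩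
  have hi' : Integrable (fun x => 1 + t * g x) P := (integrable_const 1).add (hi.const_mul t)
  simp only [tiltDensity_eq hK ht]
  refine ⟨?_⟩
  rw [withDensity_apply _ .univ, Measure.restrict_univ, ← ofReal_integral_eq_lintegral_ofReal hi',
    integral_add (integrable_const 1) (hi.const_mul t), integral_const_mul, h0]
  · simp
  · exact .of_forall fun x => by
      have := (abs_le.1 (abs_mul_le_of_abs_le (x := x) hK ht)).1
      simp only [Pi.zero_apply]; linarith

theorem isLittleO_tiltDensity (hg : BoundedMeasurable g) :
    (fun t : ℝ => ∫ x, (√(tiltDensity g t x) - √(tiltDensity g 0 x) -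
      t / 2 * g x * √(tiltDensity g 0 x)) ^ 2 ∂P) =o[𝓝 0] fun t => t ^ 2 := by
  obtain ⟨hg, K, hK⟩ := hg
  have h1 : (fun t : ℝ => ∫ x, (√(tiltDensity g t x) - √(tiltDensity g 0 x) -
      t / 2 * g x * √(tiltDensity g 0 x)) ^ 2 ∂P) =O[𝓝 0] fun t => t ^ 4 := by
    refine .of_bound (K ^ 4 / 4) ?_
    filter_upwards [eventually_mul_abs_le_of_pos K one_pos] with t ht
    have key : ∀ x, ‖(√(tiltDensity g t x) - √(tiltDensity g 0 x) -
        t / 2 * g x * √(tiltDensity g 0 x)) ^ 2‖ ≤ K ^ 4 / 4 * ‖t ^ 4‖ := fun x => by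
      have hu := abs_mul_le_of_abs_le (x := x) hK ht
      have h2 := abs_sqrt_one_add_sub_le (abs_le.1 hu).1
      have hgK : g x ^ 4 ≤ K ^ 4 := by
        rw [← Even.pow_abs (by decide) (g x)]
        exact pow_le_pow_left₀ (abs_nonneg _) (hK x) 4
      rw [tiltDensity_zero, tiltDensity_eq hK ht, Real.sqrt_one, Real.norm_eq_abs,
        abs_of_nonneg (sq_nonneg _), Real.norm_eq_abs, abs_of_nonneg (by positivity : 0 ≤ t ^ 4)]
      calc (√(1 + t * g x) - 1 - t / 2 * g x * 1) ^ 2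
          = |√(1 + t * g x) - 1 - t * g x / 2| ^ 2 := by rw [sq_abs]; ring
        _ ≤ ((t * g x) ^ 2 / 2) ^ 2 := pow_le_pow_left₀ (abs_nonneg _) h2 2
        _ = g x ^ 4 / 4 * t ^ 4 := by ring
        _ ≤ K ^ 4 / 4 * t ^ 4 := by gcongr
    exact (norm_integral_le_of_norm_le_const (.of_forall key)).trans_eq (by simp)
  exact h1.trans_isLittleO (Asymptotics.isLittleO_pow_pow (by norm_num))

/-- The submodel with densities `1 + t g` with respect to `P`, for a bounded score `g` of mean
zero. -/
def boundedScoreSubmodel (P : Measure X) [IsProbabilityMeasure P] (g : X → ℝ)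
    (hg : BoundedMeasurable g) (h0 : ∫ x, g x ∂P = 0) : QMDSubmodel P where
  ν := P
  sigmaFinite := inferInstance
  p := tiltDensity g
  score := g
  measurable_p := measurable_tiltDensity hg.1
  nonneg_p _ _ := le_max_left _ _
  isProb := by
    obtain ⟨K, hK⟩ := hg.2
    exact (eventually_mul_abs_le_of_pos K one_pos).mono fun t ht =>
      isProbabilityMeasure_tilt hg.1 hK h0 ht
  base := by simp [tiltDensity_zero]
  memLp_score := hg.memLp 2
  qmd := isLittleO_tiltDensity hg

theorem integral_sub_integral_sq_le {f : X → ℝ} (hf : MemLp f 2 P) :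
    ∫ x, (f x - ∫ y, f y ∂P) ^ 2 ∂P ≤ ∫ x, f x ^ 2 ∂P := by
  have hi := hf.integrable one_le_two
  set a := ∫ y, f y ∂P
  have e : ∀ x, (f x - a) ^ 2 = f x ^ 2 + (a ^ 2 - 2 * a * f x) := fun x => by ring
  simp only [e]
  have hi2 : Integrable (fun x => a ^ 2 - 2 * a * f x) P :=
    (integrable_const _).sub (hi.const_mul _)
  rw [integral_add hf.integrable_sq hi2, integral_sub (integrable_const _) (hi.const_mul _), integral_const_mul]
  simp only [integral_const, probReal_univ, one_smul]
  nlinarith [sq_nonneg a]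

/-- If `S` contains all submodels with bounded scores, then every square integrable function of
mean zero belongs to the tangent space. -/
theorem toLp_mem_tangentSpace {S : Set (QMDSubmodel P)}
    (hS : ∀ g (hg : BoundedMeasurable g) (h0 : ∫ x, g x ∂P = 0), boundedScoreSubmodel P g hg h0 ∈ S)
    {f : X → ℝ} (hfm : Measurable f) (hf : MemLp f 2 P) (h0 : ∫ x, f x ∂P = 0) :
    hf.toLp f ∈ tangentSpace P S := by
  rw [tangentSpace, ← SetLike.mem_coe, Submodule.topologicalClosure_coe, Metric.mem_closure_iff]
  intro ε hε
  obtain ⟨g, hg, hfg⟩ := exists_boundedMeasurable_approx le_rfl hfm hf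
    (ε := (ε / 2) ^ 2) (by positivity)
  set a := ∫ x, g x ∂P with ha
  -- A score must have mean zero, so the truncation is recentred. As `f` is centred, this amounts to
  -- centring `f - g`, which cannot increase its `L²` norm.
  have hb : BoundedMeasurable fun x => g x - a := hg.sub (.const a)
  have hb0 : ∫ x, (g x - a) ∂P = 0 := by
    rw [integral_sub hg.integrable (integrable_const _)]; simp [ha]
  refine ⟨_, Submodule.subset_span ⟨_, hS _ hb hb0, rfl⟩, ?_⟩
  have hd : MemLp (fun x => f x - g x) 2 P := hf.sub (hg.memLp 2)
  have hda : ∫ x, (f x - g x) ∂P = -a := by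
    rw [integral_sub (hf.integrable one_le_two) hg.integrable, h0, zero_sub]
  have h2 : ‖(hf.sub (hb.memLp 2)).toLp (f - fun x => g x - a)‖ ^ 2 ≤ (ε / 2) ^ 2 := by
    rw [norm_toLp_sq]
    refine le_trans (le_of_eq ?_) ((integral_sub_integral_sq_le hd).trans hfg)
    rw [hda]
    refine integral_congr_ae (.of_forall fun x => ?_)
    simp only [Pi.sub_apply]; ring
  rw [dist_eq_norm]
  exact (abs_le_of_sq_le_sq' h2 (by positivity)).2.trans_lt (by linarith)

end

/-! ### Bounded tilts are regular submodels. -/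

section

open Obs

variable {𝒵 ℒ : Type*} [MeasurableSpace 𝒵] [MeasurableSpace ℒ] {P : Measure (Obs 𝒵 ℒ)}

theorem measurable_phiAda (ψ : ℝ) : Measurable (phiAda ψ (trueNuisance P)) := by
  have hZL : ∀ f : Obs 𝒵 ℒ → ℝ, Measurable (P[f | sigmaZL]) := fun f =>
    stronglyMeasurable_condExp.measurable.mono sigmaZL_le le_rfl
  have hL : ∀ f : Obs 𝒵 ℒ → ℝ, Measurable (P[f | sigmaL]) := fun f =>
    stronglyMeasurable_condExp.measurable.mono sigmaL_le le_rfl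
  have hcov : ∀ f g : Obs 𝒵 ℒ → ℝ, Measurable (condCovariance sigmaL P f g) := fun f g =>
    (hL _).sub ((hL _).mul (hL _))
  have hπ : Measurable (trueNuisance P).π := hZL _
  have hδ : Measurable (trueNuisance P).δ := hL _
  have hκ : Measurable (trueNuisance P).κ := hcov _ _
  have hξ : Measurable (trueNuisance P).ξ := hZL _
  have hη : Measurable (trueNuisance P).η := hL _
  have hγ : Measurable (trueNuisance P).γ := (hcov _ _).div (hcov _ _)
  have hA : Measurable (A : Obs 𝒵 ℒ → ℝ) := boundedMeasurable_A.1
  have hY : Measurable (Y : Obs 𝒵 ℒ → ℝ) := measurable_Y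
  unfold phiAda
  fun_prop

variable [IsProbabilityMeasure P]

theorem boundedScoreSubmodel_mem_regularSubmodels (hpos : Positivity P) (hY : MemLp Y 2 P)
    (g : Obs 𝒵 ℒ → ℝ) (hg : BoundedMeasurable g) (h0 : ∫ o, g o ∂P = 0) :
    boundedScoreSubmodel P g hg h0 ∈ regularSubmodels P := by
  obtain ⟨ε, hε, hpos⟩ := hpos
  obtain ⟨K, hK⟩ := hg.2
  constructor
  · refine ⟨ε / 2, by positivity, ?_⟩
    -- At `t = 0` the expression is `ε / 2 < ε`. Together with the comparison of conditional
    -- variances this leaves `ε / 2` as a common positivity constant near `0`.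
    have hlim : ∀ᶠ t in 𝓝 (0 : ℝ), (1 + 2 * (K * |t|)) ^ 2 * (ε / 2) +
        4 * ((1 + 2 * (K * |t|)) ^ 2 - 1) < ε := by
      have hc : Continuous fun t : ℝ => (1 + 2 * (K * |t|)) ^ 2 * (ε / 2) +
        4 * ((1 + 2 * (K * |t|)) ^ 2 - 1) := by fun_prop
      exact hc.tendsto 0 |>.eventually_lt_const (by simp; linarith)
    filter_upwards [eventually_mul_abs_le_of_pos K one_half_pos, hlim,
      (boundedScoreSubmodel P g hg h0).isProb] with t ht hlt hp a
    have : IsProbabilityMeasure ((boundedScoreSubmodel P g hg h0).law t) := hp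
    have hQP := withDensity_tilt_le (P := P) hK ht
    have hPQ := le_smul_withDensity_tilt (P := P) hg.1 hK ht
    have hc : 1 ≤ 1 + 2 * (K * |t|) := by
      obtain ⟨o⟩ := nonempty_of_isProbabilityMeasure P
      have := mul_nonneg ((abs_nonneg _).trans (hK o)) (abs_nonneg t)
      linarith
    have hv := condVar_condExp_le sigmaL_le_sigmaZL sigmaZL_le hc
      (Q := (boundedScoreSubmodel P g hg h0).law t) hQP hPQ (boundedMeasurable_treatInd a).integrable
      (treatInd_nonneg a) (treatInd_le_one a)
    refine (Measure.absolutelyContinuous_of_le_smul hQP).ae_le ?_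
    filter_upwards [hv, hpos a] with o h1 h2
    have h3 := (h2.trans h1).trans' hlt.le
    have h4 : 0 < (1 + 2 * (K * |t|)) ^ 2 := by positivity
    exact le_of_mul_le_mul_left (le_of_add_le_add_right h3) h4
  -- Once `K |t| ≤ 1 / 2` the tilted law is at most `2 • P`, which multiplies the `L²` norm of `Y`
  -- by at most `√2`.
  · refine ⟨((2 : ENNReal) ^ (1 / (2 : ENNReal)).toReal • eLpNorm Y 2 P).toNNReal, ?_⟩
    filter_upwards [eventually_mul_abs_le_of_pos K one_half_pos] with t ht
    have hfin : (2 : ENNReal) ^ (1 / (2 : ENNReal)).toReal • eLpNorm Y 2 P ≠ ⊤ :=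
      ENNReal.mul_ne_top (ENNReal.rpow_ne_top_of_nonneg ENNReal.toReal_nonneg
        ENNReal.ofNat_ne_top) hY.2.ne
    rw [ENNReal.coe_toNNReal hfin]
    refine eLpNorm_le_of_measure_le_smul ((withDensity_tilt_le (P := P) hK ht).trans ?_)
    gcongr
    exact ENNReal.ofReal_le_of_le_toReal (by simp; linarith)

end

end

theorem mainTheorem6
    {Ω 𝒵 ℒ 𝒰 : Type*}
    [MeasurableSpace Ω] [StandardBorelSpace Ω]
    [MeasurableSpace 𝒵] [MeasurableSpace ℒ] [MeasurableSpace 𝒰]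
    (μ : Measure Ω) [IsProbabilityMeasure μ]
    -- instrument, treatment, outcome, observed covariates, latent confounders, potential outcomes
    (Z : Ω → 𝒵) (A : Ω → Fin 2) (Y : Ω → ℝ) (L : Ω → ℒ) (U : Ω → 𝒰) (Ypot : Fin 2 → Ω → ℝ)
    (hZ : Measurable Z) (hA : Measurable A) (hY : Measurable Y) (hL : Measurable L)
    (hU : Measurable U) (hYpot : ∀ a, Measurable (Ypot a))
    -- finite second moment of the outcome
    (hY2 : MemLp Y 2 μ)
    -- the law of the observed data
    (P : Measure (Obs 𝒵 ℒ)) (hP : P = μ.map fun ω => (Z ω, A ω, Y ω, L ω))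
    -- consistency
    (hcons : ∀ᵐ ω ∂μ, Y ω = Ypot (A ω) ω)
    -- latent ignorability
    (hign : ∀ a, CondIndepFun (MeasurableSpace.comap (fun ω => (U ω, L ω)) inferInstance)
      (hU.prodMk hL).comap_le (Ypot a) (fun ω => (A ω, Z ω)) μ)
    -- IV independence
    (hind : CondIndepFun (MeasurableSpace.comap L inferInstance) hL.comap_le Z U μ)
    -- IV relevance and positivity
    (hrel : IVRelevance P)
    (hpos : Positivity P) :
    psiAda P =
        ∫ o, ((trueNuisance P).π o - (trueNuisance P).δ o) / (trueNuisance P).κ o * o.Y ∂P ∧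
      IsEIF psiAda P (regularSubmodels P) (phiAda (psiAda P) (trueNuisance P)) := by
  have hO : Measurable fun ω => (Z ω, A ω, Y ω, L ω) := hZ.prodMk (hA.prodMk (hY.prodMk hL))
  have hprob : IsProbabilityMeasure P := hP ▸ Measure.isProbabilityMeasure_map hO.aemeasurable
  have hYP : MemLp Obs.Y 2 P := by
    rw [hP]
    exact (memLp_map_measure_iff Obs.measurable_Y.aestronglyMeasurable hO.aemeasurable).2 hY2
  refine ⟨psiAda_eq hpos hYP, integral_phiAda hpos hYP, hasDerivAt_psiAda hYP,
    memLp_phiAda hpos hYP _, ?_⟩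
  exact toLp_mem_tangentSpace (boundedScoreSubmodel_mem_regularSubmodels hpos hYP)
    (measurable_phiAda _) (memLp_phiAda hpos hYP _) (integral_phiAda hpos hYP)
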